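/- **Conventions.** A schema $\sigma$ is a finite non-empty set of relation symbols, each with an arity $\mathrm{ar}(R)\ge 1$. A conjunctive query (CQ) $Q$ of schema $\sigma$ has the form $\mathrm{Ans}(z_1,\dots,z_\ell)\leftarrow \alpha_1,\dots,\alpha_d$ with $\ell\ge 0$, $d\ge 1$, where every $\alpha_j=R(x_1,\dots,x_r)$ with $R\in\sigma$, $r=\mathrm{ar}(R)$, is an atom with variable set $\mathrm{vars}(\alpha_j)=\{x_1,\dots,x_r\}$, and $z_1,\dots,z_\ell$ are pairwise distinct variables that occur in the atoms. Put $\mathrm{atoms}(Q)=\{\alpha_1,\dots,\alpha_d\}$, $\mathrm{vars}(Q)=\bigcup_j\mathrm{vars}(\alpha_j)$, $\mathrm{free}(Q)=\{z_1,\dots,z_\ell\}$, and $\|Q\|=\ell+\sum_{j=1}^d \mathrm{ar}(\alpha_j)$, where $\mathrm{ar}(\alpha_j)$ is the arity of the relation symbol of $\alpha_j$. The hypergraph $H(Q)$ has vertex set $\mathrm{vars}(Q)$ and the hyperedges $\mathrm{vars}(\alpha)$, $\alpha\in\mathrm{atoms}(Q)$. A hypergraph is $\alpha$-acyclic if there is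 a tree whose nodes are precisely its hyperedges such that for every vertex $x$ the hyperedges containing $x$ induce a connected subtree. $Q$ is free-connex acyclic (an fc-ACQ) if both $H(Q)$ and the hypergraph obtained from $H(Q)$ by adding the hyperedge $\mathrm{free}(Q)$ are $\alpha$-acyclic. A free-connex generalized hypertree decomposition of width 1 (fc-1-GHD) of $Q$ is a tuple $(T,\mathrm{bag},\mathrm{cover},W)$ such that 1. $T$ is a finite undirected tree; 2. $\mathrm{bag}(t)\subseteq\mathrm{vars}(Q)$ for every node $t$ of $T$; for every $\alpha\in\mathrm{atoms}(Q)$ there is a node $t$ with $\mathrm{vars}(\alpha)\subseteq\mathrm{bag}(t)$; and for every $y\in\mathrm{vars}(Q)$ the set $\{t : y\in\mathrm{bag}(t)\}$ induces a connected (non-empty) subtree of $T$; 3. $\mathrm{cover}(t)\in\mathrm{atoms}(Q)$ and $\mathrm{bag}(t)\subseteq\mathrm{vars}(\mathrm{cover}(t))$ for every node $t$; 4. the witness $W$ is a set of nodes that induces a connected (non-empty) subtree of $T$, and $\mathrm{free}(Q)=\bigcup_{t\in W}\mathrm{bag}(t)$. It is complete if for every $\alpha\in\mathrm{atoms}(Q)$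 there is a node $t$ with $\mathrm{bag}(t)=\mathrm{vars}(\alpha)$ and $\mathrm{cover}(t)=\alpha$. **Proposition.** There are an algorithm on a random access machine with uniform cost measure (natural-number registers and memory cells, indirect addressing, addition and truncated subtraction, memory initially $0$; relation symbols and variables are given as natural numbers) and a constant $c$, both independent of the schema, such that the following holds. For every schema $\sigma$ and every fc-ACQ $Q$ of schema $\sigma$, on input $Q$ the algorithm halts after at most $c\cdot\|Q\|$ steps and outputs (its number of nodes, all bags, covers, edges, and the witness, where a cover is given by the position of the atom in the body of $Q$) a complete fc-1-GHD $(T,\mathrm{bag},\mathrm{cover},W)$ of $Q$ such that * $|W|<2\cdot|\mathrm{free}(Q)|$ if $\mathrm{free}(Q)\neq\emptyset$, and $|W|=1$ if $\mathrm{free}(Q)=\emptyset$; * for every edge $\{t,p\}$ of $T$, $\mathrm{bag}(t)\subseteq\mathrm{bag}(p)$ or $\mathrm{bag}(p)\subseteq\mathrm{bag}(t)$. -/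

import Mathlib

/-! ## Random access machines with uniform cost -/

namespace RAM

/-- Structured programs of a random access machine. The machine has registers, addressed by
constants, a memory of cells that is addressed indirectly through registers, a sequential input
tape and a sequential output tape; all of them hold natural numbers. A program mentions only
finitely many registers. The only arithmetic is addition and truncated subtraction. (A structured
program is a special case of a goto program with the same elementary instructions and tests.) -/
inductive Prog : Type
  /-- do nothing -/
  | skip : Prog
  /-- `r := n` -/
  | const (r n : ℕ) : Prog
  /-- `r := a` -/
  | copy (r a : ℕ) : Prog
  /-- `r := a + b` -/
  | add (r a b : ℕ) : Prog
  /-- `r := a - b` (truncated at `0`) -/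
  | sub (r a b : ℕ) : Prog
  /-- `r := mem[a]` -/
  | load (r a : ℕ) : Prog
  /-- `mem[a] := r` -/
  | store (a r : ℕ) : Prog
  /-- move the next number of the input tape into `r` (`0` when the tape is exhausted) -/
  | read (r : ℕ) : Prog
  /-- append the content of `r` to the output tape -/
  | write (r : ℕ) : Prog
  /-- run two programs one after the other -/
  | seq (p q : Prog) : Prog
  /-- run `p` if `r` is nonzero, and `q` otherwise -/
  | ite (r : ℕ) (p q : Prog) : Prog
  /-- run `p` as long as `r` is nonzero -/
  | while (r : ℕ) (p : Prog) : Prog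

/-- A configuration of the machine. -/
structure State where
  reg : ℕ → ℕ
  mem : ℕ → ℕ
  input : List ℕ
  output : List ℕ

/-- The initial configuration on input `w`: all registers and memory cells are `0`. -/
def State.init (w : List ℕ) : State where
  reg := fun _ => 0
  mem := fun _ => 0
  input := w
  output := []

/-- Assign the value `v` to the register `r`. -/
def State.setReg (s : State) (r v : ℕ) : State :=
  { s with reg := Function.update s.reg r v }

/-- `Exec p s t s'`: started in `s`, the program `p` halts in `s'` after exactly `t` steps. Every
elementary instruction and every test costs one step. -/
inductive Exec : Prog → State → ℕ → State → Prop
  | skip (s : State) : Exec .skip s 1 s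
  | const (r n : ℕ) (s : State) : Exec (.const r n) s 1 (s.setReg r n)
  | copy (r a : ℕ) (s : State) : Exec (.copy r a) s 1 (s.setReg r (s.reg a))
  | add (r a b : ℕ) (s : State) : Exec (.add r a b) s 1 (s.setReg r (s.reg a + s.reg b))
  | sub (r a b : ℕ) (s : State) : Exec (.sub r a b) s 1 (s.setReg r (s.reg a - s.reg b))
  | load (r a : ℕ) (s : State) : Exec (.load r a) s 1 (s.setReg r (s.mem (s.reg a)))
  | store (a r : ℕ) (s : State) :
      Exec (.store a r) s 1 { s with mem := Function.update s.mem (s.reg a) (s.reg r) }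
  | read (r : ℕ) (s : State) :
      Exec (.read r) s 1 { s.setReg r (s.input.headD 0) with input := s.input.tail }
  | write (r : ℕ) (s : State) :
      Exec (.write r) s 1 { s with output := s.output ++ [s.reg r] }
  | seq {p q : Prog} {s s' s'' : State} {t t' : ℕ} :
      Exec p s t s' → Exec q s' t' s'' → Exec (.seq p q) s (t + t') s''
  | ite_true {r : ℕ} {p q : Prog} {s s' : State} {t : ℕ} :
      s.reg r ≠ 0 → Exec p s t s' → Exec (.ite r p q) s (t + 1) s'
  | ite_false {r : ℕ} {p q : Prog} {s s' : State} {t : ℕ} :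
      s.reg r = 0 → Exec q s t s' → Exec (.ite r p q) s (t + 1) s'
  | while_true {r : ℕ} {p : Prog} {s s' s'' : State} {t t' : ℕ} :
      s.reg r ≠ 0 → Exec p s t s' → Exec (.while r p) s' t' s'' →
      Exec (.while r p) s (t + t' + 1) s''
  | while_false {r : ℕ} {p : Prog} {s : State} :
      s.reg r = 0 → Exec (.while r p) s 1 s

/-- On input tape `w`, the program `p` halts after exactly `t` steps with output tape `w'`. -/
def Computes (p : Prog) (w : List ℕ) (t : ℕ) (w' : List ℕ) : Prop :=
  ∃ s : State, Exec p (State.init w) t s ∧ s.output = w'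

end RAM

/-! ## Conjunctive queries -/

namespace FCQ

/-- A schema: a finite, non-empty set of relation symbols with positive arities. Relation symbols
are (named by) natural numbers. -/
structure Schema where
  symbols : Finset ℕ
  symbols_nonempty : symbols.Nonempty
  ar : ℕ → ℕ
  ar_pos : ∀ R ∈ symbols, 0 < ar R

/-- The countably infinite set of variables. -/
abbrev Var : Type := ℕ

/-- An atom `R(x₁, …, x_r)` of schema `σ`. -/
structure Atom (σ : Schema) where
  rel : ℕ
  rel_mem : rel ∈ σ.symbols
  args : List Var
  args_length : args.length = σ.ar rel

/-- The set of variables of an atom. -/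
def Atom.vars {σ : Schema} (α : Atom σ) : Finset Var := α.args.toFinset

/-- A conjunctive query `Ans(z₁, …, z_ℓ) ← α₁, …, α_d` with `d ≥ 1` and pairwise distinct
`z₁, …, z_ℓ` that occur in the body. -/
structure CQ (σ : Schema) where
  head : List Var
  body : List (Atom σ)
  body_ne_nil : body ≠ []
  head_nodup : head.Nodup
  head_subset : ∀ z ∈ head, ∃ α ∈ body, z ∈ α.vars

namespace CQ

variable {σ : Schema}

/-- The set of atoms of a query. -/
def atoms (Q : CQ σ) : Set (Atom σ) := {α | α ∈ Q.body}

/-- The set of variables of a query. -/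
def vars (Q : CQ σ) : Set Var := {x | ∃ α ∈ Q.atoms, x ∈ α.vars}

/-- The set of free variables of a query. -/
def free (Q : CQ σ) : Finset Var := Q.head.toFinset

/-- The size `‖Q‖`: the arity of the query plus the sum of the arities of its atoms. -/
def size (Q : CQ σ) : ℕ := Q.head.length + (Q.body.map fun α => σ.ar α.rel).sum

/-- The hypergraph `H(Q)`. -/
def hypergraph (Q : CQ σ) : Hypergraph Var where
  vertexSet := Q.vars
  edgeSet := {e | ∃ α ∈ Q.atoms, e = (α.vars : Set Var)}
  subset_vertexSet_of_mem_edgeSet' := by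
    rintro e ⟨α, hα, rfl⟩ x hx
    exact ⟨α, hα, hx⟩

/-- The hypergraph obtained from `H(Q)` by adding the hyperedge `free(Q)`. -/
def hypergraphWithFree (Q : CQ σ) : Hypergraph Var where
  vertexSet := Q.vars
  edgeSet := insert (Q.free : Set Var) Q.hypergraph.edgeSet
  subset_vertexSet_of_mem_edgeSet' := by
    rintro e (rfl | he)
    · intro x hx
      exact Q.head_subset x (by simpa [free] using hx)
    · exact Q.hypergraph.subset_vertexSet_of_mem_edgeSet' he

end CQ

/-- `α`-acyclicity: there is a join-tree, i.e. a tree whose nodes are precisely the hyperedges and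
in which, for every vertex `x`, the hyperedges containing `x` induce a connected subtree. -/
def AlphaAcyclic (H : Hypergraph Var) : Prop :=
  ∃ T : SimpleGraph H.edgeSet, T.IsTree ∧
    ∀ x ∈ H.vertexSet, (T.induce {t : H.edgeSet | x ∈ t.1}).Preconnected

/-- Free-connex acyclic conjunctive queries. -/
def CQ.IsFreeConnexAcyclic {σ : Schema} (Q : CQ σ) : Prop :=
  AlphaAcyclic Q.hypergraph ∧ AlphaAcyclic Q.hypergraphWithFree

/-! ## Decompositions -/

/-- A free-connex generalized hypertree decomposition of width 1 of the query `Q`, with the node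
set `V` of its tree. (`SimpleGraph.Connected` includes non-emptiness.) -/
structure FC1GHD {σ : Schema} (Q : CQ σ) (V : Type) [Fintype V] where
  tree : SimpleGraph V
  tree_isTree : tree.IsTree
  bag : V → Finset Var
  bag_subset : ∀ t, (bag t : Set Var) ⊆ Q.vars
  atom_covered : ∀ α ∈ Q.atoms, ∃ t, α.vars ⊆ bag t
  path_condition : ∀ y ∈ Q.vars, (tree.induce {t | y ∈ bag t}).Connected
  cover : V → Atom σ
  cover_mem : ∀ t, cover t ∈ Q.atoms
  bag_subset_cover : ∀ t, bag t ⊆ (cover t).vars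
  witness : Finset V
  witness_connected : (tree.induce (witness : Set V)).Connected
  free_eq : (Q.free : Set Var) = ⋃ t ∈ witness, (bag t : Set Var)

/-- Completeness: every atom is the cover of a node whose bag is the atom's set of variables. -/
def FC1GHD.IsComplete {σ : Schema} {Q : CQ σ} {V : Type} [Fintype V] (H : FC1GHD Q V) : Prop :=
  ∀ α ∈ Q.atoms, ∃ t, α.vars = H.bag t ∧ α = H.cover t

/-! ## Representation of queries and decompositions as sequences of numbers -/

/-- A list, preceded by its length. -/
def encodeList (l : List ℕ) : List ℕ := l.length :: l

/-- The representation of a query `Ans(z₁, …, z_ℓ) ← α₁, …, α_d`: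
`ℓ, z₁, …, z_ℓ, d`, followed by `R, r, x₁, …, x_r` for each of the atoms `R(x₁, …, x_r)`. -/
def CQ.encode {σ : Schema} (Q : CQ σ) : List ℕ :=
  encodeList Q.head ++ Q.body.length :: Q.body.flatMap fun α => α.rel :: encodeList α.args

/-- `H.Represents w`: the list `w` is a representation of the decomposition `H`, namely the number
`n` of nodes; then, for each node `t = 0, …, n - 1`, the bag of `t` (its size, and its elements in
some order) and a position (counted from `0`) of the atom `cover t` in the body of `Q`; then the
number of edges and the edges, each as the pair of its endpoints; then the number of elements of
the witness and its elements. -/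
def FC1GHD.Represents {σ : Schema} {Q : CQ σ} {n : ℕ} (H : FC1GHD Q (Fin n)) (w : List ℕ) : Prop :=
  ∃ (bags : Fin n → List ℕ) (covers : Fin n → ℕ) (edges : List (Fin n × Fin n))
    (wit : List (Fin n)),
    (∀ t, (bags t).Nodup ∧ (bags t).toFinset = H.bag t) ∧
    (∀ t, Q.body[covers t]? = some (H.cover t)) ∧
    (edges.map fun e => s(e.1, e.2)).Nodup ∧
    (∀ e : Sym2 (Fin n), e ∈ H.tree.edgeSet ↔ e ∈ edges.map fun e => s(e.1, e.2)) ∧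
    wit.Nodup ∧ wit.toFinset = H.witness ∧
    w = n :: ((List.finRange n).flatMap fun t => encodeList (bags t) ++ [covers t])
      ++ edges.length :: (edges.flatMap fun e => [(e.1 : ℕ), (e.2 : ℕ)])
      ++ encodeList (wit.map fun t => (t : ℕ))

end FCQ

/-! ## A small language with arrays and lists, compiled to the random access machine -/

namespace RAM

/-! The algorithm is a maximum cardinality search, run twice. A search keeps a set of marked
variables, repeatedly selects an unselected atom with the largest number of marked variables, and
marks its remaining variables. The first run marks only free variables, so it treats the traces of
the atoms on free(Q); the second run marks everything.

Acyclicity enters as ear elimination: removing leaves of a join tree gives an order in which every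
hyperedge meets the remaining ones inside a single one (`Elim.exists_of_isTree`). The search builds
such an order from its end. The base `X` holds the sets already selected, the list `R` the rest, and
`Elim.exchange` is the crucial step: if the trace of `e ∈ R` on `⋃₀ X` is maximal under inclusion,
then it lies in one member of `X`, and `e` can join the base. A trace with the largest number of
elements is maximal, so counting marked variables suffices. The first run starts from the base {∅}
with the hyperedges intersected with free(Q). The second starts from {free(Q), ∅}: the hyperedge
free(Q) of the extended hypergraph can be exchanged into the base because over {∅} all traces are
empty. That free(Q) itself need not be a bag is harmless, as its intersection with every atom became
a bag during the first run.

Selecting an atom adds two nodes: one whose bag `S` is the set of its marked variables, and a child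
of it whose bag consists of all its variables allowed in this run. The parent of the first is the
node `p` that is the latest among the first occurrences (owners) of the variables in `S`; since `S`
lies in some bag, running intersection pulls it down into the bag of `p` (`NodeInv.subset_owner`).
Thus adjacent bags are comparable. With an initial empty node there are 4d + 1 nodes for d atoms,
and the second run makes the decomposition complete.

The witness collects the two nodes of each selection of the first run that marks a new variable, but
only the second node for the first such selection. Each such selection uses up a free variable, so
|W| + 1 ≤ 2 |free(Q)|; without free variables the initial node is the witness. Selections with empty
`S` are attached to the first witness node `dflt`, which keeps the witness connected.

For linear time, atoms lie in buckets by priority, with lazy deletion. The potential heap entries +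
`top` - 3 · (sum of priorities) pays for the updates and for every step of the search. The program
is written in a language with bounded loops whose clock counts only loop iterations; `Cmd.sim` shows
that compilation costs a constant factor. -/

/-- Scalar variables. -/
inductive Reg
  | len | x | y | e | cnt | tot | top | ph | id | dflt | par | fresh | wit
  deriving DecidableEq

/-- Arrays of numbers. -/
inductive Arr
  | isFree | last | owner | bucket | done
  deriving DecidableEq

/-- Arrays of lists. -/
inductive Lst
  | occ | vars | heap | atoms | edges | wit
  deriving DecidableEq

/-- The number of a scalar variable. -/
def Reg.idx : Reg → ℕ
  | .len => 0 | .x => 1 | .y => 2 | .e => 3 | .cnt => 4 | .tot => 5 | .top => 6 | .ph => 7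
  | .id => 8 | .dflt => 9 | .par => 10 | .fresh => 11 | .wit => 12

/-- The residue of the addresses of an array. -/
def Arr.idx : Arr → ℕ
  | .isFree => 0 | .last => 1 | .owner => 2 | .bucket => 3 | .done => 4

/-- The residue of the addresses of an array of lists. -/
def Lst.idx : Lst → ℕ
  | .occ => 8 | .vars => 9 | .heap => 10 | .atoms => 11 | .edges => 12 | .wit => 13

theorem Reg.idx_inj {a b : Reg} : a.idx = b.idx ↔ a = b := by
  cases a <;> cases b <;> simp [Reg.idx]

theorem Arr.idx_inj {a b : Arr} : a.idx = b.idx ↔ a = b := by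
  cases a <;> cases b <;> simp [Arr.idx]

theorem Lst.idx_inj {a b : Lst} : a.idx = b.idx ↔ a = b := by
  cases a <;> cases b <;> simp [Lst.idx]

theorem Arr.idx_lt (a : Arr) : a.idx < 8 := by cases a <;> simp [Arr.idx]

theorem Lst.idx_lt (a : Lst) : a.idx < 14 := by cases a <;> simp [Lst.idx]

theorem Lst.le_idx (a : Lst) : 8 ≤ a.idx := by cases a <;> simp [Lst.idx]

/-- The states of the language. The field `time` counts the iterations of loops. -/
structure Store where
  v : Reg → ℕ
  A : Arr → ℕ → ℕ
  L : Lst → ℕ → List ℕ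
  inp : List ℕ
  out : List ℕ
  time : ℕ

namespace Store

/-- Assign a scalar variable. -/
def setV (h : Store) (r : Reg) (n : ℕ) : Store := { h with v := Function.update h.v r n }

/-- Assign an entry of an array. -/
def setA (h : Store) (k : Arr) (i n : ℕ) : Store :=
  { h with A := Function.update h.A k (Function.update (h.A k) i n) }

/-- Assign an entry of an array of lists. -/
def setL (h : Store) (k : Lst) (i : ℕ) (l : List ℕ) : Store :=
  { h with L := Function.update h.L k (Function.update (h.L k) i l) }

/-- Advance the clock. -/
def tick (h : Store) : Store := { h with time := h.time + 1 }

/-- Append a number to the output. -/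
def emit (h : Store) (n : ℕ) : Store := { h with out := h.out ++ [n] }

/-- Drop the first number of the input. -/
def next (h : Store) : Store := { h with inp := h.inp.tail }

variable (h : Store) (r r' : Reg) (k k' : Arr) (m m' : Lst) (i i' n : ℕ) (l : List ℕ)

@[simp] theorem setV_v : (h.setV r n).v r' = if r' = r then n else h.v r' := by
  simp [setV, Function.update_apply]
@[simp] theorem setV_A : (h.setV r n).A = h.A := rfl
@[simp] theorem setV_L : (h.setV r n).L = h.L := rfl
@[simp] theorem setV_inp : (h.setV r n).inp = h.inp := rfl
@[simp] theorem setV_out : (h.setV r n).out = h.out := rfl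
@[simp] theorem setV_time : (h.setV r n).time = h.time := rfl
@[simp] theorem setA_v : (h.setA k i n).v = h.v := rfl
@[simp] theorem setA_A : (h.setA k i n).A k' i' = if k' = k ∧ i' = i then n else h.A k' i' := by
  by_cases hk : k' = k
  · subst hk; simp [setA, Function.update_apply]
  · simp [setA, hk]
@[simp] theorem setA_L : (h.setA k i n).L = h.L := rfl
@[simp] theorem setA_inp : (h.setA k i n).inp = h.inp := rfl
@[simp] theorem setA_out : (h.setA k i n).out = h.out := rfl
@[simp] theorem setA_time : (h.setA k i n).time = h.time := rfl
@[simp] theorem setL_v : (h.setL m i l).v = h.v := rfl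
@[simp] theorem setL_A : (h.setL m i l).A = h.A := rfl
@[simp] theorem setL_L : (h.setL m i l).L m' i' = if m' = m ∧ i' = i then l else h.L m' i' := by
  by_cases hk : m' = m
  · subst hk; simp [setL, Function.update_apply]
  · simp [setL, hk]
@[simp] theorem setL_inp : (h.setL m i l).inp = h.inp := rfl
@[simp] theorem setL_out : (h.setL m i l).out = h.out := rfl
@[simp] theorem setL_time : (h.setL m i l).time = h.time := rfl
@[simp] theorem tick_v : h.tick.v = h.v := rfl
@[simp] theorem tick_A : h.tick.A = h.A := rfl
@[simp] theorem tick_L : h.tick.L = h.L := rfl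
@[simp] theorem tick_inp : h.tick.inp = h.inp := rfl
@[simp] theorem tick_out : h.tick.out = h.out := rfl
@[simp] theorem tick_time : h.tick.time = h.time + 1 := rfl
@[simp] theorem emit_v : (h.emit n).v = h.v := rfl
@[simp] theorem emit_A : (h.emit n).A = h.A := rfl
@[simp] theorem emit_L : (h.emit n).L = h.L := rfl
@[simp] theorem emit_inp : (h.emit n).inp = h.inp := rfl
@[simp] theorem emit_out : (h.emit n).out = h.out ++ [n] := rfl
@[simp] theorem emit_time : (h.emit n).time = h.time := rfl
@[simp] theorem next_v : h.next.v = h.v := rfl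
@[simp] theorem next_A : h.next.A = h.A := rfl
@[simp] theorem next_L : h.next.L = h.L := rfl
@[simp] theorem next_inp : h.next.inp = h.inp.tail := rfl
@[simp] theorem next_out : h.next.out = h.out := rfl
@[simp] theorem next_time : h.next.time = h.time := rfl

end Store

/-! ### Syntax and semantics of the language with bounded loops. -/

/-- Arithmetic expressions. -/
inductive Expr
  | lit (n : ℕ)
  | var (r : Reg)
  | add (a b : Expr)
  | sub (a b : Expr)
  | get (k : Arr) (i : Expr)

/-- The value of an expression. -/
@[simp] def Expr.eval (h : Store) : Expr → ℕ
  | lit n => n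
  | var r => h.v r
  | add a b => a.eval h + b.eval h
  | sub a b => a.eval h - b.eval h
  | get k i => h.A k (i.eval h)

/-- Commands. All loops are bounded. -/
inductive Cmd
  | skip
  | set (r : Reg) (e : Expr)
  | put (k : Arr) (i e : Expr)
  | push (k : Lst) (i e : Expr)
  | pop (r : Reg) (k : Lst) (i : Expr)
  | read (r : Reg)
  | write (e : Expr)
  | seq (a b : Cmd)
  | ite (e : Expr) (a b : Cmd)
  | each (r : Reg) (k : Lst) (i : Expr) (body : Cmd)
  | rep (e : Expr) (body : Cmd)

/-- The effect of a command. -/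
def Cmd.run : Cmd → Store → Store
  | skip, h => h
  | set r e, h => h.setV r (e.eval h)
  | put k i e, h => h.setA k (i.eval h) (e.eval h)
  | push k i e, h => h.setL k (i.eval h) (e.eval h :: h.L k (i.eval h))
  | pop r k i, h =>
      (h.setV r ((h.L k (i.eval h)).headD 0)).setL k (i.eval h) (h.L k (i.eval h)).tail
  | read r, h => (h.setV r (h.inp.headD 0)).next
  | write e, h => h.emit (e.eval h)
  | seq a b, h => b.run (a.run h)
  | ite e a b, h => if e.eval h ≠ 0 then a.run h else b.run h
  | each r k i body, h =>
      (h.L k (i.eval h)).foldl (fun g a => body.run (g.setV r a).tick) h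
  | rep e body, h => (fun g => body.run g.tick)^[e.eval h] h

/-! ### Compilation of expressions. -/

/-- Compute the address `16 * i + k` from `i`, in the temporary register `τ`. -/
def addrProg (τ k : ℕ) : Prog :=
  .seq (.add (3 * τ + 3) (3 * τ + 3) (3 * τ + 3)) <|
  .seq (.add (3 * τ + 3) (3 * τ + 3) (3 * τ + 3)) <|
  .seq (.add (3 * τ + 3) (3 * τ + 3) (3 * τ + 3)) <|
  .seq (.add (3 * τ + 3) (3 * τ + 3) (3 * τ + 3)) <|
  .seq (.const (3 * τ + 6) k) (.add (3 * τ + 3) (3 * τ + 3) (3 * τ + 6))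

/-- Compile an expression; its value is left in the temporary register `τ`. -/
def Expr.comp : Expr → ℕ → Prog
  | lit n, τ => .const (3 * τ + 3) n
  | var r, τ => .copy (3 * τ + 3) (3 * r.idx + 1)
  | add a b, τ => .seq (a.comp τ) (.seq (b.comp (τ + 1))
      (.add (3 * τ + 3) (3 * τ + 3) (3 * τ + 6)))
  | sub a b, τ => .seq (a.comp τ) (.seq (b.comp (τ + 1))
      (.sub (3 * τ + 3) (3 * τ + 3) (3 * τ + 6)))
  | get k i, τ => .seq (i.comp τ) (.seq (addrProg τ k.idx) (.load (3 * τ + 3) (3 * τ + 3)))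

/-- Only temporary registers from `τ` on have changed. -/
structure TempEq (τ : ℕ) (s s' : State) : Prop where
  reg : ∀ r, (∀ i, τ ≤ i → r ≠ 3 * i + 3) → s'.reg r = s.reg r
  mem : s'.mem = s.mem
  input : s'.input = s.input
  output : s'.output = s.output

theorem TempEq.refl (τ : ℕ) (s : State) : TempEq τ s s := ⟨fun _ _ => rfl, rfl, rfl, rfl⟩

theorem TempEq.trans {τ τ' : ℕ} {s s' s'' : State} (h : TempEq τ s s') (h' : TempEq τ' s' s'')
    (hτ : τ ≤ τ') : TempEq τ s s'' :=
  ⟨fun r hr => (h'.reg r fun i hi => hr i (hτ.trans hi)).trans (h.reg r hr),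
    h'.mem.trans h.mem, h'.input.trans h.input, h'.output.trans h.output⟩

theorem TempEq.setReg {τ i : ℕ} (hi : τ ≤ i) (s : State) (n : ℕ) :
    TempEq τ s (s.setReg (3 * i + 3) n) :=
  ⟨fun r hr => by simp [State.setReg, Function.update_of_ne (hr i hi)], rfl, rfl, rfl⟩

@[simp] theorem State.setReg_reg (s : State) (r n r' : ℕ) :
    (s.setReg r n).reg r' = if r' = r then n else s.reg r' := by
  simp [State.setReg, Function.update_apply]
@[simp] theorem State.setReg_mem (s : State) (r n : ℕ) : (s.setReg r n).mem = s.mem := rfl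
@[simp] theorem State.setReg_input (s : State) (r n : ℕ) : (s.setReg r n).input = s.input := rfl
@[simp] theorem State.setReg_output (s : State) (r n : ℕ) : (s.setReg r n).output = s.output := rfl

/-- Without multiplication, the factor 16 comes from four doublings. Memory is split into 16 residue
classes: below 8 for arrays, 8 to 13 for list heads, 14 and 15 for the two halves of list cells. -/
theorem exec_addrProg (τ k : ℕ) (s : State) : ∃ s', Exec (addrProg τ k) s 6 s' ∧
    s'.reg (3 * τ + 3) = 16 * s.reg (3 * τ + 3) + k ∧ TempEq τ s s' := by
  refine ⟨_, .seq (.add ..) (.seq (.add ..) (.seq (.add ..) (.seq (.add ..)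
    (.seq (.const ..) (.add ..))))), ?_, ?_⟩
  · simp; ring
  · refine (TempEq.setReg le_rfl _ _).trans ((TempEq.setReg le_rfl _ _).trans
      ((TempEq.setReg le_rfl _ _).trans ((TempEq.setReg le_rfl _ _).trans
      ((TempEq.setReg (i := τ + 1) (Nat.le_succ _) _ _).trans (TempEq.setReg le_rfl _ _) le_rfl)
      le_rfl) le_rfl) le_rfl) le_rfl

/-! ### Linked lists and the representation of stores. -/

/-- The memory holds the list `l`, with its first cell at address `p`; cells up to number `nc` are
allocated. -/
def IsList (mem : ℕ → ℕ) (nc : ℕ) : ℕ → List ℕ → Prop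
  | p, [] => p = 0
  | p, a :: l => p ≠ 0 ∧ p ≤ nc ∧ mem (16 * p + 14) = a ∧ IsList mem nc (mem (16 * p + 15)) l

/-- The allocated cells stay unchanged. -/
structure HeapLE (s s' : State) : Prop where
  nc : s.reg 0 ≤ s'.reg 0
  car : ∀ p ≤ s.reg 0, s'.mem (16 * p + 14) = s.mem (16 * p + 14)
  cdr : ∀ p ≤ s.reg 0, s'.mem (16 * p + 15) = s.mem (16 * p + 15)

theorem HeapLE.trans {s s' s'' : State} (h : HeapLE s s') (h' : HeapLE s' s'') : HeapLE s s'' :=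
  ⟨h.nc.trans h'.nc, fun p hp => (h'.car p (hp.trans h.nc)).trans (h.car p hp),
    fun p hp => (h'.cdr p (hp.trans h.nc)).trans (h.cdr p hp)⟩

/-- Every pointer on the list is an allocated cell, and allocated cells are immutable, so lists
persist under any later computation. -/
theorem HeapLE.isList {s s' : State} (h : HeapLE s s') {p : ℕ} {l : List ℕ}
    (hl : IsList s.mem (s.reg 0) p l) : IsList s'.mem (s'.reg 0) p l := by
  induction l generalizing p with
  | nil => exact hl
  | cons a l ih =>
    obtain ⟨h1, h2, h3, h4⟩ := hl
    refine ⟨h1, h2.trans h.nc, (h.car p h2).trans h3, ?_⟩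
    rw [h.cdr p h2]
    exact ih h4

/-- The machine state `s` represents the store `h`. -/
structure Rep (s : State) (h : Store) : Prop where
  -- Registers are split modulo 3: 3r + 1 for scalars, 3δ + 2 for loop control at depth δ, 3τ + 3
  -- for temporaries. Register 0 counts the allocated cells.
  v : ∀ r : Reg, s.reg (3 * r.idx + 1) = h.v r
  A : ∀ (k : Arr) i, s.mem (16 * i + k.idx) = h.A k i
  L : ∀ (k : Lst) i, IsList s.mem (s.reg 0) (s.mem (16 * i + k.idx)) (h.L k i)
  inp : s.input = h.inp
  out : s.output = h.out

theorem TempEq.rep {τ : ℕ} {s s' : State} (hs : TempEq τ s s') {h : Store} (hr : Rep s h) :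
    Rep s' h where
  v r := by rw [hs.reg _ fun i _ => by omega]; exact hr.v r
  A k i := by rw [hs.mem]; exact hr.A k i
  L k i := by rw [hs.mem, hs.reg _ fun i _ => by omega]; exact hr.L k i
  inp := hs.input.trans hr.inp
  out := hs.output.trans hr.out

/-- The bound `K` depends on the expression only. The left operand survives in temporary `τ` because
the right one is evaluated in temporaries from `τ + 1` on. -/
theorem Expr.exec_comp (e : Expr) : ∃ K, ∀ τ s h, Rep s h → ∃ t s', Exec (e.comp τ) s t s' ∧
    t ≤ K ∧ s'.reg (3 * τ + 3) = e.eval h ∧ TempEq τ s s' := by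
  induction e with
  | lit n => exact ⟨1, fun τ s h _ => ⟨_, _, .const .., le_rfl, by simp, .setReg le_rfl _ _⟩⟩
  | var r => exact ⟨1, fun τ s h hr =>
      ⟨_, _, .copy .., le_rfl, by simp [hr.v], .setReg le_rfl _ _⟩⟩
  | add a b iha ihb =>
    obtain ⟨Ka, ha⟩ := iha
    obtain ⟨Kb, hb⟩ := ihb
    refine ⟨Ka + (Kb + 1), fun τ s h hr => ?_⟩
    obtain ⟨t, s', h1, h2, h3, h4⟩ := ha τ s h hr
    obtain ⟨t', s'', h1', h2', h3', h4'⟩ := hb (τ + 1) s' h (h4.rep hr)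
    refine ⟨_, _, .seq h1 (.seq h1' (.add ..)), by omega, ?_,
      (h4.trans h4' (Nat.le_succ _)).trans (.setReg le_rfl _ _) le_rfl⟩
    rw [show 3 * (τ + 1) + 3 = 3 * τ + 6 by ring] at h3'
    simp [h3', h4'.reg (3 * τ + 3) fun i _ => by omega, h3]
  | sub a b iha ihb =>
    obtain ⟨Ka, ha⟩ := iha
    obtain ⟨Kb, hb⟩ := ihb
    refine ⟨Ka + (Kb + 1), fun τ s h hr => ?_⟩
    obtain ⟨t, s', h1, h2, h3, h4⟩ := ha τ s h hr
    obtain ⟨t', s'', h1', h2', h3', h4'⟩ := hb (τ + 1) s' h (h4.rep hr)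
    refine ⟨_, _, .seq h1 (.seq h1' (.sub ..)), by omega, ?_,
      (h4.trans h4' (Nat.le_succ _)).trans (.setReg le_rfl _ _) le_rfl⟩
    rw [show 3 * (τ + 1) + 3 = 3 * τ + 6 by ring] at h3'
    simp [h3', h4'.reg (3 * τ + 3) fun i _ => by omega, h3]
  | get k i ih =>
    obtain ⟨K, hi⟩ := ih
    refine ⟨K + 7, fun τ s h hr => ?_⟩
    obtain ⟨t, s', h1, h2, h3, h4⟩ := hi τ s h hr
    obtain ⟨s'', h1', h3', h4'⟩ := exec_addrProg τ k.idx s'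
    refine ⟨_, _, .seq h1 (.seq h1' (.load ..)), by omega, ?_,
      (h4.trans h4' le_rfl).trans (.setReg le_rfl _ _) le_rfl⟩
    simp [h3', h3, (h4'.rep (h4.rep hr)).A]

/-- Compile a command at loop depth `δ`. -/
def Cmd.comp : Cmd → ℕ → Prog
  | skip, _ => .skip
  | set r e, _ => .seq (e.comp 0) (.copy (3 * r.idx + 1) 3)
  | put k i e, _ => .seq (i.comp 0) <| .seq (addrProg 0 k.idx) <| .seq (e.comp 1) (.store 3 6)
  | push k i e, _ => .seq (i.comp 0) <| .seq (addrProg 0 k.idx) <| .seq (e.comp 1) <|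
      .seq (.const 9 1) <| .seq (.add 0 0 9) <| .seq (.copy 9 0) <| .seq (addrProg 2 14) <|
      .seq (.store 9 6) <| .seq (.const 6 1) <| .seq (.add 9 9 6) <| .seq (.load 6 3) <|
      .seq (.store 9 6) (.store 3 0)
  | pop r k i, _ => .seq (i.comp 0) <| .seq (addrProg 0 k.idx) <| .seq (.load 6 3) <|
      .ite 6
        (.seq (addrProg 1 14) <| .seq (.load (3 * r.idx + 1) 6) <| .seq (.const 9 1) <|
          .seq (.add 6 6 9) <| .seq (.load 6 6) (.store 3 6))
        (.const (3 * r.idx + 1) 0)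
  | read r, _ => .read (3 * r.idx + 1)
  | write e, _ => .seq (e.comp 0) (.write 3)
  | seq a b, δ => .seq (a.comp δ) (b.comp δ)
  | ite e a b, δ => .seq (e.comp 0) (.ite 3 (a.comp δ) (b.comp δ))
  | each r k i body, δ => .seq (i.comp 0) <| .seq (addrProg 0 k.idx) <| .seq (.load (3 * δ + 2) 3) <|
      .while (3 * δ + 2) (.seq (.copy 3 (3 * δ + 2)) <| .seq (addrProg 0 14) <|
        .seq (.load (3 * r.idx + 1) 3) <| .seq (.const 6 1) <| .seq (.add 3 3 6) <|
        .seq (.load (3 * δ + 2) 3) (body.comp (δ + 1)))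
  | rep e body, δ => .seq (e.comp 0) <| .seq (.copy (3 * δ + 2) 3) <|
      .while (3 * δ + 2) (.seq (.const 3 1) <| .seq (.sub (3 * δ + 2) (3 * δ + 2) 3)
        (body.comp (δ + 1)))

/-- The control registers of loops of depth below `δ` and the allocated cells stay unchanged. -/
structure Frame (δ : ℕ) (s s' : State) : Prop extends HeapLE s s' where
  reg : ∀ i < δ, s'.reg (3 * i + 2) = s.reg (3 * i + 2)

theorem Frame.trans {δ δ' : ℕ} {s s' s'' : State} (h : Frame δ s s') (h' : Frame δ' s' s'')
    (hδ : δ ≤ δ') : Frame δ s s'' :=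
  ⟨h.toHeapLE.trans h'.toHeapLE, fun i hi => (h'.reg i (hi.trans_le hδ)).trans (h.reg i hi)⟩

theorem TempEq.frame {τ : ℕ} {s s' : State} (h : TempEq τ s s') (δ : ℕ) : Frame δ s s' :=
  ⟨⟨(h.reg 0 fun i _ => by omega).ge, fun p _ => by rw [h.mem], fun p _ => by rw [h.mem]⟩,
    fun i _ => h.reg _ fun j _ => by omega⟩

/-- The compiled command simulates the command, with constant overhead. -/
def Cmd.Sim (c : Cmd) : Prop :=
  ∃ K, ∀ δ s h, Rep s h → ∃ t s', Exec (c.comp δ) s t s' ∧ Rep s' (c.run h) ∧ Frame δ s s' ∧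
    h.time ≤ (c.run h).time ∧ t ≤ K * ((c.run h).time - h.time + 1)

end RAM

/-! ### Simulation of the commands without iteration. -/

namespace RAM

namespace Cmd

theorem sim_skip : Sim .skip :=
  ⟨1, fun δ s h hr => ⟨1, s, .skip s, hr, (TempEq.refl 0 s).frame δ, le_rfl, by simp⟩⟩

theorem Sim.seq {a b : Cmd} (ha : a.Sim) (hb : b.Sim) : (Cmd.seq a b).Sim := by
  obtain ⟨Ka, ha⟩ := ha
  obtain ⟨Kb, hb⟩ := hb
  refine ⟨Ka + Kb, fun δ s h hr => ?_⟩
  obtain ⟨t, s', h1, h2, h3, h4, h5⟩ := ha δ s h hr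
  obtain ⟨t', s'', h1', h2', h3', h4', h5'⟩ := hb δ s' _ h2
  refine ⟨_, _, .seq h1 h1', h2', h3.trans h3' le_rfl, h4.trans h4', ?_⟩
  simp only [run]
  calc t + t' ≤ Ka * ((a.run h).time - h.time + 1)
        + Kb * ((b.run (a.run h)).time - (a.run h).time + 1) := Nat.add_le_add h5 h5'
    _ ≤ Ka * ((b.run (a.run h)).time - h.time + 1)
        + Kb * ((b.run (a.run h)).time - h.time + 1) := by
      gcongr
    _ = _ := by ring

theorem Sim.ite (e : Expr) {a b : Cmd} (ha : a.Sim) (hb : b.Sim) : (Cmd.ite e a b).Sim := by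
  obtain ⟨Ka, ha⟩ := ha
  obtain ⟨Kb, hb⟩ := hb
  obtain ⟨Ke, he⟩ := e.exec_comp
  refine ⟨Ke + 1 + Ka + Kb, fun δ s h hr => ?_⟩
  obtain ⟨t, s', h1, h2, h3, h4⟩ := he 0 s h hr
  simp only [run]
  split_ifs with hc
  · obtain ⟨t', s'', h1', h2', h3', h4', h5'⟩ := ha δ s' h (h4.rep hr)
    refine ⟨_, _, .seq h1 (.ite_true (by simpa [h3] using hc) h1'), h2',
      (h4.frame δ).trans h3' le_rfl, h4', ?_⟩
    nlinarith
  · obtain ⟨t', s'', h1', h2', h3', h4', h5'⟩ := hb δ s' h (h4.rep hr)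
    refine ⟨_, _, .seq h1 (.ite_false (by simpa [h3] using hc) h1'), h2',
      (h4.frame δ).trans h3' le_rfl, h4', ?_⟩
    nlinarith

theorem sim_write (e : Expr) : Sim (.write e) := by
  obtain ⟨Ke, he⟩ := e.exec_comp
  refine ⟨Ke + 1, fun δ s h hr => ?_⟩
  obtain ⟨t, s', h1, h2, h3, h4⟩ := he 0 s h hr
  have hr' := h4.rep hr
  have hf := h4.frame δ
  refine ⟨_, _, .seq h1 (.write ..), ⟨hr'.v, hr'.A, hr'.L, hr'.inp, ?_⟩,
    ⟨⟨hf.nc, hf.car, hf.cdr⟩, hf.reg⟩, le_rfl, ?_⟩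
  · simp only [run, Store.emit_out, hr'.out]
    exact congrArg (fun n => h.out ++ [n]) h3
  · simp [run]; omega

theorem _root_.RAM.Rep.setReg {s : State} {h : Store} (hr : Rep s h) (r : Reg) (n : ℕ) :
    Rep (s.setReg (3 * r.idx + 1) n) (h.setV r n) where
  v r' := by
    have : 3 * r'.idx + 1 = 3 * r.idx + 1 ↔ r' = r := by rw [← Reg.idx_inj]; omega
    simp only [State.setReg_reg, this, Store.setV_v, hr.v]
  A := hr.A
  L k i := by simpa using hr.L k i
  inp := hr.inp
  out := hr.out

theorem frame_setReg (δ : ℕ) (s : State) (r : Reg) (n : ℕ) :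
    Frame δ s (s.setReg (3 * r.idx + 1) n) :=
  ⟨⟨by simp, fun _ _ => rfl, fun _ _ => rfl⟩, fun i _ => by simp; omega⟩

theorem sim_set (r : Reg) (e : Expr) : Sim (.set r e) := by
  obtain ⟨Ke, he⟩ := e.exec_comp
  refine ⟨Ke + 1, fun δ s h hr => ?_⟩
  obtain ⟨t, s', h1, h2, h3, h4⟩ := he 0 s h hr
  refine ⟨_, _, .seq h1 (.copy _ _ _), ?_, (h4.frame δ).trans (frame_setReg _ _ _ _) le_rfl,
    le_rfl, by simp [run]; omega⟩
  rw [show s'.reg 3 = e.eval h from h3]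
  exact (h4.rep hr).setReg r _

theorem sim_read (r : Reg) : Sim (.read r) := by
  refine ⟨1, fun δ s h hr => ⟨_, _, .read _ _, ?_, ?_, le_rfl, by simp [run, Store.next]⟩⟩
  · have := hr.setReg r (h.inp.headD 0)
    rw [hr.inp]
    exact ⟨this.v, this.A, this.L, rfl, this.out⟩
  · have := frame_setReg δ s r (s.input.headD 0)
    exact ⟨⟨this.nc, this.car, this.cdr⟩, this.reg⟩

/-- The written address has residue below 8, so no list head and no list cell is touched. -/
theorem sim_put (k : Arr) (i e : Expr) : Sim (.put k i e) := by
  obtain ⟨Ki, hi⟩ := i.exec_comp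
  obtain ⟨Ke, he⟩ := e.exec_comp
  refine ⟨Ki + Ke + 7, fun δ s h hr => ?_⟩
  obtain ⟨t, s1, h1, h2, h3, h4⟩ := hi 0 s h hr
  obtain ⟨s2, h1', h3', h4'⟩ := exec_addrProg 0 k.idx s1
  have hr2 := h4'.rep (h4.rep hr)
  obtain ⟨t', s3, h5, h6, h7, h8⟩ := he 1 s2 h hr2
  have hr3 := h8.rep hr2
  have hf := ((h4.trans h4' le_rfl).trans h8 (Nat.zero_le 1)).frame δ
  have h9 : s3.reg 3 = 16 * i.eval h + k.idx := by
    rw [h8.reg 3 fun i hi => by omega]; simpa [h3] using h3'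
  have hk := k.idx_lt
  refine ⟨_, _, .seq h1 (.seq h1' (.seq h5 (.store _ _ _))), ⟨hr3.v, fun k' i' => ?_,
    fun k' i' => ?_, hr3.inp, hr3.out⟩, ⟨⟨hf.nc, fun p hp => ?_, fun p hp => ?_⟩, hf.reg⟩, le_rfl,
    by simp [run]; omega⟩
  · have hk' := k'.idx_lt
    have : 16 * i' + k'.idx = 16 * i.eval h + k.idx ↔ k' = k ∧ i' = i.eval h := by
      rw [← Arr.idx_inj]; omega
    simp only [run, Store.setA_A, h9, Function.update_apply, this, hr3.A]
    split_ifs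
    · exact h7
    · rfl
  · have hk' := k'.le_idx
    have hk'' := k'.idx_lt
    have hl := hr3.L k' i'
    rw [← show (Function.update s3.mem (s3.reg 3) (s3.reg 6)) (16 * i' + k'.idx)
      = s3.mem (16 * i' + k'.idx) from Function.update_of_ne (by omega) _ _] at hl
    refine HeapLE.isList (s := s3) (s' := { s3 with mem := Function.update s3.mem (s3.reg 3) (s3.reg 6) })
      ⟨le_rfl, fun p _ => ?_, fun p _ => ?_⟩ hl
    · exact Function.update_of_ne (by omega) _ _
    · exact Function.update_of_ne (by omega) _ _
  · rw [← hf.car p hp]; exact Function.update_of_ne (by omega) _ _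
  · rw [← hf.cdr p hp]; exact Function.update_of_ne (by omega) _ _

/-- A fresh cell receives the new entry and the old head, and the head is redirected to it; existing
cells keep their contents, so all other lists stay valid. -/
theorem sim_push (k : Lst) (i e : Expr) : Sim (.push k i e) := by
  obtain ⟨Ki, hi⟩ := i.exec_comp
  obtain ⟨Ke, he⟩ := e.exec_comp
  refine ⟨Ki + Ke + 21, fun δ s h hr => ?_⟩
  obtain ⟨t, s1, h1, h2, h3, h4⟩ := hi 0 s h hr
  obtain ⟨s2, h1', h3', h4'⟩ := exec_addrProg 0 k.idx s1
  have hr2 := h4'.rep (h4.rep hr)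
  obtain ⟨t', s3, h5, h6, h7, h8⟩ := he 1 s2 h hr2
  have hr3 := h8.rep hr2
  have hf := ((h4.trans h4' le_rfl).trans h8 (Nat.zero_le 1)).frame δ
  have h9 : s3.reg 3 = 16 * i.eval h + k.idx := by
    rw [h8.reg 3 fun i hi => by omega]; simpa [h3] using h3'
  have h7 : s3.reg 6 = e.eval h := h7
  -- Cells are numbered from 1, so that the pointer 0 can stand for the empty list.
  set n := s3.reg 0 + 1 with hn
  set s4 := ((s3.setReg 9 1).setReg 0 n).setReg 9 n with hs4
  obtain ⟨s5, h10, h11, h12⟩ := exec_addrProg 2 14 s4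
  have h11 : s5.reg 9 = 16 * n + 14 := by rw [h11]; simp [hs4]
  have h13 : ∀ r, r ≠ 9 → r ≠ 0 → (∀ i, 2 ≤ i → r ≠ 3 * i + 3) → s5.reg r = s3.reg r :=
    fun r hr1 hr2 hr3 => by rw [h12.reg r hr3]; simp [hs4, hr1, hr2]
  have h14 : s5.reg 0 = n := by rw [h12.reg 0 fun i hi => by omega]; simp [hs4]
  have hmem : s5.mem = s3.mem := h12.mem
  have hk := k.idx_lt
  have hk8 := k.le_idx
  have key : ∃ s', Exec ((Cmd.push k i e).comp δ) s (t + (6 + (t' + (1 + (1 + (1 + (6 + (1 + (1 + (1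
      + (1 + (1 + 1)))))))))))) s' ∧ (∀ r, (∀ i, r ≠ 3 * i + 3) → r ≠ 0 → s'.reg r = s3.reg r) ∧
      s'.reg 0 = n ∧ s'.input = s3.input ∧ s'.output = s3.output ∧
      s'.mem = Function.update (Function.update (Function.update s3.mem (16 * n + 14) (e.eval h))
        (16 * n + 15) (s3.mem (16 * i.eval h + k.idx))) (16 * i.eval h + k.idx) n := by
    refine ⟨_, .seq h1 <| .seq h1' <| .seq h5 <| .seq (.const ..) <| .seq (.add ..) <|
      .seq (.copy ..) <| .seq (s' := s5) ?_ <| .seq (.store ..) <| .seq (.const ..) <|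
      .seq (.add ..) <| .seq (.load ..) <| .seq (.store ..) (.store ..), ?_, ?_, ?_, ?_, ?_⟩
    · convert h10 using 2
      · simp [hn]
      · simp [hn]
    · intro r hr hr0
      have hr1 := hr 1
      have hr2 := hr 2
      simp [hr1, hr2, h13 r hr2 hr0 fun i _ => hr i]
    · simpa using h14
    · simpa [hs4] using h12.input
    · simpa [hs4] using h12.output
    · have e1 : s5.reg 3 = 16 * i.eval h + k.idx := by
        rw [h13 3 (by simp) (by simp) fun i hi => by omega, h9]
      have e2 : s5.reg 6 = e.eval h := by
        rw [h13 6 (by simp) (by simp) fun i hi => by omega, h7]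
      simp only [State.setReg_mem, State.setReg_reg, h11, h14, e1, e2, hmem]
      simp
      rw [Function.update_of_ne (a := 16 * i.eval h + k.idx) (a' := 16 * n + 14) (by omega)]
  obtain ⟨s', hex, hreg, hreg0, hinp, hout, hm⟩ := key
  have hle : HeapLE s3 s' := by
    refine ⟨by omega, fun p hp => ?_, fun p hp => ?_⟩
    · rw [hm, Function.update_of_ne (by omega), Function.update_of_ne (by omega),
        Function.update_of_ne (by omega)]
    · rw [hm, Function.update_of_ne (by omega), Function.update_of_ne (by omega),
        Function.update_of_ne (by omega)]
  refine ⟨_, s', hex, ⟨fun r => ?_, fun k' i' => ?_, fun k' i' => ?_, ?_, ?_⟩,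
    hf.trans ⟨hle, fun i _ => hreg _ (by omega) (by omega)⟩ le_rfl, le_rfl, by simp [run]; omega⟩
  · rw [hreg _ (fun i => by omega) (by omega)]; exact hr3.v r
  · have hk' := k'.idx_lt
    rw [hm, Function.update_of_ne (by omega), Function.update_of_ne (by omega),
        Function.update_of_ne (by omega)]
    exact hr3.A k' i'
  · have hk' := k'.idx_lt
    simp only [run, Store.setL_L]
    have hiff : 16 * i' + k'.idx = 16 * i.eval h + k.idx ↔ k' = k ∧ i' = i.eval h := by
      rw [← Lst.idx_inj]; omega
    split_ifs with hc
    · rw [hiff.2 hc]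
      have e1 : s'.mem (16 * i.eval h + k.idx) = n := by rw [hm, Function.update_self]
      rw [e1]
      refine ⟨by omega, hreg0.ge, ?_, ?_⟩
      · rw [hm, Function.update_of_ne (by omega), Function.update_of_ne (by omega),
          Function.update_self]
      · rw [show s'.mem (16 * n + 15) = s3.mem (16 * i.eval h + k.idx) by
          rw [hm, Function.update_of_ne (by omega), Function.update_self]]
        exact hle.isList (hr3.L _ _)
    · have : s'.mem (16 * i' + k'.idx) = s3.mem (16 * i' + k'.idx) := by
        rw [hm, Function.update_of_ne (by rwa [Ne, hiff]), Function.update_of_ne (by omega),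
          Function.update_of_ne (by omega)]
      rw [this]
      exact hle.isList (hr3.L _ _)
  · rw [hinp]; exact hr3.inp
  · rw [hout]; exact hr3.out

/-- Only the head pointer moves and the cell is never freed; a loop that is still running over the
old list is therefore undisturbed. -/
theorem sim_pop (r : Reg) (k : Lst) (i : Expr) : Sim (.pop r k i) := by
  obtain ⟨Ki, hi⟩ := i.exec_comp
  refine ⟨Ki + 20, fun δ s h hr => ?_⟩
  obtain ⟨t, s1, h1, h2, h3, h4⟩ := hi 0 s h hr
  obtain ⟨s2, h1', h3', h4'⟩ := exec_addrProg 0 k.idx s1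
  have hr2 := h4'.rep (h4.rep hr)
  have hf := (h4.trans h4' le_rfl).frame δ
  have h9 : s2.reg 3 = 16 * i.eval h + k.idx := by simpa [h3] using h3'
  set p := s2.mem (16 * i.eval h + k.idx) with hp
  have hk := k.idx_lt
  have hk8 := k.le_idx
  set s3 := s2.setReg 6 p with hs3
  have hload : Exec (.load 6 3) s2 1 s3 := by
    have := Exec.load 6 3 s2
    rwa [h9] at this
  have ht3 : TempEq 0 s2 s3 := TempEq.setReg (i := 1) (Nat.zero_le 1) _ _
  have hr3 := ht3.rep hr2
  have hl := hr2.L k (i.eval h)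
  rw [← hp] at hl
  cases hL : h.L k (i.eval h) with
  | nil =>
    rw [hL] at hl
    have hl : p = 0 := hl
    refine ⟨_, _, .seq h1 <| .seq h1' <| .seq hload <| .ite_false (by simp [hs3, hl]) (.const ..),
      ?_, hf.trans ((ht3.frame δ).trans (frame_setReg _ _ _ _) le_rfl) le_rfl, le_rfl,
      by simp [run]; omega⟩
    have := hr3.setReg r 0
    simp only [run, hL, List.headD_nil, List.tail_nil]
    refine ⟨this.v, this.A, fun k' i' => ?_, this.inp, this.out⟩
    simp only [Store.setL_L]
    split_ifs with hc
    · have := this.L k' i'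
      rwa [hc.1, hc.2, Store.setV_L, hL, ← hc.1, ← hc.2] at this
    · exact this.L k' i'
  | cons a l =>
    rw [hL] at hl
    obtain ⟨hl1, hl2, hl3, hl4⟩ := hl
    obtain ⟨s4, h10, h11, h12⟩ := exec_addrProg 1 14 s3
    have h11 : s4.reg 6 = 16 * p + 14 := by rw [h11]; simp [hs3]
    have hr4 := h12.rep hr3
    have hmem : s4.mem = s2.mem := h12.mem
    have h13 : s4.reg 3 = 16 * i.eval h + k.idx := by
      rw [h12.reg 3 fun i hi => by omega]; simp [hs3, h9]
    have hf4 := hf.trans ((ht3.frame δ).trans (h12.frame δ) le_rfl) le_rfl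
    set s5 := s4.setReg (3 * r.idx + 1) a with hs5
    have h14 : Exec (.load (3 * r.idx + 1) 6) s4 1 s5 := by
      have := Exec.load (3 * r.idx + 1) 6 s4
      rwa [h11, hmem, hl3] at this
    have hr5 := hr4.setReg r a
    rw [← hs5] at hr5
    have e3 : s5.reg 3 = 16 * i.eval h + k.idx := by
      rw [hs5, State.setReg_reg, if_neg (by omega), h13]
    have e6 : s5.reg 6 = 16 * p + 14 := by
      rw [hs5, State.setReg_reg, if_neg (by omega), h11]
    have hf5 := hf4.trans (frame_setReg δ s4 r a) le_rfl
    rw [← hs5] at hf5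
    have hmem5 : s5.mem = s2.mem := hmem
    have key : ∃ s', Exec ((Cmd.pop r k i).comp δ) s (t + (6 + (1 + ((6 + (1 + (1 + (1 + (1 +
        1))))) + 1)))) s' ∧ (∀ r, (∀ i, r ≠ 3 * i + 3) → s'.reg r = s5.reg r) ∧
        s'.input = s5.input ∧ s'.output = s5.output ∧
        s'.mem = Function.update s2.mem (16 * i.eval h + k.idx) (s2.mem (16 * p + 15)) := by
      refine ⟨_, .seq h1 <| .seq h1' <| .seq hload <| .ite_true (by simpa [hs3] using hl1) <|
        .seq h10 <| .seq h14 <| .seq (.const ..) <| .seq (.add ..) <| .seq (.load ..) (.store ..),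
        ?_, rfl, rfl, ?_⟩
      · intro r hr
        have hr1 := hr 1
        have hr2 := hr 2
        simp [hr1, hr2]
      · simp [e3, e6, hmem5]
    obtain ⟨s', hex, hreg, hinp, hout, hm⟩ := key
    have hle : HeapLE s5 s' := by
      refine ⟨(hreg 0 (by omega)).ge, fun p hp => ?_, fun p hp => ?_⟩
      · rw [hm, Function.update_of_ne (by omega), hmem5]
      · rw [hm, Function.update_of_ne (by omega), hmem5]
    refine ⟨_, s', hex, ⟨fun r' => ?_, fun k' i' => ?_, fun k' i' => ?_, ?_, ?_⟩,
      hf5.trans ⟨hle, fun i _ => hreg _ (by omega)⟩ le_rfl, le_rfl, by simp [run]; omega⟩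
    · rw [hreg _ (fun i => by omega), hr5.v]; simp [run, hL]
    · have hk' := k'.idx_lt
      rw [hm, Function.update_of_ne (by omega), ← hmem5]
      exact hr5.A k' i'
    · have hk' := k'.idx_lt
      simp only [run, Store.setL_L]
      have hiff : 16 * i' + k'.idx = 16 * i.eval h + k.idx ↔ k' = k ∧ i' = i.eval h := by
        rw [← Lst.idx_inj]; omega
      split_ifs with hc
      · rw [hiff.2 hc]
        have e1 : s'.mem (16 * i.eval h + k.idx) = s2.mem (16 * p + 15) := by
          rw [hm, Function.update_self]
        rw [e1, hL, List.tail_cons]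
        refine hle.isList ?_
        rw [hmem5]
        have : s5.reg 0 = s2.reg 0 := by
          rw [hs5, State.setReg_reg, if_neg (by omega), h12.reg 0 fun i _ => by omega]
          simp [hs3]
        rwa [this]
      · have : s'.mem (16 * i' + k'.idx) = s5.mem (16 * i' + k'.idx) := by
          rw [hm, Function.update_of_ne (by rwa [Ne, hiff]), hmem5]
        rw [this]
        exact hle.isList (hr5.L _ _)
    · rw [hinp]; exact hr5.inp
    · rw [hout]; exact hr5.out

end Cmd

end RAM

/-! ### Simulation of loops. -/

namespace RAM

theorem Rep.tick {s : State} {h : Store} (hr : Rep s h) : Rep s h.tick :=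
  ⟨hr.v, hr.A, hr.L, hr.inp, hr.out⟩

theorem Rep.setCtl {s : State} {h : Store} (hr : Rep s h) (δ n : ℕ) :
    Rep (s.setReg (3 * δ + 2) n) h where
  v r := by rw [State.setReg_reg, if_neg (by omega)]; exact hr.v r
  A := hr.A
  L k i := by rw [State.setReg_reg, if_neg (by omega)]; exact hr.L k i
  inp := hr.inp
  out := hr.out

theorem frame_setCtl (δ : ℕ) (s : State) (n : ℕ) : Frame δ s (s.setReg (3 * δ + 2) n) :=
  ⟨⟨by simp, fun _ _ => rfl, fun _ _ => rfl⟩, fun i _ => by simp; omega⟩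

namespace Cmd

/-- The control register traverses the cells of the list as it was at the start, which remain valid
whatever the body pushes or pops. The 12 extra steps per iteration are the while test and the 11
steps of fetching the entry and the next cell, paid by one tick of the clock. -/
theorem Sim.each_loop {body : Cmd} {K : ℕ} (hK : ∀ δ s h, Rep s h → ∃ t s',
    Exec (body.comp δ) s t s' ∧ Rep s' (body.run h) ∧ Frame δ s s' ∧
    h.time ≤ (body.run h).time ∧ t ≤ K * ((body.run h).time - h.time + 1)) (r : Reg) (δ : ℕ)
    (l : List ℕ) : ∀ (s : State) (h : Store), Rep s h →
    IsList s.mem (s.reg 0) (s.reg (3 * δ + 2)) l → ∃ t s',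
    Exec (.while (3 * δ + 2) (.seq (.copy 3 (3 * δ + 2)) <| .seq (addrProg 0 14) <|
        .seq (.load (3 * r.idx + 1) 3) <| .seq (.const 6 1) <| .seq (.add 3 3 6) <|
        .seq (.load (3 * δ + 2) 3) (body.comp (δ + 1)))) s t s' ∧
    Rep s' (l.foldl (fun g a => body.run (g.setV r a).tick) h) ∧ Frame δ s s' ∧
    h.time ≤ (l.foldl (fun g a => body.run (g.setV r a).tick) h).time ∧
    t ≤ (K + 12) * ((l.foldl (fun g a => body.run (g.setV r a).tick) h).time - h.time) + 1 := by
  induction l with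
  | nil =>
    intro s h hr hl
    exact ⟨1, s, .while_false hl, hr, (TempEq.refl 0 s).frame δ, le_rfl, by simp⟩
  | cons a l ih =>
    intro s h hr hl
    obtain ⟨hl1, hl2, hl3, hl4⟩ := hl
    set p := s.reg (3 * δ + 2) with hp
    set s1 := s.setReg 3 p with hs1
    have ht1 : TempEq 0 s s1 := TempEq.setReg (i := 0) le_rfl _ _
    obtain ⟨s2, h2, h2', ht2⟩ := exec_addrProg 0 14 s1
    have h2' : s2.reg 3 = 16 * p + 14 := by rw [h2']; simp [hs1]
    have hr2 := ht2.rep (ht1.rep hr)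
    have hm2 : s2.mem = s.mem := ht2.mem
    set s3 := s2.setReg (3 * r.idx + 1) a with hs3
    have e3 : Exec (.load (3 * r.idx + 1) 3) s2 1 s3 := by
      have := Exec.load (3 * r.idx + 1) 3 s2
      rwa [h2', hm2, hl3] at this
    have hr3 := hr2.setReg r a
    rw [← hs3] at hr3
    set s4 := (s3.setReg 6 1).setReg 3 (16 * p + 15) with hs4
    have ht4 : TempEq 0 s3 s4 := (TempEq.setReg (i := 1) (Nat.zero_le 1) _ _).trans
      (TempEq.setReg (i := 0) le_rfl _ _) le_rfl
    have e4 : Exec (.add 3 3 6) (s3.setReg 6 1) 1 s4 := by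
      have := Exec.add 3 3 6 (s3.setReg 6 1)
      rwa [show (s3.setReg 6 1).reg 3 + (s3.setReg 6 1).reg 6 = 16 * p + 15 by
        simp [hs3, h2']; omega] at this
    set q := s.mem (16 * p + 15) with hq
    -- The control register already points to the rest of the list when the body starts; the body
    -- runs at depth `δ + 1` and leaves it alone.
    set s5 := s4.setReg (3 * δ + 2) q with hs5
    have e5 : Exec (.load (3 * δ + 2) 3) s4 1 s5 := by
      have := Exec.load (3 * δ + 2) 3 s4
      rwa [show s4.reg 3 = 16 * p + 15 by simp [hs4], show s4.mem = s.mem from hm2] at this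
    have hr5 : Rep s5 (h.setV r a).tick := ((ht4.rep hr3).setCtl δ q).tick
    have hf5 : Frame δ s s5 := ((ht1.trans ht2 le_rfl).frame δ).trans
      ((frame_setReg δ s2 r a).trans ((ht4.frame δ).trans (frame_setCtl δ s4 q) le_rfl) le_rfl)
      le_rfl
    obtain ⟨t6, s6, e6, hr6, hf6, ht6, hk6⟩ := hK (δ + 1) s5 _ hr5
    have hl6 : IsList s6.mem (s6.reg 0) (s6.reg (3 * δ + 2)) l := by
      rw [hf6.reg δ (Nat.lt_succ_self δ)]
      refine hf6.toHeapLE.isList ?_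
      rw [show s5.reg (3 * δ + 2) = q by simp [hs5]]
      exact hf5.toHeapLE.isList hl4
    obtain ⟨t7, s7, e7, hr7, hf7, ht7, hk7⟩ := ih s6 _ hr6 hl6
    refine ⟨_, s7, .while_true hl1 (.seq (.copy ..) <| .seq h2 <| .seq e3 <| .seq (.const ..) <|
      .seq e4 <| .seq e5 e6) e7, hr7, hf5.trans
        ⟨hf6.toHeapLE.trans hf7.toHeapLE,
          fun i hi => (hf7.reg i hi).trans (hf6.reg i (by omega))⟩ le_rfl, ?_, ?_⟩
    · simp only [Store.tick_time, Store.setV_time, List.foldl_cons] at ht6 ht7 ⊢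
      omega
    · simp only [Store.tick_time, Store.setV_time, List.foldl_cons] at ht6 ht7 hk6 hk7 ⊢
      generalize (List.foldl (fun g a => body.run (g.setV r a).tick)
        (body.run (h.setV r a).tick) l).time = T at *
      generalize (body.run (h.setV r a).tick).time = T' at *
      obtain ⟨x, rfl⟩ := Nat.exists_eq_add_of_le ht6
      obtain ⟨y, rfl⟩ := Nat.exists_eq_add_of_le ht7
      rw [show h.time + 1 + x - (h.time + 1) = x by omega] at hk6
      rw [show h.time + 1 + x + y - (h.time + 1 + x) = y by omega] at hk7
      rw [show h.time + 1 + x + y - h.time = y + x + 1 by omega]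
      nlinarith

theorem Sim.each (r : Reg) (k : Lst) (i : Expr) {body : Cmd} (hb : body.Sim) :
    (Cmd.each r k i body).Sim := by
  obtain ⟨K, hK⟩ := hb
  obtain ⟨Ki, hi⟩ := i.exec_comp
  refine ⟨K + 12 + (Ki + 8), fun δ s h hr => ?_⟩
  obtain ⟨t, s1, h1, h2, h3, h4⟩ := hi 0 s h hr
  obtain ⟨s2, h1', h3', h4'⟩ := exec_addrProg 0 k.idx s1
  have hr2 := h4'.rep (h4.rep hr)
  have hf := (h4.trans h4' le_rfl).frame δ
  have h9 : s2.reg 3 = 16 * i.eval h + k.idx := by simpa [h3] using h3'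
  have e3 := Exec.load (3 * δ + 2) 3 s2
  rw [h9] at e3
  set q := s2.mem (16 * i.eval h + k.idx) with hq
  have hr3 := hr2.setCtl δ q
  have hl := hr3.L k (i.eval h)
  obtain ⟨t', s4, e4, hr4, hf4, ht4, hk4⟩ := Sim.each_loop hK r δ (h.L k (i.eval h)) _ _ hr3
    (by rwa [show (s2.setReg (3 * δ + 2) q).reg (3 * δ + 2) = q by simp])
  refine ⟨_, s4, .seq h1 (.seq h1' (.seq e3 e4)), hr4,
    hf.trans ((frame_setCtl δ s2 q).trans hf4 le_rfl) le_rfl, ht4, ?_⟩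
  simp only [run]
  nlinarith

/-- The number of iterations is fixed at entry in a control register that the body cannot change.
Test, constant and decrement account for the 3 extra steps per iteration. -/
theorem Sim.rep_loop {body : Cmd} {K : ℕ} (hK : ∀ δ s h, Rep s h → ∃ t s',
    Exec (body.comp δ) s t s' ∧ Rep s' (body.run h) ∧ Frame δ s s' ∧
    h.time ≤ (body.run h).time ∧ t ≤ K * ((body.run h).time - h.time + 1)) (δ n : ℕ) :
    ∀ (s : State) (h : Store), Rep s h → s.reg (3 * δ + 2) = n → ∃ t s',
    Exec (.while (3 * δ + 2) (.seq (.const 3 1) <| .seq (.sub (3 * δ + 2) (3 * δ + 2) 3)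
        (body.comp (δ + 1)))) s t s' ∧
    Rep s' ((fun g => body.run g.tick)^[n] h) ∧ Frame δ s s' ∧
    h.time ≤ ((fun g => body.run g.tick)^[n] h).time ∧
    t ≤ (K + 3) * (((fun g => body.run g.tick)^[n] h).time - h.time) + 1 := by
  induction n with
  | zero =>
    intro s h hr hl
    exact ⟨1, s, .while_false hl, hr, (TempEq.refl 0 s).frame δ, le_rfl, by simp⟩
  | succ n ih =>
    intro s h hr hl
    set s1 := s.setReg 3 1 with hs1
    have ht1 : TempEq 0 s s1 := TempEq.setReg (i := 0) le_rfl _ _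
    have e2 : Exec (.sub (3 * δ + 2) (3 * δ + 2) 3) s1 1 (s1.setReg (3 * δ + 2) n) := by
      have := Exec.sub (3 * δ + 2) (3 * δ + 2) 3 s1
      rwa [show s1.reg (3 * δ + 2) - s1.reg 3 = n by
        simp only [hs1, State.setReg_reg]
        rw [if_neg (by omega), if_pos True.intro, hl, Nat.add_sub_cancel]] at this
    have hr2 := ((ht1.rep hr).setCtl δ n).tick
    have hf2 : Frame δ s _ := (ht1.frame δ).trans (frame_setCtl δ s1 n) le_rfl
    obtain ⟨t6, s6, e6, hr6, hf6, ht6, hk6⟩ := hK (δ + 1) _ _ hr2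
    obtain ⟨t7, s7, e7, hr7, hf7, ht7, hk7⟩ := ih s6 _ hr6
      (by rw [hf6.reg δ (Nat.lt_succ_self δ)]; simp)
    refine ⟨_, s7, .while_true (by omega) (.seq (.const ..) <| .seq e2 e6) e7, hr7, hf2.trans
        ⟨hf6.toHeapLE.trans hf7.toHeapLE,
          fun i hi => (hf7.reg i hi).trans (hf6.reg i (by omega))⟩ le_rfl, ?_, ?_⟩
    · simp only [Store.tick_time, Function.iterate_succ_apply] at ht6 ht7 ⊢
      omega
    · simp only [Store.tick_time, Function.iterate_succ_apply] at ht6 ht7 hk6 hk7 ⊢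
      generalize ((fun g => body.run g.tick)^[n] (body.run h.tick)).time = T at *
      generalize (body.run h.tick).time = T' at *
      obtain ⟨x, rfl⟩ := Nat.exists_eq_add_of_le ht6
      obtain ⟨y, rfl⟩ := Nat.exists_eq_add_of_le ht7
      rw [show h.time + 1 + x - (h.time + 1) = x by omega] at hk6
      rw [show h.time + 1 + x + y - (h.time + 1 + x) = y by omega] at hk7
      rw [show h.time + 1 + x + y - h.time = y + x + 1 by omega]
      nlinarith

theorem Sim.rep (e : Expr) {body : Cmd} (hb : body.Sim) : (Cmd.rep e body).Sim := by
  obtain ⟨K, hK⟩ := hb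
  obtain ⟨Ke, he⟩ := e.exec_comp
  refine ⟨K + 3 + (Ke + 2), fun δ s h hr => ?_⟩
  obtain ⟨t, s1, h1, h2, h3, h4⟩ := he 0 s h hr
  have e3 := Exec.copy (3 * δ + 2) 3 s1
  rw [show s1.reg 3 = e.eval h from h3] at e3
  obtain ⟨t', s4, e4, hr4, hf4, ht4, hk4⟩ := Sim.rep_loop hK δ (e.eval h) _ _
    ((h4.rep hr).setCtl δ (e.eval h)) (by simp)
  refine ⟨_, s4, .seq h1 (.seq e3 e4), hr4,
    (h4.frame δ).trans ((frame_setCtl δ s1 _).trans hf4 le_rfl) le_rfl, ht4, ?_⟩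
  simp only [run]
  nlinarith

/-- Every command is simulated by its compilation. -/
theorem sim (c : Cmd) : c.Sim := by
  induction c with
  | skip => exact sim_skip
  | set r e => exact sim_set r e
  | put k i e => exact sim_put k i e
  | push k i e => exact sim_push k i e
  | pop r k i => exact sim_pop r k i
  | read r => exact sim_read r
  | write e => exact sim_write e
  | seq a b iha ihb => exact iha.seq ihb
  | ite e a b iha ihb => exact iha.ite e ihb
  | each r k i body ih => exact ih.each r k i
  | rep e body ih => exact ih.rep e

end Cmd

/-- The initial store on input `w`. -/
def Store.init (w : List ℕ) : Store where
  v := fun _ => 0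
  A := fun _ _ => 0
  L := fun _ _ => []
  inp := w
  out := []
  time := 0

/-- Compiled commands compute the output of the command, in time linear in the number of loop
iterations. -/
theorem Cmd.computes (c : Cmd) : ∃ K, ∀ w, ∃ t,
    Computes (c.comp 0) w t (c.run (.init w)).out ∧ t ≤ K * ((c.run (.init w)).time + 1) := by
  obtain ⟨K, hK⟩ := c.sim
  refine ⟨K, fun w => ?_⟩
  obtain ⟨t, s', h1, h2, -, -, h5⟩ := hK 0 (State.init w) (Store.init w)
    ⟨fun _ => rfl, fun _ _ => rfl, fun _ _ => rfl, rfl, rfl⟩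
  exact ⟨t, ⟨s', h1, h2.out⟩, by simpa [Store.init] using h5⟩

end RAM

/-! ## Elimination of ears -/

namespace FCQ

/-- The sets in the list `R` can be removed, one after the other, as ears of the hypergraph whose
hyperedges are the remaining sets and the sets in `X`. -/
def Elim {α : Type*} (X : Set (Set α)) : List (Set α) → Prop
  | [] => True
  | r :: R => (∃ f, (f ∈ X ∨ f ∈ R) ∧ ∀ g, (g ∈ X ∨ g ∈ R) → r ∩ g ⊆ f) ∧ Elim X R

namespace Elim

variable {α : Type*} {X : Set (Set α)} {R : List (Set α)}

/-- A remaining set meets `e` only inside `f`, which is already in the base, so `e` imposes no new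
condition on the ears. -/
theorem insert_of_subset (h : Elim X R) {e f : Set α} (hf : f ∈ X) (he : ∀ r ∈ R, e ∩ r ⊆ f) :
    Elim (insert e X) R := by
  induction R with
  | nil => trivial
  | cons r R ih =>
    obtain ⟨⟨w, hw, hw'⟩, h⟩ := h
    refine ⟨⟨w, hw.imp (Set.mem_insert_of_mem _) id, ?_⟩,
      ih h fun r' hr' => he r' (List.mem_cons_of_mem _ hr')⟩
    rintro g ((rfl | hg) | hg)
    · exact fun x hx => hw' f (.inl hf) ⟨hx.1, he r List.mem_cons_self ⟨hx.2, hx.1⟩⟩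
    · exact hw' g (.inl hg)
    · exact hw' g (.inr hg)

/-- While the sets in `R` are removed, it does not matter whether `f` counts as base or as last in
the list; at the end `f` is an ear with witness `w`. -/
theorem append_singleton {f w : Set α} (h : Elim (insert f X) R) (hw : w ∈ X)
    (hw' : ∀ g ∈ X, f ∩ g ⊆ w) : Elim X (R ++ [f]) := by
  induction R with
  | nil => exact ⟨⟨w, .inl hw, by simpa using hw'⟩, trivial⟩
  | cons r R ih =>
    obtain ⟨⟨w, hw, hw'⟩, h⟩ := h
    have key : ∀ g, (g ∈ X ∨ g ∈ R ++ [f]) ↔ (g ∈ insert f X ∨ g ∈ R) := fun g => by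
      simp only [List.mem_append, List.mem_singleton, Set.mem_insert_iff]; tauto
    exact ⟨⟨w, (key w).2 hw, fun g hg => hw' g ((key g).1 hg)⟩, ih h⟩

/-- A further copy of a set is an ear whose witness is the copy left behind. This accounts for
distinct atoms with equal variable sets. -/
theorem append_of_subset (h : Elim X R) {D : List (Set α)} (hD : ∀ r ∈ D, r ∈ R) :
    Elim X (D ++ R) := by
  induction D with
  | nil => exact h
  | cons r D ih =>
    exact ⟨⟨r, .inr (List.mem_append_right _ (hD r List.mem_cons_self)),
      fun g _ => Set.inter_subset_left⟩, ih fun r' hr' => hD r' (List.mem_cons_of_mem _ hr')⟩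

/-- The witness of an ear, intersected with `A`, witnesses the trace of that ear. Applied with `A` =
free(Q), this gives the hypergraph of the first search. -/
theorem inter (h : Elim X R) (A : Set α) :
    Elim ((· ∩ A) '' X) (R.map (· ∩ A)) := by
  induction R with
  | nil => trivial
  | cons r R ih =>
    obtain ⟨⟨w, hw, hw'⟩, h⟩ := h
    refine ⟨⟨w ∩ A, hw.imp (Set.mem_image_of_mem (· ∩ A))
      (List.mem_map_of_mem (f := (· ∩ A))), ?_⟩, ih h⟩
    rintro _ (⟨g, hg, rfl⟩ | hg)
    · exact fun x hx => ⟨hw' g (.inl hg) ⟨hx.1.1, hx.2.1⟩, hx.1.2⟩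
    · obtain ⟨g, hg', rfl⟩ := List.mem_map.1 hg
      exact fun x hx => ⟨hw' g (.inr hg') ⟨hx.1.1, hx.2.1⟩, hx.1.2⟩

/-- If the trace of `e` on the base is maximal, then it is contained in a single hyperedge of the
base, and `e` can be moved to the base. -/
theorem exchange {e : Set α} (h : Elim X R) (he : e ∈ R)
    (hmax : ∀ g ∈ R, e ∩ ⋃₀ X ⊆ g → g ∩ ⋃₀ X ⊆ e) :
    (∃ f ∈ X, e ∩ ⋃₀ X ⊆ f) ∧ ∃ R', (e :: R').Perm R ∧ Elim (insert e X) R' := by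
  induction R generalizing e with
  | nil => simp at he
  | cons r R ih =>
    obtain ⟨⟨f, hf, hf'⟩, h⟩ := h
    by_cases heR : e ∈ R
    · obtain ⟨h1, R', h2, h3⟩ := ih h heR fun g hg => hmax g (List.mem_cons_of_mem _ hg)
      -- Moving `e` from the list to the base does not change the family against which `r` has to be
      -- an ear, so `r` stays in front.
      have key : ∀ g, (g ∈ insert e X ∨ g ∈ R') ↔ (g ∈ X ∨ g ∈ R) := fun g => by
        rw [← h2.mem_iff, List.mem_cons, Set.mem_insert_iff]; tauto
      exact ⟨h1, r :: R', (List.Perm.swap r e R').trans (h2.cons r),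
        ⟨f, (key f).2 hf, fun g hg => hf' g ((key g).1 hg)⟩, h3⟩
    · obtain rfl : e = r := (List.mem_cons.1 he).resolve_right heR
      have hef : e ∩ ⋃₀ X ⊆ f := fun x hx => by
        obtain ⟨g, hg, hxg⟩ := hx.2
        exact hf' g (.inl hg) ⟨hx.1, hxg⟩
      rcases hf with hf | hf
      · exact ⟨⟨f, hf, hef⟩, R, .refl _, h.insert_of_subset hf fun r hr => hf' r (.inr hr)⟩
      -- Maximality makes the traces of `f` and `e` equal, so `f` is maximal too and the induction
      -- hypothesis moves it to the base. Then `e` joins the base at no cost, being attached to `f`,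
      -- and `f` is put back as the last ear with witness `e`.
      · have hfe := hmax f (List.mem_cons_of_mem _ hf) hef
        obtain ⟨⟨f', h1, h1'⟩, R', h2, h3⟩ := ih h hf fun g hg hfg x hx => by
          have : g ∩ ⋃₀ X ⊆ e := hmax g (List.mem_cons_of_mem _ hg)
            fun x hx => hfg ⟨hef hx, hx.2⟩
          exact hef ⟨this hx, hx.2⟩
        refine ⟨⟨f', h1, fun x hx => h1' ⟨hef hx, hx.2⟩⟩, R' ++ [f], ?_, ?_⟩
        · exact ((List.perm_append_singleton f R').trans h2).cons e
        · refine append_singleton (w := e) ?_ (Set.mem_insert _ _) ?_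
          · rw [Set.insert_comm]
            refine h3.insert_of_subset (Set.mem_insert _ _) fun r hr => hf' r (.inr ?_)
            exact h2.mem_iff.1 (List.mem_cons_of_mem _ hr)
          · rintro g (rfl | hg)
            · exact Set.inter_subset_right
            · exact fun x hx => hfe ⟨hx.1, g, hg, hx.2⟩

/-- The surplus copies in `L` are eliminated first, and then the distinct sets in the order `R`. -/
theorem exists_perm (h : Elim X R) (hR : R.Nodup) {L : List (Set α)} (hL : ∀ r, r ∈ L ↔ r ∈ R) :
    ∃ R', R'.Perm L ∧ Elim X R' := by
  obtain ⟨l, hl, hs⟩ := List.subperm_of_subset hR fun r hr => (hL r).2 hr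
  obtain ⟨D, hD⟩ := hs.exists_perm_append
  exact ⟨D ++ R, List.perm_append_comm.trans ((hl.symm.append_right D).trans hD.symm), h.append_of_subset fun r hr =>
    (hL r).1 (hD.mem_iff.2 (List.mem_append_right _ hr))⟩

/-- A family of sets with a join tree can be eliminated. -/
theorem exists_of_isTree {α V : Type*} [Finite V] (T : SimpleGraph V) (hT : T.IsTree)
    (B : V → Set α) (hB : ∀ x, (T.induce {t | x ∈ B t}).Preconnected) :
    ∃ l : List V, l.Nodup ∧ (∀ t, t ∈ l) ∧ Elim {∅} (l.map B) := by
  classical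
  induction hn : Nat.card V generalizing V with
  | zero =>
    have := hT.connected.nonempty
    exact absurd hn Nat.card_pos.ne'
  | succ n ih =>
    rcases subsingleton_or_nontrivial V with hV | hV
    · obtain ⟨v⟩ := hT.connected.nonempty
      exact ⟨[v], List.nodup_singleton v, fun t => by simp [Subsingleton.elim t v],
        ⟨∅, .inl rfl, by simp⟩, trivial⟩
    · have := Fintype.ofFinite V
      obtain ⟨v, hv⟩ := hT.exists_vert_degree_one_of_nontrivial
      obtain ⟨u, hvu, hu⟩ := SimpleGraph.degree_eq_one_iff_existsUnique_adj.1 hv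
      have hsub : ∀ w, T.Adj v w → w = u := hu
      obtain ⟨l, hl1, hl2, hl3⟩ := ih (V := ({v}ᶜ : Set V)) (T.induce {v}ᶜ)
        ⟨hT.connected.induce_compl_singleton_of_degree_eq_one hv, hT.isAcyclic.induce _⟩
        (fun t => B t) (fun x => by
          -- Removing the leaf `v` keeps the nodes containing `x` connected, as `v` has at most one
          -- neighbour among them.
          have h1 := (hB x).induce_of_degree_eq_one (s := {t | t.1 ≠ v}) (by
            rintro ⟨t, ht⟩ htv a ha b hb
            obtain rfl : t = v := by simpa using htv
            exact Subtype.ext ((hsub a ha).trans (hsub b hb).symm))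
          let φ : (T.induce {t | x ∈ B t}).induce {t | t.1 ≠ v} →g
              (T.induce {v}ᶜ).induce {t : ({v}ᶜ : Set V) | x ∈ B t} :=
            ⟨fun t => ⟨⟨t.1.1, t.2⟩, t.1.2⟩, fun h => h⟩
          refine h1.map φ ?_
          rintro ⟨⟨t, ht⟩, ht'⟩
          exact ⟨⟨⟨t, ht'⟩, ht⟩, rfl⟩)
        (by
          rw [Nat.card_coe_set_eq, Set.ncard_compl, Set.ncard_singleton, hn]; rfl)
      refine ⟨v :: l.map Subtype.val, ?_, fun t => ?_, ⟨B u, .inr ?_, ?_⟩, ?_⟩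
      · refine List.nodup_cons.2 ⟨fun h => ?_, hl1.map Subtype.val_injective⟩
        obtain ⟨t, -, ht⟩ := List.mem_map.1 h
        exact t.2 ht
      · by_cases h : t = v
        · simp [h]
        · exact List.mem_cons_of_mem _ (List.mem_map.2 ⟨⟨t, h⟩, hl2 _, rfl⟩)
      · exact List.mem_map_of_mem (List.mem_map.2 ⟨⟨u, hvu.ne'⟩, hl2 _, rfl⟩)
      · rintro g (rfl | hg)
        · simp
        · obtain ⟨t, ht, rfl⟩ := List.mem_map.1 hg
          obtain ⟨⟨t, htv⟩, -, rfl⟩ := List.mem_map.1 ht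
          rintro x ⟨hxv, hxt⟩
          -- A walk from `v` to `t` through nodes containing `x` starts with the only neighbour `u`
          -- of `v`, hence `x ∈ B u`.
          obtain ⟨p⟩ := hB x ⟨v, hxv⟩ ⟨t, hxt⟩
          have hp : ¬ p.Nil := fun h => htv (congrArg Subtype.val h.eq).symm
          have := p.adj_snd hp
          rw [← hsub _ this]
          exact p.snd.2
      · rwa [List.map_map]

end Elim

end FCQ

/-! ### Elimination orders of free-connex acyclic queries. -/

namespace FCQ

theorem AlphaAcyclic.exists_elim {H : Hypergraph Var} (hH : AlphaAcyclic H) {L : List (Set Var)}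
    (hL : ∀ r, r ∈ L ↔ r ∈ H.edgeSet) : ∃ R, R.Perm L ∧ Elim {∅} R := by
  obtain ⟨T, hT, hB⟩ := hH
  have hfin : H.edgeSet.Finite := (List.finite_toSet L).subset fun r hr => (hL r).2 hr
  have := hfin.to_subtype
  obtain ⟨l, h1, h2, h3⟩ := Elim.exists_of_isTree T hT (fun t => t.1) fun x => by
    by_cases hx : x ∈ H.vertexSet
    · exact hB x hx
    · rintro ⟨t, ht⟩
      exact absurd (H.subset_vertexSet_of_mem_edgeSet' t.2 ht) hx
  refine h3.exists_perm (h1.map Subtype.val_injective) fun r => ?_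
  rw [hL, List.mem_map]
  exact ⟨fun hr => ⟨⟨r, hr⟩, h2 _, rfl⟩, fun ⟨t, _, ht⟩ => ht ▸ t.2⟩

variable {σ : Schema}

/-- The variable sets of the atoms of a query. -/
def CQ.varSets (Q : CQ σ) : List (Set Var) := Q.body.map fun α => (α.vars : Set Var)

theorem CQ.mem_varSets (Q : CQ σ) (r : Set Var) : r ∈ Q.varSets ↔ r ∈ Q.hypergraph.edgeSet := by
  simp only [varSets, List.mem_map, eq_comm]
  rfl

/-- Starting point of the first search: traces on free(Q) inherit an elimination order from H(Q). -/
theorem CQ.exists_elim_inter_free (Q : CQ σ) (h : Q.IsFreeConnexAcyclic) :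
    ∃ R, R.Perm (Q.varSets.map (· ∩ (Q.free : Set Var))) ∧ Elim {∅} R := by
  obtain ⟨R, h1, h2⟩ := h.1.exists_elim Q.mem_varSets
  refine ⟨_, h1.map (· ∩ (Q.free : Set Var)), ?_⟩
  simpa using h2.inter (Q.free : Set Var)

/-- Starting point of the second search. In the extended hypergraph over the base {∅}, all traces
are empty and so maximal; the exchange therefore moves free(Q) from the list to the base. -/
theorem CQ.exists_elim_free (Q : CQ σ) (h : Q.IsFreeConnexAcyclic) :
    ∃ R, R.Perm Q.varSets ∧ Elim {(Q.free : Set Var), ∅} R := by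
  obtain ⟨R, h1, h2⟩ := h.2.exists_elim (L := (Q.free : Set Var) :: Q.varSets) fun r => by
    rw [List.mem_cons, Q.mem_varSets]; rfl
  obtain ⟨-, R', h3, h4⟩ := h2.exchange (e := (Q.free : Set Var))
    (h1.mem_iff.2 List.mem_cons_self) (by simp)
  exact ⟨R', (List.perm_cons _).1 (h3.trans h1), h4⟩

/-! ## Decompositions from sequences of bags with the running intersection property -/

/-- A sequence of `M + 1` bags, in which every bag but the first one has a parent among the
preceding ones, such that the running intersection property holds and each bag is comparable with
the bag of its parent. -/
structure BagSeq (M : ℕ) (bag : ℕ → List ℕ) (par : ℕ → ℕ) : Prop where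
  par_lt : ∀ t, 0 < t → t ≤ M → par t < t
  nodup : ∀ t ≤ M, (bag t).Nodup
  subset : ∀ t, 0 < t → t ≤ M → bag t ⊆ bag (par t) ∨ bag (par t) ⊆ bag t
  rip : ∀ t ≤ M, ∀ s < t, ∀ x ∈ bag t, x ∈ bag s → x ∈ bag (par t)

namespace BagSeq

/-- The tree given by a parent function. -/
def graph (M : ℕ) (par : ℕ → ℕ) : SimpleGraph (Fin (M + 1)) where
  Adj i j := (0 < i.1 ∧ par i = j.1 ∧ par i < i) ∨ (0 < j.1 ∧ par j = i.1 ∧ par j < j)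
  symm := ⟨fun _ _ h => h.symm⟩
  loopless := ⟨fun i h => by rcases h with h | h <;> omega⟩

variable {M : ℕ} {bag : ℕ → List ℕ} {par : ℕ → ℕ}

theorem val_ofNat {t : ℕ} (ht : t ≤ M) : (Fin.ofNat (M + 1) t).1 = t :=
  Nat.mod_eq_of_lt (Nat.lt_succ_of_le ht)

theorem ofNat_inj {s t : ℕ} (hs : s ≤ M) (ht : t ≤ M) :
    Fin.ofNat (M + 1) s = Fin.ofNat (M + 1) t ↔ s = t := by
  rw [Fin.ext_iff, val_ofNat hs, val_ofNat ht]

/-- Parents have smaller numbers, so following them inside `S` must end at the only exempt node `m`.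
-/
theorem connected_induce (h : BagSeq M bag par) {S : Set (Fin (M + 1))} {m : Fin (M + 1)}
    (hm : m ∈ S) (hS : ∀ t ∈ S, t ≠ m → 0 < t.1 ∧ Fin.ofNat (M + 1) (par t) ∈ S) :
    ((graph M par).induce S).Connected := by
  have key : ∀ n (t : Fin (M + 1)) (ht : t ∈ S), t.1 = n →
      ((graph M par).induce S).Reachable ⟨t, ht⟩ ⟨m, hm⟩ := by
    intro n
    induction n using Nat.strong_induction_on with
    | _ n ih =>
      intro t ht htn
      by_cases htm : t = m
      · subst htm; exact .refl _
      · obtain ⟨h0, hp⟩ := hS t ht htm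
        have hlt := h.par_lt t h0 (by omega)
        have hv := val_ofNat (M := M) (t := par t) (by omega)
        refine .trans (SimpleGraph.Adj.reachable ?_) (ih (par t) (by omega) _ hp hv)
        exact .inl ⟨h0, hv.symm, hlt⟩
  exact (SimpleGraph.connected_iff _).2
    ⟨fun a b => (key _ a.1 a.2 rfl).trans (key _ b.1 b.2 rfl).symm, ⟨⟨m, hm⟩⟩⟩

/-- The list `ts` may enumerate the nodes 1, …, M in any order, because the program outputs edges in
decreasing order. -/
theorem edge_iff (h : BagSeq M bag par) {ts : List ℕ} (hts : ∀ t, t ∈ ts ↔ 0 < t ∧ t ≤ M)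
    (e : Sym2 (Fin (M + 1))) : e ∈ (graph M par).edgeSet ↔
      e ∈ ts.map fun t => s(Fin.ofNat (M + 1) t, Fin.ofNat (M + 1) (par t)) := by
  rw [List.mem_map]
  induction e with
  | _ i j =>
    have aux : ∀ i j : Fin (M + 1), 0 < i.1 → par i = j.1 → par i < i →
        ∃ t ∈ ts, s(Fin.ofNat (M + 1) t, Fin.ofNat (M + 1) (par t)) = s(i, j) := by
      intro i j h0 h1 h2
      refine ⟨i, (hts _).2 ⟨h0, by omega⟩, ?_⟩
      rw [h1]
      simp
    constructor
    · rintro (⟨h0, h1, h2⟩ | ⟨h0, h1, h2⟩)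
      · exact aux i j h0 h1 h2
      · rw [Sym2.eq_swap]; exact aux j i h0 h1 h2
    · rintro ⟨t, ht, hij⟩
      obtain ⟨h0, h1⟩ := (hts t).1 ht
      have h2 := h.par_lt t h0 h1
      rw [← hij]
      refine .inl ⟨?_, ?_⟩
      · rwa [val_ofNat h1]
      · rw [val_ofNat h1, val_ofNat (by omega)]; exact ⟨rfl, h2⟩

/-- Distinct nodes give distinct edges, since `t` is recovered as the larger endpoint. -/
theorem edges_nodup (h : BagSeq M bag par) {ts : List ℕ} (hts : ∀ t, t ∈ ts ↔ 0 < t ∧ t ≤ M)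
    (hn : ts.Nodup) :
    (ts.map fun t => s(Fin.ofNat (M + 1) t, Fin.ofNat (M + 1) (par t))).Nodup := by
  refine hn.map_on fun t ht t' ht' htt' => ?_
  obtain ⟨h0, h1⟩ := (hts t).1 ht
  obtain ⟨h0', h1'⟩ := (hts t').1 ht'
  have h2 := h.par_lt t h0 h1
  have h2' := h.par_lt t' h0' h1'
  rw [Sym2.eq_iff, ofNat_inj h1 h1', ofNat_inj (by omega) (by omega), ofNat_inj h1 (by omega),
    ofNat_inj (by omega) h1'] at htt'
  omega

/-- A connected graph on M + 1 vertices with M edges. -/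
theorem isTree (h : BagSeq M bag par) : (graph M par).IsTree := by
  rw [SimpleGraph.isTree_iff_connected_and_card]
  constructor
  · rw [← (SimpleGraph.induceUnivIso _).connected_iff]
    exact h.connected_induce (m := 0) (Set.mem_univ _)
      fun t _ ht => ⟨Nat.pos_of_ne_zero fun h => ht (Fin.ext h), Set.mem_univ _⟩
  · have hts : ∀ t, t ∈ List.range' 1 M ↔ 0 < t ∧ t ≤ M := fun t => by
      rw [List.mem_range'_1]; omega
    have h1 := h.edges_nodup hts List.nodup_range'
    have h2 : (graph M par).edgeSet = ((List.range' 1 M).map fun t =>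
        s(Fin.ofNat (M + 1) t, Fin.ofNat (M + 1) (par t))).toFinset := by
      ext e
      rw [h.edge_iff hts, List.coe_toFinset, Set.mem_ofPred_eq]
    rw [h2, Nat.card_coe_set_eq, Set.ncard_coe_finset, List.toFinset_card_of_nodup h1]
    simp

/-- The bridge from the program's arrays to decompositions: the tree comes from the parent function,
running intersection gives the path condition, and the witness is connected since it is closed under
parents down to its root `m`. -/
theorem exists_decomposition (h : BagSeq M bag par) (Q : CQ σ) (cov : ℕ → ℕ) (wit : List ℕ)
    (hcov : ∀ t ≤ M, ∃ α, Q.body[cov t]? = some α ∧ ∀ x ∈ bag t, x ∈ α.vars)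
    (hcomp : ∀ e α, Q.body[e]? = some α →
      ∃ t ≤ M, cov t = e ∧ ∀ x, x ∈ bag t ↔ x ∈ α.vars)
    (hwn : wit.Nodup) (hwM : ∀ t ∈ wit, t ≤ M) {m : ℕ} (hm : m ∈ wit)
    (hwp : ∀ t ∈ wit, t ≠ m → 0 < t ∧ par t ∈ wit)
    (hfree : ∀ x, x ∈ Q.free ↔ ∃ t ∈ wit, x ∈ bag t)
    {ts : List ℕ} (hts : ∀ t, t ∈ ts ↔ 0 < t ∧ t ≤ M) (hn : ts.Nodup) :
    ∃ H : FC1GHD Q (Fin (M + 1)), H.Represents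
      ((M + 1) :: ((List.range (M + 1)).flatMap fun t => encodeList (bag t) ++ [cov t])
        ++ M :: (ts.flatMap fun t => [t, par t]) ++ encodeList wit) ∧ H.IsComplete ∧
      H.witness.card = wit.length ∧
      ∀ u v, H.tree.Adj u v → H.bag u ⊆ H.bag v ∨ H.bag v ⊆ H.bag u := by
  choose cover hcover1 hcover2 using fun t : Fin (M + 1) => hcov t (by omega)
  have hwn' : (wit.map (Fin.ofNat (M + 1))).Nodup := hwn.map_on fun s hs t ht hst =>
    (ofNat_inj (hwM s hs) (hwM t ht)).1 hst
  have hmem : ∀ t, cover t ∈ Q.atoms := fun t => List.mem_of_getElem? (hcover1 t)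
  let H : FC1GHD Q (Fin (M + 1)) :=
    { tree := graph M par
      tree_isTree := h.isTree
      bag := fun t => (bag t).toFinset
      bag_subset := fun t x hx =>
        ⟨cover t, hmem t, hcover2 t x (by simpa using hx)⟩
      atom_covered := fun α hα => by
        obtain ⟨e, he⟩ := List.mem_iff_getElem?.1 hα
        obtain ⟨t, ht, -, ht'⟩ := hcomp e α he
        refine ⟨Fin.ofNat (M + 1) t, fun x hx => ?_⟩
        rw [val_ofNat ht]
        simpa using (ht' x).2 hx
      path_condition := fun y hy => by
        have hex : ∃ t, t ≤ M ∧ y ∈ bag t := by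
          obtain ⟨α, hα, hy⟩ := hy
          obtain ⟨e, he⟩ := List.mem_iff_getElem?.1 hα
          obtain ⟨t, ht, -, ht'⟩ := hcomp e α he
          exact ⟨t, ht, (ht' y).2 hy⟩
        classical
        obtain ⟨h1, h2⟩ := Nat.find_spec hex
        -- The root is the first node containing `y`; running intersection against it puts `y` into
        -- the parent of every later node containing `y`.
        refine h.connected_induce (m := Fin.ofNat (M + 1) (Nat.find hex)) ?_ fun t ht htm => ?_
        · simp only [Set.mem_ofPred_eq, List.mem_toFinset]
          rwa [val_ofNat h1]
        · have hty : y ∈ bag t := by simpa using ht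
          have hle : Nat.find hex ≤ t := Nat.find_le ⟨by omega, hty⟩
          have hlt : Nat.find hex < t := lt_of_le_of_ne hle fun h => htm <| by
            rw [Fin.ext_iff, val_ofNat h1, h]
          have := h.par_lt t (by omega) (by omega)
          refine ⟨by omega, ?_⟩
          simp only [Set.mem_ofPred_eq, List.mem_toFinset]
          rw [val_ofNat (by omega)]
          exact h.rip t (by omega) _ hlt y hty h2
      cover := cover
      cover_mem := hmem
      bag_subset_cover := fun t x hx => hcover2 t x (by simpa using hx)
      witness := (wit.map (Fin.ofNat (M + 1))).toFinset
      witness_connected := by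
        refine h.connected_induce (m := Fin.ofNat (M + 1) m) ?_ fun t ht htm => ?_
        · simpa using ⟨m, hm, rfl⟩
        · simp only [List.coe_toFinset, List.mem_map, Set.mem_ofPred_eq] at ht ⊢
          obtain ⟨t, ht, rfl⟩ := ht
          obtain ⟨h0, h1⟩ := hwp t ht fun h => htm (h ▸ rfl)
          rw [val_ofNat (hwM t ht)]
          exact ⟨h0, par t, h1, rfl⟩
      free_eq := by
        ext x
        simp only [Finset.mem_coe, hfree, List.mem_toFinset, List.mem_map, Set.mem_iUnion,
          List.coe_toFinset, Set.mem_ofPred_eq, exists_prop, exists_exists_and_eq_and]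
        refine exists_congr fun t => and_congr_right fun ht => ?_
        rw [val_ofNat (hwM t ht)] }
  refine ⟨H, ⟨fun t => bag t, fun t => cov t,
    ts.map fun t => (Fin.ofNat (M + 1) t, Fin.ofNat (M + 1) (par t)),
    wit.map (Fin.ofNat (M + 1)), fun t => ⟨h.nodup t (by omega), rfl⟩, hcover1, ?_, fun e => ?_,
    hwn', rfl, ?_⟩, fun α hα => ?_, ?_, fun u v huv => ?_⟩
  · rw [List.map_map]; exact h.edges_nodup hts hn
  · rw [List.map_map]; exact h.edge_iff hts e
  · have e1 : (List.finRange (M + 1)).flatMap (fun t => encodeList (bag t.1) ++ [cov t.1])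
        = (List.range (M + 1)).flatMap fun t => encodeList (bag t) ++ [cov t] := by
      have e0 : (List.finRange (M + 1)).map (fun t => t.1) = List.range (M + 1) :=
        List.ext_getElem (by simp) (by simp)
      rw [← e0, List.flatMap_map]
    have e2 : (wit.map (Fin.ofNat (M + 1))).map (fun t : Fin (M + 1) => (t : ℕ)) = wit := by
      rw [List.map_map]
      exact (List.map_congr_left fun t ht => val_ofNat (hwM t ht)).trans (List.map_id' _)
    have e3 : (ts.map fun t => (Fin.ofNat (M + 1) t, Fin.ofNat (M + 1) (par t))).flatMap
        (fun e => [(e.1 : ℕ), (e.2 : ℕ)]) = ts.flatMap fun t => [t, par t] := by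
      rw [List.flatMap_map]
      refine List.flatMap_congr fun t ht => ?_
      obtain ⟨h0, h1⟩ := (hts t).1 ht
      have := h.par_lt t h0 h1
      rw [val_ofNat h1, val_ofNat (by omega)]
    have e4 : ts.length = M := by
      have : ts.Perm (List.range' 1 M) := (List.perm_ext_iff_of_nodup hn List.nodup_range').2
        fun t => by rw [hts, List.mem_range'_1]; omega
      simpa using this.length_eq
    have e5 : ((wit.map (Fin.ofNat (M + 1))) >>= fun a => pure a.1) = wit := by
      change (wit.map (Fin.ofNat (M + 1))).flatMap (fun a => [a.1]) = wit
      rw [← List.map_eq_flatMap, e2]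
    simp only [e3, List.length_map, e4, List.map_id']
    rw [e1, e5]
  · obtain ⟨e, he⟩ := List.mem_iff_getElem?.1 hα
    obtain ⟨t, ht, hte, ht'⟩ := hcomp e α he
    refine ⟨Fin.ofNat (M + 1) t, ?_, ?_⟩
    · ext x
      simp only [H, List.mem_toFinset]
      rw [val_ofNat ht, ht']
    · have := hcover1 (Fin.ofNat (M + 1) t)
      rw [val_ofNat ht, hte, he] at this
      exact Option.some.inj this
  · simp only [H]
    rw [List.toFinset_card_of_nodup hwn', List.length_map]
  · have aux : ∀ u v : Fin (M + 1), 0 < u.1 → par u = v.1 →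
        H.bag u ⊆ H.bag v ∨ H.bag v ⊆ H.bag u := fun u v h0 h1 => by
      rcases h.subset u h0 (by omega) with h2 | h2
      · exact .inl fun x hx => by
          simp only [H, List.mem_toFinset] at hx ⊢; rw [← h1]; exact h2 hx
      · exact .inr fun x hx => by
          simp only [H, List.mem_toFinset] at hx ⊢; rw [← h1] at hx; exact h2 hx
    rcases huv with ⟨h0, h1, -⟩ | ⟨h0, h1, -⟩
    · exact aux u v h0 h1
    · exact (aux v u h0 h1).symm

end BagSeq

end FCQ

/-! ## Invariants of the construction of the decomposition -/

namespace FCQ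

/-- The nodes `0, …, n` of a decomposition under construction; the owner `M x` of a variable is the
first node whose bag contains it (`0` if there is none). -/
structure NodeInv (d : ℕ) (vs : ℕ → List ℕ) (n : ℕ) (bag : ℕ → List ℕ) (par cov M : ℕ → ℕ) :
    Prop where
  seq : BagSeq n bag par
  cov_lt : ∀ t ≤ n, cov t < d
  cov_sub : ∀ t ≤ n, bag t ⊆ vs (cov t + 1)
  zero : bag 0 = []
  marked : ∀ t ≤ n, ∀ x ∈ bag t, 0 < M x ∧ M x ≤ t
  owner : ∀ x, M x ≠ 0 → M x ≤ n ∧ x ∈ bag (M x)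

namespace NodeInv

variable {d : ℕ} {vs : ℕ → List ℕ} {n : ℕ} {bag : ℕ → List ℕ} {par cov M : ℕ → ℕ}

/-- If `S` lies in the bag of a node `i` after `p`, then each element of `S` already occurs at its
owner, which is at most `p` and so before `i`; by running intersection `S` lies in the bag of the
parent of `i`. The descent stops at `p`, since it cannot pass the owner `p` of some element. -/
theorem subset_owner (h : NodeInv d vs n bag par cov M) {S : List ℕ} {p : ℕ}
    (hp : ∃ x ∈ S, M x = p) (hp' : ∀ x ∈ S, M x ≤ p) {i : ℕ} (hi : i ≤ n) (hS : S ⊆ bag i) :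
    S ⊆ bag p := by
  induction i using Nat.strong_induction_on with
  | _ i ih =>
    obtain ⟨x, hx, hxp⟩ := hp
    have hpi : p ≤ i := hxp ▸ (h.marked i hi x (hS hx)).2
    rcases hpi.eq_or_lt with rfl | hlt
    · exact hS
    · have hlt' := h.seq.par_lt i (by omega) hi
      refine ih (par i) hlt' (by omega) fun y hy => ?_
      have hy' := h.marked i hi y (hS hy)
      have hyp := hp' y hy
      exact h.seq.rip i hi (M y) (by omega) y (hS hy) (h.owner y hy'.1.ne').2

/-- Running intersection for the new node only asks that its already owned variables lie in the
parent's bag. The other variables of the new bag get the new node as owner. -/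
theorem snoc (h : NodeInv d vs n bag par cov M) {b : List ℕ} {p c : ℕ} {M' : ℕ → ℕ} (hp : p ≤ n)
    (hb : b.Nodup) (hc : c < d) (hbc : b ⊆ vs (c + 1)) (hsub : b ⊆ bag p ∨ bag p ⊆ b)
    (hM : ∀ x ∈ b, M x ≠ 0 → x ∈ bag p) (hM' : ∀ x, M' x = if x ∈ b ∧ M x = 0 then n + 1 else M x) :
    NodeInv d vs (n + 1) (Function.update bag (n + 1) b) (Function.update par (n + 1) p)
      (Function.update cov (n + 1) c) M' := by
  have old : ∀ {β : Type} (f : ℕ → β) (v : β) {t : ℕ}, t ≤ n → Function.update f (n + 1) v t = f t :=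
    fun f v t ht => Function.update_of_ne (by omega) v f
  refine ⟨⟨fun t h0 ht => ?_, fun t ht => ?_, fun t h0 ht => ?_, fun t ht s hs x hx hxs => ?_⟩,
    fun t ht => ?_, fun t ht => ?_, ?_, fun t ht x hx => ?_, fun x hx => ?_⟩
  · rcases Nat.le_succ_iff.1 ht with ht | rfl
    · rw [old _ _ ht]; exact h.seq.par_lt t h0 ht
    · rw [Function.update_self]; omega
  · rcases Nat.le_succ_iff.1 ht with ht | rfl
    · rw [old _ _ ht]; exact h.seq.nodup t ht
    · rwa [Function.update_self]
  · rcases Nat.le_succ_iff.1 ht with ht | rfl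
    · have := h.seq.par_lt t h0 ht
      rw [old _ _ ht, old _ _ ht, old _ _ (by omega)]; exact h.seq.subset t h0 ht
    · rwa [Function.update_self, Function.update_self, old _ _ hp]
  · rcases Nat.le_succ_iff.1 ht with ht | rfl
    · have := h.seq.par_lt t (by omega) ht
      rw [old _ _ ht] at hx ⊢
      rw [old _ _ (by omega)] at hxs ⊢
      exact h.seq.rip t ht s hs x hx hxs
    · rw [Function.update_self] at hx ⊢
      rw [old _ _ (by omega)] at hxs ⊢
      exact hM x hx (h.marked s (by omega) x hxs).1.ne'
  · rcases Nat.le_succ_iff.1 ht with ht | rfl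
    · rw [old _ _ ht]; exact h.cov_lt t ht
    · rwa [Function.update_self]
  · rcases Nat.le_succ_iff.1 ht with ht | rfl
    · rw [old _ _ ht, old _ _ ht]; exact h.cov_sub t ht
    · rwa [Function.update_self, Function.update_self]
  · rw [old _ _ (Nat.zero_le n)]; exact h.zero
  · rw [hM']
    rcases Nat.le_succ_iff.1 ht with ht | rfl
    · rw [old _ _ ht] at hx
      have := h.marked t ht x hx
      rw [if_neg (by omega)]
      exact this
    · rw [Function.update_self] at hx
      split_ifs with hc
      · omega
      · have h0 : M x ≠ 0 := fun h0 => hc ⟨hx, h0⟩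
        have := (h.owner x h0).1
        omega
  · rw [hM'] at hx ⊢
    split_ifs at hx ⊢ with hc
    · rw [Function.update_self]; exact ⟨le_rfl, hc.1⟩
    · have := h.owner x hx
      rw [old _ _ this.1]
      exact ⟨by omega, this.2⟩

end NodeInv

/-- The list `W` of the nodes of the witness under construction. -/
structure WitInv (fr : ℕ → ℕ) (zs : List ℕ) (n : ℕ) (bag : ℕ → List ℕ) (par M : ℕ → ℕ) (dflt : ℕ)
    (W : List ℕ) : Prop where
  nodup : W.Nodup
  le : ∀ t ∈ W, 0 < t ∧ t ≤ n
  nil : dflt = 0 → W = []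
  mem : dflt ≠ 0 → dflt ∈ W
  par_mem : ∀ t ∈ W, t ≠ dflt → par t ∈ W
  -- Ensures that a maximum over owners of marked variables is not distorted when it is initialised
  -- with `dflt`.
  low : ∀ x, M x ≠ 0 → dflt ≤ M x
  own : ∀ x, fr x ≠ 0 → M x ≠ 0 → M x ∈ W
  free : ∀ t ∈ W, ∀ x ∈ bag t, fr x ≠ 0
  card : W ≠ [] → W.length + 1 ≤ 2 * (zs.filter (M · ≠ 0)).length

namespace WitInv

variable {fr : ℕ → ℕ} {zs : List ℕ} {n : ℕ} {bag bag' : ℕ → List ℕ} {par par' M M' : ℕ → ℕ}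
  {dflt : ℕ} {W : List ℕ}

theorem dflt_le (h : WitInv fr zs n bag par M dflt W) : dflt ≤ n := by
  by_cases h0 : dflt = 0
  · omega
  · exact (h.le _ (h.mem h0)).2

theorem filter_length_mono (hM : ∀ x, M x ≠ 0 → M' x ≠ 0) :
    (zs.filter (M · ≠ 0)).length ≤ (zs.filter (M' · ≠ 0)).length := by
  refine (List.monotone_filter_right zs fun x hx => ?_).length_le
  simpa using hM x (by simpa using hx)

/-- No node is added to the witness. -/
theorem keep (h : WitInv fr zs n bag par M dflt W) (hbag : ∀ t ≤ n, bag' t = bag t)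
    (hpar : ∀ t ≤ n, par' t = par t) (hM : ∀ x, M x ≠ 0 → M' x = M x)
    (hM' : ∀ x, M x = 0 → M' x ≠ 0 → M' x = n + 2 ∧ fr x = 0) :
    WitInv fr zs (n + 2) bag' par' M' dflt W where
  nodup := h.nodup
  le t ht := ⟨(h.le t ht).1, by have := h.le t ht; omega⟩
  nil := h.nil
  mem := h.mem
  par_mem t ht htd := by rw [hpar t (h.le t ht).2]; exact h.par_mem t ht htd
  low x hx := by
    by_cases h0 : M x = 0
    · have := h.dflt_le; have := hM' x h0 hx; omega
    · rw [hM x h0]; exact h.low x h0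
  own x hf hx := by
    by_cases h0 : M x = 0
    · exact absurd (hM' x h0 hx).2 hf
    · rw [hM x h0]; exact h.own x hf h0
  free t ht := by rw [hbag t (h.le t ht).2]; exact h.free t ht
  card hW := by
    have := h.card hW
    have := filter_length_mono (zs := zs) (M := M) (M' := M') fun x hx => by rwa [hM x hx]
    omega

theorem filter_length_lt (hM : ∀ x, M x ≠ 0 → M' x = M x) {x : ℕ} (hx : x ∈ zs) (h0 : M x = 0)
    (h1 : M' x ≠ 0) : (zs.filter (M · ≠ 0)).length < (zs.filter (M' · ≠ 0)).length := by
  have hs : (zs.filter (M · ≠ 0)).Sublist (zs.filter (M' · ≠ 0)) :=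
    List.monotone_filter_right zs fun x hx => by
      simpa using fun h => (by simpa using hx : M x ≠ 0) (hM x (by simpa using hx) ▸ h)
  refine lt_of_le_of_ne hs.length_le fun h => ?_
  have := hs.eq_of_length h
  have hx' : x ∈ zs.filter (M' · ≠ 0) := List.mem_filter.2 ⟨hx, by simpa using h1⟩
  rw [← this] at hx'
  simp [h0] at hx'

/-- The first node is added to the witness. -/
theorem first (h : WitInv fr zs n bag par M 0 W) (hfr : ∀ x, M x ≠ 0 → fr x ≠ 0)
    (hzs : ∀ x, x ∈ zs ↔ fr x ≠ 0)
    (hM' : ∀ x, M x = 0 → M' x ≠ 0 → M' x = n + 2)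
    (hM : ∀ x, M x ≠ 0 → M' x = M x) (hb : ∀ x ∈ bag' (n + 2), fr x ≠ 0)
    (hex : ∃ x ∈ bag' (n + 2), M x = 0 ∧ M' x ≠ 0) :
    WitInv fr zs (n + 2) bag' par' M' (n + 2) ((n + 2) :: W) := by
  have hW := h.nil rfl
  subst hW
  -- Before the first witness node nothing is marked: only free variables can be, and their owners
  -- would lie in the empty witness.
  have h0 : ∀ x, M x = 0 := fun x => by
    by_contra hx
    simpa using h.own x (hfr x hx) hx
  refine ⟨by simp, by simp, by simp, by simp, by simp, fun x hx => ?_, fun x _ hx => ?_, ?_,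
    fun _ => ?_⟩
  · exact (hM' x (h0 x) hx).ge
  · simpa using hM' x (h0 x) hx
  · simpa using hb
  · obtain ⟨x, hx, hx0, hx1⟩ := hex
    have := filter_length_lt (zs := zs) hM ((hzs x).2 (hb x hx)) hx0 hx1
    simp only [List.length_cons, List.length_nil]
    omega

/-- Two more nodes are added to the witness. -/
theorem more (h : WitInv fr zs n bag par M dflt W) (hd : dflt ≠ 0)
    (hbag : ∀ t ≤ n, bag' t = bag t) (hpar : ∀ t ≤ n, par' t = par t)
    (hzs : ∀ x, x ∈ zs ↔ fr x ≠ 0)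
    (hM' : ∀ x, M x = 0 → M' x ≠ 0 → M' x = n + 2)
    (hM : ∀ x, M x ≠ 0 → M' x = M x) (hb : ∀ x ∈ bag' (n + 2), fr x ≠ 0)
    (hs : ∀ x ∈ bag' (n + 1), fr x ≠ 0)
    (hp2 : par' (n + 2) = n + 1) (hp1 : par' (n + 1) ∈ W)
    (hex : ∃ x ∈ bag' (n + 2), M x = 0 ∧ M' x ≠ 0) :
    WitInv fr zs (n + 2) bag' par' M' dflt ((n + 2) :: (n + 1) :: W) := by
  have hle := h.dflt_le
  refine ⟨?_, fun t ht => ?_, fun h => absurd h hd, fun _ => ?_, fun t ht htd => ?_,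
    fun x hx => ?_, fun x hf hx => ?_, fun t ht => ?_, fun _ => ?_⟩
  · refine List.nodup_cons.2 ⟨fun hm => ?_, List.nodup_cons.2 ⟨fun hm => ?_, h.nodup⟩⟩
    · rcases List.mem_cons.1 hm with hm | hm
      · omega
      · have := h.le _ hm; omega
    · have := h.le _ hm; omega
  · rcases List.mem_cons.1 ht with rfl | ht
    · omega
    rcases List.mem_cons.1 ht with rfl | ht
    · omega
    · have := h.le t ht; omega
  · exact List.mem_cons_of_mem _ (List.mem_cons_of_mem _ (h.mem hd))
  · rcases List.mem_cons.1 ht with rfl | ht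
    · rw [hp2]; simp
    rcases List.mem_cons.1 ht with rfl | ht
    · exact List.mem_cons_of_mem _ (List.mem_cons_of_mem _ hp1)
    · rw [hpar t (h.le t ht).2]
      exact List.mem_cons_of_mem _ (List.mem_cons_of_mem _ (h.par_mem t ht htd))
  · by_cases h0 : M x = 0
    · have := hM' x h0 hx; omega
    · rw [hM x h0]; exact h.low x h0
  · by_cases h0 : M x = 0
    · rw [hM' x h0 hx]; simp
    · rw [hM x h0]
      exact List.mem_cons_of_mem _ (List.mem_cons_of_mem _ (h.own x hf h0))
  · rcases List.mem_cons.1 ht with rfl | ht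
    · exact hb
    rcases List.mem_cons.1 ht with rfl | ht
    · exact hs
    · rw [hbag t (h.le t ht).2]; exact h.free t ht
  -- Two new nodes are charged to a newly marked free variable, which raises the right-hand side by
  -- at least 2.
  · obtain ⟨x, hx, hx0, hx1⟩ := hex
    have := filter_length_lt (zs := zs) hM ((hzs x).2 (hb x hx)) hx0 hx1
    have := h.card (List.ne_nil_of_mem (h.mem hd))
    simp only [List.length_cons]
    omega

end WitInv

/-! ### Output of nodes and edges. -/

/-- The output for the nodes `0, …, n`. -/
def nodesOut (bag : ℕ → List ℕ) (cov : ℕ → ℕ) (n : ℕ) : List ℕ :=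
  (List.range (n + 1)).flatMap fun t => encodeList (bag t) ++ [cov t]

theorem nodesOut_snoc (bag : ℕ → List ℕ) (cov : ℕ → ℕ) (n : ℕ) (b : List ℕ) (c : ℕ) :
    nodesOut (Function.update bag (n + 1) b) (Function.update cov (n + 1) c) (n + 1)
      = nodesOut bag cov n ++ (encodeList b ++ [c]) := by
  rw [nodesOut, List.range_succ, List.flatMap_append]
  congr 1
  · refine List.flatMap_congr fun t ht => ?_
    have := List.mem_range.1 ht
    rw [Function.update_of_ne (by omega), Function.update_of_ne (by omega)]
  · simp

/-- The numbers from `n` down to `1`. -/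
def countdown (n : ℕ) : List ℕ := (List.range' 1 n).reverse

theorem mem_countdown {n t : ℕ} : t ∈ countdown n ↔ 0 < t ∧ t ≤ n := by
  rw [countdown, List.mem_reverse, List.mem_range'_1]; omega

theorem countdown_nodup (n : ℕ) : (countdown n).Nodup := List.nodup_reverse.2 List.nodup_range'

/-- The output for the edges between the nodes `0, …, n`. -/
def edgesOut (par : ℕ → ℕ) (n : ℕ) : List ℕ := (countdown n).flatMap fun t => [t, par t]

/-- Edges are stored by pushing to the front of a list, hence the decreasing order. -/
theorem edgesOut_snoc (par : ℕ → ℕ) (n p : ℕ) :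
    edgesOut (Function.update par (n + 1) p) (n + 1) = (n + 1) :: p :: edgesOut par n := by
  have : countdown (n + 1) = (n + 1) :: countdown n := by
    rw [countdown, List.range'_1_concat, List.reverse_append, Nat.add_comm 1 n]; rfl
  rw [edgesOut, this, List.flatMap_cons, Function.update_self]
  refine congrArg (fun l => (n + 1) :: p :: l) (List.flatMap_congr fun t ht => ?_)
  have := mem_countdown.1 ht
  rw [Function.update_of_ne (by omega)]

end FCQ

/-! ## The program -/

namespace FCQ

open RAM

infixr:60 " ;; " => RAM.Cmd.seq

/-- Increase a variable by one. -/
def incr (r : Reg) : Cmd := .set r (.add (.var r) (.lit 1))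

/-- `r := max r e` -/
def maxWith (r : Reg) (e : Expr) : Cmd := .set r (.add (.var r) (.sub e (.var r)))

/-- Read the head of the query. -/
def readHead : Cmd :=
  .read .len ;; .rep (.var .len) (.read .x ;; .put .isFree (.var .x) (.lit 1))

/-- Read a variable of the atom `e`. -/
def readVar : Cmd :=
  -- Entries of `last` never exceed the current atom number, so the difference is zero exactly when
  -- `x` has already been seen in this atom.
  .read .x ;; .ite (.sub (.var .e) (.get .last (.var .x)))
    (.put .last (.var .x) (.var .e) ;; .push .occ (.var .x) (.var .e) ;;
      .push .vars (.var .e) (.var .x) ;; incr .tot) .skip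

/-- Read an atom. -/
def readAtom : Cmd :=
  incr .e ;; .read .x ;; .read .len ;; .put .bucket (.var .e) (.lit 1) ;;
    .push .atoms (.lit 0) (.var .e) ;; .rep (.var .len) readVar

/-- Read the body of the query. -/
def readBody : Cmd := .read .cnt ;; .rep (.var .cnt) readAtom

/-- Twice the value of an expression. -/
def dbl (e : Expr) : Expr := .add e e

/-- The number of nodes, and the node `0`. -/
def header : Cmd :=
  -- The number 4d + 1 of nodes is known in advance, so nodes can be output as they arise. Node 0
  -- has an empty bag and cover position 0.
  .write (.add (dbl (dbl (.var .cnt))) (.lit 1)) ;; .write (.lit 0) ;; .write (.lit 0)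

/-- Enter the atom `r` into the heap. -/
def enter (r : Reg) : Cmd :=
  .push .heap (.get .bucket (.var r)) (.var r) ;; maxWith .top (.get .bucket (.var r))

/-- The variable `x` may be marked in the current phase. -/
def allowed : Expr := .add (.get .isFree (.var .x)) (.var .ph)

/-- Determine the marked variables of an atom. -/
def scanMarked : Cmd :=
  .ite (.get .owner (.var .x))
    (.write (.var .x) ;; maxWith .par (.get .owner (.var .x)))
    (.ite allowed (incr .fresh) .skip)

/-- Output the variables of an atom that are allowed. -/
def scanAllowed : Cmd := .ite allowed (.write (.var .x)) .skip

/-- Count a marked variable of the atom `y`. -/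
def bump : Cmd :=
  .put .bucket (.var .y) (.add (.get .bucket (.var .y)) (.lit 1)) ;;
    .ite (.sub (.add (.var .ph) (.lit 1)) (.get .done (.var .y))) (enter .y) .skip

/-- Mark a variable. -/
def mark : Cmd :=
  .ite (.get .owner (.var .x)) .skip (.ite allowed
    (.put .owner (.var .x) (.var .id) ;; .each .y .occ (.var .x) bump) .skip)

/-- Update the witness. -/
def extendWit : Cmd :=
  .ite (.var .fresh) (.ite (.var .ph) .skip (.ite (.var .dflt)
    (.push .wit (.lit 0) (.sub (.var .id) (.lit 1)) ;; .push .wit (.lit 0) (.var .id) ;;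
      .set .wit (.add (.var .wit) (.lit 2)))
    (.push .wit (.lit 0) (.var .id) ;; .set .dflt (.var .id) ;; incr .wit))) .skip

/-- Prepare the output of the nodes of a selected atom. -/
def emitStart : Cmd :=
  .put .done (.var .e) (.add (.var .ph) (.lit 1)) ;; .set .id (.add (.var .id) (.lit 2)) ;;
  .set .par (.var .dflt) ;; .set .fresh (.lit 0) ;;
  -- The size of a bag must precede its elements; here it is read off from the priority, which is
  -- one more than the number of marked variables.
  .write (.sub (.get .bucket (.var .e)) (.lit 1))

/-- Output the cover of the first node and the size of the second bag of a selected atom. -/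
def emitMiddle : Cmd :=
  .write (.sub (.var .e) (.lit 1)) ;;
  .write (.add (.sub (.get .bucket (.var .e)) (.lit 1)) (.var .fresh))

/-- Output the cover of the second node of a selected atom, and store the edges. -/
def emitEnd : Cmd :=
  .write (.sub (.var .e) (.lit 1)) ;;
  .push .edges (.lit 0) (.var .par) ;; .push .edges (.lit 0) (.sub (.var .id) (.lit 1)) ;;
  .push .edges (.lit 0) (.sub (.var .id) (.lit 1)) ;; .push .edges (.lit 0) (.var .id)

/-- Output the two nodes of a selected atom. -/
def emitNodes : Cmd :=
  emitStart ;; .each .x .vars (.var .e) scanMarked ;; emitMiddle ;;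
    .each .x .vars (.var .e) scanAllowed ;; emitEnd

/-- Process a selected atom. -/
def select : Cmd := emitNodes ;; extendWit ;; .each .x .vars (.var .e) mark

/-- One step of the search. -/
def step : Cmd :=
  -- Atoms are numbered from 1, so the default value 0 of `pop` signals an empty bucket. An entry of
  -- an atom already selected is stale and is dropped.
  .ite (.var .top) (.pop .e .heap (.var .top) ;; .ite (.var .e)
    (.ite (.sub (.add (.var .ph) (.lit 1)) (.get .done (.var .e))) select .skip)
    (.set .top (.sub (.var .top) (.lit 1)))) .skip

/-- Fill the heap. -/
def fill : Cmd := .each .e .atoms (.lit 0) (enter .e)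

/-- A bound for the number of steps of a phase. -/
def bound : Expr :=
  .add (.add (dbl (dbl (dbl (.var .tot)))) (.var .cnt)) (.lit 1)

/-- One phase of the search. -/
def phase : Cmd := fill ;; .rep bound step

/-- Output the edges and the witness. -/
def finish : Cmd :=
  .write (dbl (dbl (.var .cnt))) ;; .each .x .edges (.lit 0) (.write (.var .x)) ;;
  -- An empty witness list means that there are no free variables; then the node 0 with the empty
  -- bag serves as witness.
  .ite (.var .wit) .skip (.push .wit (.lit 0) (.lit 0) ;; incr .wit) ;;
  .write (.var .wit) ;; .each .x .wit (.lit 0) (.write (.var .x))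

/-- The part of the program after the input has been read. -/
def search : Cmd := header ;; phase ;; .set .ph (.lit 1) ;; phase ;; finish

/-- The program. -/
def program : Cmd := readHead ;; readBody ;; search

/-! ### The effect of the parts of the program -/

theorem run_seq (a b : Cmd) (h : Store) : (a ;; b).run h = b.run (a.run h) := rfl

theorem run_ite_pos {e : Expr} {h : Store} (he : e.eval h ≠ 0) (a b : Cmd) :
    (Cmd.ite e a b).run h = a.run h := if_pos he

theorem run_ite_neg {e : Expr} {h : Store} (he : e.eval h = 0) (a b : Cmd) :
    (Cmd.ite e a b).run h = b.run h := if_neg (not_not_intro he)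

/-- The run of a loop over the list `l`. -/
def eachRun (r : Reg) (body : Cmd) (l : List ℕ) (h : Store) : Store :=
  l.foldl (fun g a => body.run (g.setV r a).tick) h

theorem run_each (r : Reg) (k : Lst) (i : Expr) (body : Cmd) (h : Store) :
    (Cmd.each r k i body).run h = eachRun r body (h.L k (i.eval h)) h := rfl

theorem eachRun_cons (r : Reg) (body : Cmd) (a : ℕ) (l : List ℕ) (h : Store) :
    eachRun r body (a :: l) h = eachRun r body l (body.run (h.setV r a).tick) := rfl

theorem eachRun_write (l : List ℕ) (h : Store) :
    (eachRun .x (.write (.var .x)) l h).out = h.out ++ l ∧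
    (eachRun .x (.write (.var .x)) l h).time = h.time + l.length ∧
    (eachRun .x (.write (.var .x)) l h).L = h.L ∧
    ∀ r, r ≠ .x → (eachRun .x (.write (.var .x)) l h).v r = h.v r := by
  induction l generalizing h with
  | nil => simp [eachRun]
  | cons a l ih =>
    rw [eachRun_cons]
    have e : (Cmd.write (.var .x)).run (h.setV .x a).tick = (h.setV .x a).tick.emit a := by
      simp [Cmd.run]
    rw [e]
    obtain ⟨h1, h2, h3, h4⟩ := ih ((h.setV .x a).tick.emit a)
    refine ⟨by simp [h1], by simp [h2]; omega, by simp [h3], fun r hr => by simp [h4 r hr, hr]⟩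

/-- The effect of `scanMarked`. -/
structure ScanMarked (l : List ℕ) (g g' : Store) : Prop where
  A : g'.A = g.A
  L : g'.L = g.L
  out : g'.out = g.out ++ l.filter (g.A .owner · ≠ 0)
  time : g'.time = g.time + l.length
  v : ∀ r, r ≠ .x → r ≠ .par → r ≠ .fresh → g'.v r = g.v r
  fresh : g'.v .fresh = g.v .fresh
    + (l.filter fun x => g.A .owner x = 0 ∧ g.A .isFree x + g.v .ph ≠ 0).length
  par_le : g.v .par ≤ g'.v .par
  le_par : ∀ x ∈ l, g.A .owner x ≤ g'.v .par
  par : g'.v .par = g.v .par ∨ ∃ x ∈ l, g.A .owner x ≠ 0 ∧ g.A .owner x = g'.v .par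

theorem eachRun_scanMarked (l : List ℕ) (g : Store) :
    ScanMarked l g (eachRun .x scanMarked l g) := by
  induction l generalizing g with
  | nil => exact ⟨rfl, rfl, by simp [eachRun], rfl, fun _ _ _ _ => rfl, by simp [eachRun], le_rfl,
      by simp, .inl rfl⟩
  | cons a l ih =>
    rw [eachRun_cons]
    obtain ⟨h1, h2, h3, h4, h5, h6, h7, h8, h9⟩ := ih (scanMarked.run (g.setV .x a).tick)
    generalize eachRun .x scanMarked l (scanMarked.run (g.setV .x a).tick) = g' at *
    by_cases hM : g.A .owner a = 0
    · by_cases hA : g.A .isFree a + g.v .ph = 0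
      · have e : scanMarked.run (g.setV .x a).tick = (g.setV .x a).tick := by
          simp [scanMarked, allowed, Cmd.run, hM, hA]
        rw [e] at h1 h2 h3 h4 h5 h6 h7 h8 h9
        refine ⟨h1, h2, ?_, by simp [h4]; omega, fun r hr1 hr2 hr3 => by
          simp [h5 r hr1 hr2 hr3, hr1], ?_, by simpa using h7, ?_, ?_⟩
        · rw [List.filter_cons_of_neg (by simp [hM])]; exact h3
        · rw [List.filter_cons_of_neg (by simp [hA])]; exact h6
        · simpa [hM] using h8
        · simpa [hM] using h9
      · have e : scanMarked.run (g.setV .x a).tick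
            = (g.setV .x a).tick.setV .fresh (g.v .fresh + 1) := by
          simp [scanMarked, allowed, Cmd.run, hM, incr]
          omega
        rw [e] at h1 h2 h3 h4 h5 h6 h7 h8 h9
        refine ⟨h1, h2, ?_, by simp [h4]; omega, fun r hr1 hr2 hr3 => by
          simp [h5 r hr1 hr2 hr3, hr1, hr3], ?_, by simpa using h7, ?_, ?_⟩
        · rw [List.filter_cons_of_neg (by simp [hM])]; exact h3
        · rw [List.filter_cons_of_pos (by exact decide_eq_true ⟨hM, hA⟩), List.length_cons, ← Nat.add_assoc,
            Nat.add_right_comm]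
          exact h6
        · simpa [hM] using h8
        · simpa [hM] using h9
    · have e : scanMarked.run (g.setV .x a).tick
          = ((g.setV .x a).tick.emit a).setV .par (g.v .par + (g.A .owner a - g.v .par)) := by
        simp [scanMarked, Cmd.run, hM, maxWith]
      rw [e] at h1 h2 h3 h4 h5 h6 h7 h8 h9
      simp at h7 h8 h9
      refine ⟨h1, h2, ?_, by simp [h4]; omega, fun r hr1 hr2 hr3 => by
        simp [h5 r hr1 hr2 hr3, hr1, hr2], ?_, by omega, ?_, ?_⟩
      · rw [List.filter_cons_of_pos (by simpa using hM)]
        exact h3.trans (List.append_assoc ..)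
      · rw [List.filter_cons_of_neg (by simp [hM])]; exact h6
      · intro x hx
        rcases List.mem_cons.1 hx with rfl | hx
        · omega
        · exact h8 x hx
      · rcases h9 with h9 | ⟨x, hx, hx'⟩
        · by_cases hle : g.A .owner a ≤ g.v .par
          · exact .inl (by omega)
          · exact .inr ⟨a, List.mem_cons_self, hM, by omega⟩
        · exact .inr ⟨x, List.mem_cons_of_mem _ hx, by omega, hx'.2⟩

theorem eachRun_scanAllowed (l : List ℕ) (g : Store) :
    (eachRun .x scanAllowed l g).A = g.A ∧ (eachRun .x scanAllowed l g).L = g.L ∧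
    (eachRun .x scanAllowed l g).out = g.out ++ l.filter (g.A .isFree · + g.v .ph ≠ 0) ∧
    (eachRun .x scanAllowed l g).time = g.time + l.length ∧
    ∀ r, r ≠ .x → (eachRun .x scanAllowed l g).v r = g.v r := by
  induction l generalizing g with
  | nil => simp [eachRun]
  | cons a l ih =>
    rw [eachRun_cons]
    obtain ⟨h1, h2, h3, h4, h5⟩ := ih (scanAllowed.run (g.setV .x a).tick)
    generalize eachRun .x scanAllowed l (scanAllowed.run (g.setV .x a).tick) = g' at *
    by_cases hA : g.A .isFree a + g.v .ph = 0
    · have e : scanAllowed.run (g.setV .x a).tick = (g.setV .x a).tick := by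
        simp [scanAllowed, allowed, Cmd.run]
        omega
      rw [e] at h1 h2 h3 h4 h5
      exact ⟨h1, h2, by rw [List.filter_cons_of_neg (by simpa using hA)]; simpa using h3,
        by simp [h4]; omega, fun r hr => by simp [h5 r hr, hr]⟩
    · have e : scanAllowed.run (g.setV .x a).tick = (g.setV .x a).tick.emit a := by
        simp [scanAllowed, allowed, Cmd.run]
        omega
      rw [e] at h1 h2 h3 h4 h5
      exact ⟨h1, h2, by
        rw [List.filter_cons_of_pos (by exact decide_eq_true hA)]; exact h3.trans (List.append_assoc ..),
        by simp [h4]; omega, fun r hr => by simp [h5 r hr, hr]⟩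

end FCQ

/-! ## The heap of the atoms, ordered by the numbers of marked variables -/

namespace FCQ

open RAM

/-- The data of a query, as stored in the memory: the numbers of atoms and of pairs of an atom and
one of its variables, the variables of the atoms `1, …, d`, the atoms that contain a variable, the
indicator function of the free variables, and the list of the free variables. -/
structure Data where
  d : ℕ
  tot : ℕ
  vs : ℕ → List ℕ
  oc : ℕ → List ℕ
  fr : ℕ → ℕ
  zs : List ℕ

/-- The consistency of the data of a query. -/
structure Data.Valid (D : Data) : Prop where
  vs_nodup : ∀ e, (D.vs e).Nodup
  oc_nodup : ∀ x, (D.oc x).Nodup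
  mem_oc : ∀ x y, y ∈ D.oc x ↔ y ∈ Finset.Icc 1 D.d ∧ x ∈ D.vs y
  mem_zs : ∀ x, x ∈ D.zs ↔ D.fr x ≠ 0
  exists_mem : ∀ x, D.fr x ≠ 0 → ∃ e ∈ Finset.Icc 1 D.d, x ∈ D.vs e
  tot_eq : ∑ e ∈ Finset.Icc 1 D.d, (D.vs e).length = D.tot

/-- The data are stored in the memory. -/
structure Stored (D : Data) (h : Store) : Prop where
  vars : h.L .vars = D.vs
  occ : h.L .occ = D.oc
  isFree : h.A .isFree = D.fr
  atoms_nodup : (h.L .atoms 0).Nodup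
  atoms : ∀ y, y ∈ h.L .atoms 0 ↔ y ∈ Finset.Icc 1 D.d
  cnt : h.v .cnt = D.d
  tot : h.v .tot = D.tot

theorem Stored.congr {D : Data} {h g : Store} (hs : Stored D h) (hv : g.L .vars = h.L .vars)
    (ho : g.L .occ = h.L .occ) (ha : g.L .atoms = h.L .atoms) (hf : g.A .isFree = h.A .isFree)
    (hc : g.v .cnt = h.v .cnt) (ht : g.v .tot = h.v .tot) : Stored D g :=
  ⟨hv.trans hs.vars, ho.trans hs.occ, hf.trans hs.isFree, by rw [ha]; exact hs.atoms_nodup,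
    by rw [ha]; exact hs.atoms, hc.trans hs.cnt, ht.trans hs.tot⟩

/-- The number of entries of the heap. -/
def cells (h : Store) : ℕ := ∑ j ∈ Finset.range (h.v .top + 1), (h.L .heap j).length

/-- The heap contains every atom satisfying `U`, with its current priority, and no entry has
a priority that is larger than the current priority of the atom. -/
structure HeapInv (d : ℕ) (U : ℕ → Prop) (h : Store) : Prop where
  mem : ∀ j, ∀ y ∈ h.L .heap j, y ∈ Finset.Icc 1 d ∧ 0 < j ∧ j ≤ h.A .bucket y
  has : ∀ y ∈ Finset.Icc 1 d, U y → y ∈ h.L .heap (h.A .bucket y)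
  above : ∀ j, h.v .top < j → h.L .heap j = []

/-- An entry found in bucket `top` belongs to an atom of priority at least `top`; together with this
bound, an unselected atom popped there has the largest priority among the unselected ones. -/
theorem HeapInv.le_top {d : ℕ} {U : ℕ → Prop} {h : Store} (hh : HeapInv d U h) {y : ℕ}
    (hy : y ∈ Finset.Icc 1 d) (hU : U y) : h.A .bucket y ≤ h.v .top := by
  by_contra hc
  have := hh.has y hy hU
  rw [hh.above _ (not_le.1 hc)] at this
  simp at this

theorem cells_eq {h : Store} (habove : ∀ j, h.v .top < j → h.L .heap j = []) {m : ℕ}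
    (hm : h.v .top ≤ m) : cells h = ∑ j ∈ Finset.range (m + 1), (h.L .heap j).length := by
  refine Finset.sum_subset (Finset.range_mono (by omega)) fun j _ hj => ?_
  rw [habove j (by simpa using hj)]
  rfl

/-- The effect of `enter`. -/
structure Entered (y : ℕ) (h g : Store) : Prop where
  A : g.A = h.A
  L : ∀ k, k ≠ .heap → g.L k = h.L k
  heap : ∀ j, g.L .heap j = if j = h.A .bucket y then y :: h.L .heap j else h.L .heap j
  v : ∀ r, r ≠ .top → g.v r = h.v r
  top : g.v .top = max (h.v .top) (h.A .bucket y)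
  inp : g.inp = h.inp
  out : g.out = h.out
  time : g.time = h.time

theorem run_enter (r : Reg) (h : Store) :
    Entered (h.v r) h ((enter r).run h) := by
  refine ⟨rfl, fun k hk => ?_, fun j => ?_, fun r' hr' => ?_, ?_, rfl, rfl, rfl⟩
  · funext j; simp [enter, maxWith, Cmd.run, hk]
  · simp [enter, maxWith, Cmd.run]
    split_ifs with hj
    · rw [hj]
    · rfl
  · simp [enter, maxWith, Cmd.run, hr']
  · simp [enter, maxWith, Cmd.run]
    omega

namespace Entered

variable {y : ℕ} {h g : Store} (he : Entered y h g)

include he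

theorem above (ha : ∀ j, h.v .top < j → h.L .heap j = []) (j : ℕ) (hj : g.v .top < j) :
    g.L .heap j = [] := by
  rw [he.top] at hj
  rw [he.heap, if_neg (by omega), ha j (by omega)]

theorem cells (ha : ∀ j, h.v .top < j → h.L .heap j = []) : cells g = cells h + 1 := by
  have hb : h.A .bucket y ∈ Finset.range (g.v .top + 1) := by
    rw [he.top, Finset.mem_range]; omega
  rw [cells_eq ha (m := g.v .top) (by rw [he.top]; omega), FCQ.cells,
    ← Finset.sum_erase_add _ _ hb, ← Finset.sum_erase_add (Finset.range (g.v .top + 1)) _ hb,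
    he.heap, if_pos rfl, List.length_cons, ← Nat.add_assoc]
  congr 2
  refine Finset.sum_congr rfl fun j hj => ?_
  rw [he.heap, if_neg (Finset.ne_of_mem_erase hj)]

theorem heapInv {d : ℕ} {U V : ℕ → Prop} (hy : y ∈ Finset.Icc 1 d) (hpos : 0 < h.A .bucket y)
    (hUV : ∀ z, V z → U z ∨ z = y)
    (hmem : ∀ j, ∀ z ∈ h.L .heap j, z ∈ Finset.Icc 1 d ∧ 0 < j ∧ j ≤ h.A .bucket z)
    (hhas : ∀ z ∈ Finset.Icc 1 d, z ≠ y → U z → z ∈ h.L .heap (h.A .bucket z))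
    (ha : ∀ j, h.v .top < j → h.L .heap j = []) : HeapInv d V g where
  mem j z hz := by
    rw [he.A]
    rw [he.heap] at hz
    split_ifs at hz with hj
    · rcases List.mem_cons.1 hz with rfl | hz
      · exact ⟨hy, hj ▸ hpos, hj.le⟩
      · exact hmem j z hz
    · exact hmem j z hz
  has z hz hV := by
    rw [he.A, he.heap]
    by_cases hzy : z = y
    · subst hzy; rw [if_pos rfl]; exact List.mem_cons_self
    · have := hhas z hz hzy ((hUV z hV).resolve_right hzy)
      split_ifs
      · exact List.mem_cons_of_mem _ this
      · exact this
  above := he.above ha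

end Entered

/-- The effect of `fill`. -/
structure Filled (d : ℕ) (U V : ℕ → Prop) (l : List ℕ) (h g : Store) : Prop where
  A : g.A = h.A
  L : ∀ k, k ≠ .heap → g.L k = h.L k
  v : ∀ r, r ≠ .top → r ≠ .e → g.v r = h.v r
  inp : g.inp = h.inp
  out : g.out = h.out
  time : g.time = h.time + l.length
  cells : cells g = cells h + l.length
  top : ∀ m, h.v .top ≤ m → (∀ y ∈ l, h.A .bucket y ≤ m) → g.v .top ≤ m
  heapInv : HeapInv d V g

/-- The conditions `U` and `V` let the set of atoms known to be in the heap grow along the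
induction. -/
theorem eachRun_enter {d : ℕ} (l : List ℕ) : ∀ {U V : ℕ → Prop} (h : Store), HeapInv d U h →
    (∀ y ∈ l, y ∈ Finset.Icc 1 d) → (∀ y ∈ l, 0 < h.A .bucket y) → (∀ y, V y → U y ∨ y ∈ l) →
    Filled d U V l h (eachRun .e (enter .e) l h) := by
  induction l with
  | nil =>
    intro U V h hh hl hpos hUV
    exact ⟨rfl, fun _ _ => rfl, fun _ _ _ => rfl, rfl, rfl, rfl, rfl, fun m hm _ => hm,
      hh.mem, fun y hy hV => hh.has y hy ((hUV y hV).resolve_right (by simp)), hh.above⟩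
  | cons a l ih =>
    intro U V h hh hl hpos hUV
    rw [eachRun_cons]
    have he := run_enter .e (h.setV .e a).tick
    have ha : (h.setV .e a).tick.v .e = a := by simp
    rw [ha] at he
    have habove : ∀ j, (h.setV .e a).tick.v .top < j → (h.setV .e a).tick.L .heap j = [] := by
      simpa using hh.above
    have hc := he.cells habove
    have hi : HeapInv d (fun z => U z ∨ z = a) _ := he.heapInv (U := U)
      (hl a List.mem_cons_self) (hpos a List.mem_cons_self) (fun z hz => hz) hh.mem (fun z hz _ hU => hh.has z hz hU) habove
    have := ih (U := fun z => U z ∨ z = a) (V := V) _ hi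
      (fun y hy => hl y (List.mem_cons_of_mem _ hy))
      (fun y hy => by rw [he.A]; exact hpos y (List.mem_cons_of_mem _ hy)) fun y hV => by
        have := hUV y hV
        rw [List.mem_cons] at this
        tauto
    obtain ⟨h1, h2, h3, h4, h5, h6, h7, h8, h9⟩ := this
    refine ⟨h1.trans he.A, fun k hk => (h2 k hk).trans (he.L k hk), fun r hr hr' => ?_,
      h4.trans he.inp, h5.trans he.out, ?_, ?_, fun m hm hlm => ?_, h9⟩
    · rw [h3 r hr hr', he.v r hr]; simp [hr']
    · rw [h6, he.time]; simp; omega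
    · rw [h7, hc]
      have : cells (h.setV .e a).tick = cells h := by simp [cells]
      rw [this, List.length_cons]; omega
    · refine h8 m ?_ fun y hy => ?_
      · rw [he.top]
        simpa using ⟨hm, hlm a List.mem_cons_self⟩
      · rw [he.A]; exact hlm y (List.mem_cons_of_mem _ hy)

/-- The sum of the priorities. -/
def prio (d : ℕ) (h : Store) : ℕ := ∑ y ∈ Finset.Icc 1 d, h.A .bucket y

/-- The atoms that have not been selected in the current phase. -/
def Unselected (h : Store) (y : ℕ) : Prop := h.A .done y < h.v .ph + 1

/-- The effect of a loop over `bump`. -/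
structure Bumped (d : ℕ) (l : List ℕ) (h g : Store) : Prop where
  A : ∀ k, k ≠ .bucket → g.A k = h.A k
  bucket : ∀ y, g.A .bucket y = h.A .bucket y + if y ∈ l then 1 else 0
  L : ∀ k, k ≠ .heap → g.L k = h.L k
  v : ∀ r, r ≠ .top → r ≠ .y → g.v r = h.v r
  inp : g.inp = h.inp
  out : g.out = h.out
  heapInv : HeapInv d (Unselected h) g
  pot : g.time + cells g + g.v .top + 3 * prio d h ≤ h.time + cells h + h.v .top + 3 * prio d g

theorem prio_update {d y : ℕ} (hy : y ∈ Finset.Icc 1 d) {h g : Store}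
    (hg : ∀ z, g.A .bucket z = if z = y then h.A .bucket z + 1 else h.A .bucket z) :
    prio d g = prio d h + 1 := by
  rw [prio, prio, ← Finset.sum_erase_add _ _ hy, ← Finset.sum_erase_add (Finset.Icc 1 d) _ hy,
    hg, if_pos rfl, ← Nat.add_assoc]
  congr 2
  refine Finset.sum_congr rfl fun z hz => ?_
  rw [hg, if_neg (Finset.ne_of_mem_erase hz)]

/-- A bump costs one tick, adds at most one heap entry, raises `top` by at most 1, and raises the
sum of priorities by exactly 1; this explains the weight 3. Old entries are left in lower buckets,
which `HeapInv` tolerates as priorities only grow. -/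
theorem eachRun_bump {d : ℕ} (l : List ℕ) : ∀ (h : Store), HeapInv d (Unselected h) h →
    (∀ y ∈ l, y ∈ Finset.Icc 1 d) → l.Nodup → Bumped d l h (eachRun .y bump l h) := by
  induction l with
  | nil =>
    intro h hh hl _
    exact ⟨fun _ _ => rfl, by simp [eachRun], fun _ _ => rfl, fun _ _ _ => rfl, rfl, rfl, hh,
      le_rfl⟩
  | cons a l ih =>
    intro h hh hl hn
    rw [eachRun_cons]
    have haI := hl a List.mem_cons_self
    set h1 := (h.setV .y a).tick.setA .bucket a (h.A .bucket a + 1) with hh1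
    have hU1 : ∀ y, Unselected h1 y ↔ Unselected h y := fun y => by simp [Unselected, hh1]
    have hB1 : ∀ z, h1.A .bucket z = if z = a then h.A .bucket z + 1 else h.A .bucket z := by
      intro z
      by_cases hz : z = a
      · simp [hh1, hz]
      · simp [hh1, hz]
    have hmem1 : ∀ j, ∀ z ∈ h1.L .heap j, z ∈ Finset.Icc 1 d ∧ 0 < j ∧ j ≤ h1.A .bucket z := by
      intro j z hz
      have := hh.mem j z hz
      rw [hB1]
      split_ifs
      · exact ⟨this.1, this.2.1, by omega⟩
      · exact this
    have hhas1 : ∀ z ∈ Finset.Icc 1 d, z ≠ a → Unselected h z →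
        z ∈ h1.L .heap (h1.A .bucket z) := by
      intro z hz hza hU
      rw [hB1, if_neg hza]
      exact hh.has z hz hU
    have habove1 : ∀ j, h1.v .top < j → h1.L .heap j = [] := by simpa [hh1] using hh.above
    have hc1 : cells h1 = cells h := by simp [cells, hh1]
    have ht1 : h1.time = h.time + 1 := by simp [hh1]
    have htop1 : h1.v .top = h.v .top := by simp [hh1]
    have hp1 := prio_update haI hB1
    have eput : (Cmd.put .bucket (.var .y) (.add (.get .bucket (.var .y)) (.lit 1))).run
        (h.setV .y a).tick = h1 := by simp [Cmd.run, hh1]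
    have key : ∃ h2, bump.run (h.setV .y a).tick = h2 ∧ h2.A = h1.A ∧
        (∀ k, k ≠ .heap → h2.L k = h1.L k) ∧ (∀ r, r ≠ .top → h2.v r = h1.v r) ∧
        h2.inp = h.inp ∧ h2.out = h.out ∧ HeapInv d (Unselected h) h2 ∧ h2.time = h1.time ∧
        cells h2 + h2.v .top ≤ cells h1 + h1.v .top + 2 := by
      by_cases hU : Unselected h a
      · have he := run_enter .y h1
        have ha : h1.v .y = a := by simp [hh1]
        rw [ha] at he
        refine ⟨(enter .y).run h1, ?_, he.A, he.L, he.v, he.inp, he.out,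
          he.heapInv haI (by rw [hB1, if_pos rfl]; omega) (fun z hz => .inl hz) hmem1 hhas1 habove1, he.time, ?_⟩
        · rw [bump, run_seq, eput, run_ite_pos]
          simp [Unselected, hh1] at hU ⊢
          omega
        -- The old priority is at most `top`, so the new one exceeds `top` by at most 1.
        · have := hh.le_top haI hU
          rw [he.cells habove1, he.top, hB1, if_pos rfl]
          omega
      · refine ⟨h1, ?_, rfl, fun _ _ => rfl, fun _ _ => rfl, rfl, rfl,
          ⟨hmem1, fun z hz hUz => hhas1 z hz (fun hza => hU (hza ▸ hUz)) hUz, habove1⟩, rfl,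
          by omega⟩
        rw [bump, run_seq, eput, run_ite_neg]
        · rfl
        · simp [Unselected, hh1] at hU ⊢
          omega
    obtain ⟨h2, e2, A2, L2, v2, inp2, out2, hi2, t2, c2⟩ := key
    rw [e2]
    have hU2 : Unselected h2 = Unselected h := by
      funext y
      rw [Unselected, A2, v2 .ph (by simp)]
      exact propext (hU1 y)
    obtain ⟨i1, i2, i3, i4, i5, i6, i7, i8⟩ := ih h2 (hU2 ▸ hi2)
      (fun y hy => hl y (List.mem_cons_of_mem _ hy)) (List.nodup_cons.1 hn).2
    have hp2 : prio d h2 = prio d h1 := by simp [prio, A2]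
    refine ⟨fun k hk => ?_, fun y => ?_, fun k hk => (i3 k hk).trans (L2 k hk), fun r hr hr' => ?_,
      i5.trans inp2, i6.trans out2, hU2 ▸ i7, by omega⟩
    · rw [i1 k hk, A2]
      funext j
      simp [hh1, hk]
    · rw [i2, A2, hB1]
      by_cases hya : y = a
      · subst hya
        simp [(List.nodup_cons.1 hn).1]
      · simp [hya]
    · rw [i4 r hr hr', v2 r hr]
      simp [hh1, hr']

/-- The number of marked variables in a list. -/
def markedCount (M : ℕ → ℕ) (l : List ℕ) : ℕ := (l.filter (M · ≠ 0)).length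

theorem markedCount_update {M : ℕ → ℕ} {x n : ℕ} (hx : M x = 0) (hn : n ≠ 0) {l : List ℕ}
    (hl : l.Nodup) :
    markedCount (Function.update M x n) l = markedCount M l + if x ∈ l then 1 else 0 := by
  induction l with
  | nil => rfl
  | cons a l ih =>
    obtain ⟨ha, hl⟩ := List.nodup_cons.1 hl
    have ih := ih hl
    simp only [markedCount] at ih ⊢
    by_cases hxa : x = a
    · subst hxa
      rw [List.filter_cons_of_pos (by simpa using hn), List.filter_cons_of_neg (by simpa using hx),
        List.length_cons, ih]
      simp [ha]
    · have e : Function.update M x n a = M a := Function.update_of_ne (Ne.symm hxa) _ _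
      by_cases hMa : M a = 0
      · rw [List.filter_cons_of_neg (by simpa [e] using hMa),
          List.filter_cons_of_neg (by simpa using hMa), ih]
        simp [hxa]
      · rw [List.filter_cons_of_pos (by simpa [e] using hMa),
          List.filter_cons_of_pos (by simpa using hMa), List.length_cons, List.length_cons, ih]
        simp [hxa]
        omega

/-- The priority of an atom is larger by one than the number of its marked variables. -/
def PrioInv (D : Data) (h : Store) : Prop :=
  ∀ y ∈ Finset.Icc 1 D.d, h.A .bucket y = markedCount (h.A .owner) (D.vs y) + 1

/-- The effect of a loop over `mark`. -/
structure Marked (D : Data) (l : List ℕ) (h g : Store) : Prop where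
  A : ∀ k, k ≠ .bucket → k ≠ .owner → g.A k = h.A k
  owner : ∀ x, g.A .owner x = if (x ∈ l ∧ h.A .isFree x + h.v .ph ≠ 0) ∧ h.A .owner x = 0
    then h.v .id else h.A .owner x
  L : ∀ k, k ≠ .heap → g.L k = h.L k
  v : ∀ r, r ≠ .top → r ≠ .x → r ≠ .y → g.v r = h.v r
  inp : g.inp = h.inp
  out : g.out = h.out
  prioInv : PrioInv D g
  heapInv : HeapInv D.d (Unselected h) g
  pot : g.time + cells g + g.v .top + 3 * prio D.d h
    ≤ h.time + cells h + h.v .top + 3 * prio D.d g + l.length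

/-- Marking a new variable raises the marked count of exactly the atoms in its occurrence list,
which are the atoms bumped. Only the `l.length` ticks of the outer loop are not paid by the growth
of priorities. -/
theorem eachRun_mark {D : Data} (hD : D.Valid) (l : List ℕ) : ∀ (h : Store), h.L .occ = D.oc →
    h.v .id ≠ 0 → PrioInv D h → HeapInv D.d (Unselected h) h →
    Marked D l h (eachRun .x mark l h) := by
  induction l with
  | nil =>
    intro h ho hid hp hh
    exact ⟨fun _ _ _ => rfl, by simp [eachRun], fun _ _ => rfl, fun _ _ _ _ => rfl, rfl, rfl, hp,
      hh, le_rfl⟩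
  | cons a l ih =>
    intro h ho hid hp hh
    rw [eachRun_cons]
    by_cases hc : h.A .owner a = 0 ∧ h.A .isFree a + h.v .ph ≠ 0
    · set h1 := ((h.setV .x a).tick).setA .owner a (h.v .id) with hh1
      have e : mark.run (h.setV .x a).tick = eachRun .y bump (D.oc a) h1 := by
        rw [mark, run_ite_neg (by simpa using hc.1), run_ite_pos (by simpa [allowed] using hc.2),
          run_seq, ← ho, run_each]
        simp [hh1, Cmd.run]
      rw [e]
      have hU1 : Unselected h1 = Unselected h := by
        funext y; simp [Unselected, hh1]
      have hi1 : HeapInv D.d (Unselected h1) h1 := by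
        rw [hU1]
        exact ⟨by simpa [hh1] using hh.mem, by simpa [hh1] using hh.has,
          by simpa [hh1] using hh.above⟩
      obtain ⟨i1, i2, i3, i4, i5, i6, i7, i8⟩ := eachRun_bump (D.oc a) h1 hi1
        (fun y hy => ((hD.mem_oc a y).1 hy).1) (hD.oc_nodup a)
      generalize eachRun .y bump (D.oc a) h1 = h2 at *
      have hU2 : Unselected h2 = Unselected h := by
        rw [← hU1]; funext y
        rw [Unselected, Unselected, i1 .done (by simp), i4 .ph (by simp) (by simp)]
      have ho1 : h1.A .owner = Function.update (h.A .owner) a (h.v .id) := by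
        funext x; simp [hh1, Function.update_apply]
      have ho2 := (i1 .owner (by simp)).trans ho1
      have hp2 : PrioInv D h2 := by
        intro y hy
        rw [i2, ho2, markedCount_update hc.1 hid (hD.vs_nodup y)]
        have : h1.A .bucket y = h.A .bucket y := by simp [hh1]
        rw [this, hp y hy]
        simp [hD.mem_oc, Finset.mem_Icc.1 hy]
        omega
      have hid2 : h2.v .id = h.v .id := by rw [i4 _ (by simp) (by simp)]; simp [hh1]
      have hph2 : h2.v .ph = h.v .ph := by rw [i4 _ (by simp) (by simp)]; simp [hh1]
      have hfr2 : h2.A .isFree = h.A .isFree := by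
        rw [i1 _ (by simp)]; funext x; simp [hh1]
      obtain ⟨j1, j2, j3, j4, j5, j6, j7, j8, j9⟩ := ih h2 (by rw [i3 _ (by simp)]; exact ho)
        (by rw [hid2]; exact hid) hp2 (by rw [hU2, ← hU1]; exact i7)
      refine ⟨fun k hk hk' => ?_, fun x => ?_, fun k hk => ?_, fun r hr hr' hr'' => ?_,
        j5.trans i5, j6.trans i6, j7, hU2 ▸ j8, ?_⟩
      · rw [j1 k hk hk', i1 k hk]; funext x; simp [hh1, hk']
      · rw [j2, hid2, hph2, hfr2, ho2, Function.update_apply]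
        by_cases hxa : x = a
        · subst hxa
          rw [if_pos rfl, if_neg (by simp [hid]), if_pos ⟨⟨List.mem_cons_self, hc.2⟩, hc.1⟩]
        · simp [hxa]
      · rw [j3 k hk, i3 k hk]; simp [hh1]
      · rw [j4 r hr hr' hr'', i4 r hr hr'']; simp [hh1, hr']
      · have e1 : cells h1 = cells h := by simp [cells, hh1]
        have e2 : h1.time = h.time + 1 := by simp [hh1]
        have e3 : h1.v .top = h.v .top := by simp [hh1]
        have e4 : prio D.d h1 = prio D.d h := by simp [prio, hh1]
        rw [List.length_cons]
        omega
    · set h1 := (h.setV .x a).tick with hh1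
      have e : mark.run h1 = h1 := by
        by_cases c1 : h.A .owner a = 0
        · rw [mark, run_ite_neg (by simpa [hh1] using c1), run_ite_neg]
          · rfl
          · simpa [allowed, hh1] using fun c2 => hc ⟨c1, c2⟩
        · rw [mark, run_ite_pos (by simpa [hh1] using c1)]
          rfl
      rw [e]
      have hU1 : Unselected h1 = Unselected h := by
        funext y; simp [Unselected, hh1]
      obtain ⟨j1, j2, j3, j4, j5, j6, j7, j8, j9⟩ := ih h1 ho (by simpa [hh1] using hid) hp
        (by
          rw [hU1]
          exact ⟨hh.mem, hh.has, by simpa [hh1] using hh.above⟩)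
      refine ⟨j1, fun x => ?_, j3, fun r hr hr' hr'' => ?_, j5, j6, j7, hU1 ▸ j8, ?_⟩
      · rw [j2]
        have e1 : h1.v .id = h.v .id := by simp [hh1]
        have e2 : h1.v .ph = h.v .ph := by simp [hh1]
        rw [e1, e2]
        by_cases hxa : x = a
        · subst hxa
          rw [if_neg fun hx => hc ⟨hx.2, hx.1.2⟩, if_neg fun hx => hc ⟨hx.2, hx.1.2⟩]; rfl
        · simp only [List.mem_cons, hxa, false_or]; rfl
      · rw [j4 r hr hr' hr'']; simp [hh1, hr']
      · have e1 : cells h1 = cells h := by simp [cells, hh1]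
        have e2 : h1.time = h.time + 1 := by simp [hh1]
        have e3 : h1.v .top = h.v .top := by simp [hh1]
        have e4 : prio D.d h1 = prio D.d h := by simp [prio, hh1]
        rw [List.length_cons]
        omega

end FCQ

/-! ### The effect of selecting an atom. -/

namespace FCQ

open RAM

/-- The effect of `emitNodes`. -/
structure Emitted (l : List ℕ) (h g : Store) : Prop where
  A : ∀ k, k ≠ .done → g.A k = h.A k
  done : ∀ y, g.A .done y = if y = h.v .e then h.v .ph + 1 else h.A .done y
  L : ∀ k, k ≠ .edges → g.L k = h.L k
  edges : g.L .edges 0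
    = (h.v .id + 2) :: (h.v .id + 1) :: (h.v .id + 1) :: g.v .par :: h.L .edges 0
  v : ∀ r, r ≠ .x → r ≠ .par → r ≠ .fresh → r ≠ .id → g.v r = h.v r
  id : g.v .id = h.v .id + 2
  fresh : g.v .fresh = (l.filter fun x => h.A .owner x = 0 ∧ h.A .isFree x + h.v .ph ≠ 0).length
  par_le : h.v .dflt ≤ g.v .par
  le_par : ∀ x ∈ l, h.A .owner x ≤ g.v .par
  par : g.v .par = h.v .dflt ∨ ∃ x ∈ l, h.A .owner x ≠ 0 ∧ h.A .owner x = g.v .par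
  out : g.out = h.out ++ ((h.A .bucket (h.v .e) - 1) :: l.filter (h.A .owner · ≠ 0))
    ++ [h.v .e - 1] ++ ((h.A .bucket (h.v .e) - 1 + g.v .fresh)
    :: l.filter (h.A .isFree · + h.v .ph ≠ 0)) ++ [h.v .e - 1]
  time : g.time = h.time + 2 * l.length

theorem run_emitNodes (h : Store) : Emitted (h.L .vars (h.v .e)) h (emitNodes.run h) := by
  set l := h.L .vars (h.v .e) with hl
  have hs : emitNodes.run h = emitEnd.run (eachRun .x scanAllowed
      ((emitMiddle.run (eachRun .x scanMarked ((emitStart.run h).L .vars ((emitStart.run h).v .e))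
        (emitStart.run h))).L .vars ((emitMiddle.run (eachRun .x scanMarked
        ((emitStart.run h).L .vars ((emitStart.run h).v .e)) (emitStart.run h))).v .e))
      (emitMiddle.run (eachRun .x scanMarked ((emitStart.run h).L .vars ((emitStart.run h).v .e))
        (emitStart.run h)))) := rfl
  have e0 : ∃ h0, emitStart.run h = h0 ∧ h0.L = h.L ∧ (∀ k, k ≠ .done → h0.A k = h.A k) ∧
      (∀ y, h0.A .done y = if y = h.v .e then h.v .ph + 1 else h.A .done y) ∧
      (∀ r, r ≠ .par → r ≠ .fresh → r ≠ .id → h0.v r = h.v r) ∧ h0.v .id = h.v .id + 2 ∧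
      h0.v .fresh = 0 ∧ h0.v .par = h.v .dflt ∧
      h0.out = h.out ++ [h.A .bucket (h.v .e) - 1] ∧ h0.time = h.time := by
    refine ⟨_, rfl, rfl, fun k hk => ?_, fun y => ?_, fun r hr hr' hr'' => ?_, ?_, ?_, ?_, ?_, rfl⟩
    · funext x; simp [emitStart, Cmd.run, hk]
    all_goals simp [emitStart, Cmd.run, *]
  obtain ⟨h0, e0, L0, A0, done0, v0, id0, fresh0, par0, out0, time0⟩ := e0
  rw [hs, e0, L0, v0 .e (by simp) (by simp) (by simp), ← hl]
  obtain ⟨A1, L1, out1, time1, v1, fresh1, parle1, lepar1, par1⟩ := eachRun_scanMarked l h0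
  generalize eachRun .x scanMarked l h0 = h1 at *
  have e2 : ∃ h2, emitMiddle.run h1 = h2 ∧ h2.L = h1.L ∧ h2.A = h1.A ∧ h2.v = h1.v ∧
      h2.out = h1.out ++ [h1.v .e - 1] ++ [h1.A .bucket (h1.v .e) - 1 + h1.v .fresh] ∧
      h2.time = h1.time := ⟨_, rfl, rfl, rfl, rfl, rfl, rfl⟩
  obtain ⟨h2, e2, L2, A2, v2, out2, time2⟩ := e2
  have he1 : h1.v .e = h.v .e := by
    rw [v1 _ (by simp) (by simp) (by simp), v0 _ (by simp) (by simp) (by simp)]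
  rw [e2, L2, v2, L1, L0, he1, ← hl]
  obtain ⟨A3, L3, out3, time3, v3⟩ := eachRun_scanAllowed l h2
  generalize eachRun .x scanAllowed l h2 = h3 at *
  have e4 : ∃ h4, emitEnd.run h3 = h4 ∧ (∀ k, k ≠ .edges → h4.L k = h3.L k) ∧ h4.A = h3.A ∧
      h4.v = h3.v ∧ h4.out = h3.out ++ [h3.v .e - 1] ∧ h4.time = h3.time ∧
      h4.L .edges 0 = h3.v .id :: (h3.v .id - 1) :: (h3.v .id - 1) :: h3.v .par
        :: h3.L .edges 0 := by
    refine ⟨_, rfl, fun k hk => ?_, rfl, rfl, rfl, rfl, ?_⟩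
    · funext i; simp [emitEnd, Cmd.run, hk]
    · simp [emitEnd, Cmd.run]
  obtain ⟨h4, e4, L4, A4, v4, out4, time4, edges4⟩ := e4
  rw [e4]
  have hAk : ∀ k, h4.A k = h0.A k := fun k => by rw [A4, A3, A2, A1]
  have hv : ∀ r, r ≠ .x → r ≠ .par → r ≠ .fresh → h4.v r = h0.v r := fun r hx hp hf => by
    rw [v4, v3 r hx, v2, v1 r hx hp hf]
  have hpar : h4.v .par = h1.v .par := by rw [v4, v3 _ (by simp), v2]
  have hfresh : h4.v .fresh = h1.v .fresh := by rw [v4, v3 _ (by simp), v2]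
  have ho0 := A0 .owner (by simp)
  have hf0 := A0 .isFree (by simp)
  have hb0 := A0 .bucket (by simp)
  have hph0 : h0.v .ph = h.v .ph := v0 _ (by simp) (by simp) (by simp)
  have hid3 : h3.v .id = h.v .id + 2 := by
    rw [v3 _ (by simp), v2, v1 _ (by simp) (by simp) (by simp), id0]
  have hpar3 : h3.v .par = h4.v .par := by rw [v4]
  refine ⟨fun k hk => (hAk k).trans (A0 k hk), fun y => ?_, fun k hk => ?_, ?_,
    fun r hx hp hf hi => (hv r hx hp hf).trans (v0 r hp hf hi),
    (hv _ (by simp) (by simp) (by simp)).trans id0, ?_, ?_, ?_, ?_, ?_, by omega⟩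
  · rw [hAk, done0]
  · rw [L4 k hk, L3, L2, L1, L0]
  · rw [edges4, hid3, hpar3, L3, L2, L1, L0]; rfl
  · rw [hfresh, fresh1, fresh0, ho0, hf0, hph0, Nat.zero_add]
  · rw [hpar, ← par0]; exact parle1
  · rw [hpar, ← ho0]; exact lepar1
  · rw [hpar, ← par0, ← ho0]; exact par1
  · have he3 : h3.v .e = h.v .e := by rw [v3 _ (by simp), v2, he1]
    have hph2 : h2.v .ph = h.v .ph := by
      rw [v2, v1 _ (by simp) (by simp) (by simp), hph0]
    rw [out4, out3, out2, out1, out0, A2, A1, ho0, hf0, hb0, he1, he3, hph2, hfresh]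
    simp

/-- The effect of `extendWit`. -/
structure Extended (h g : Store) : Prop where
  A : g.A = h.A
  L : ∀ k, k ≠ .wit → g.L k = h.L k
  v : ∀ r, r ≠ .wit → r ≠ .dflt → g.v r = h.v r
  out : g.out = h.out
  time : g.time = h.time
  wit : (h.v .fresh = 0 ∨ h.v .ph ≠ 0) ∧ g.v .dflt = h.v .dflt ∧ g.v .wit = h.v .wit ∧
      g.L .wit 0 = h.L .wit 0 ∨
    h.v .fresh ≠ 0 ∧ h.v .ph = 0 ∧ h.v .dflt ≠ 0 ∧ g.v .dflt = h.v .dflt ∧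
      g.v .wit = h.v .wit + 2 ∧ g.L .wit 0 = h.v .id :: (h.v .id - 1) :: h.L .wit 0 ∨
    h.v .fresh ≠ 0 ∧ h.v .ph = 0 ∧ h.v .dflt = 0 ∧ g.v .dflt = h.v .id ∧
      g.v .wit = h.v .wit + 1 ∧ g.L .wit 0 = h.v .id :: h.L .wit 0

theorem run_extendWit (h : Store) : Extended h (extendWit.run h) := by
  by_cases hf : h.v .fresh = 0
  · rw [extendWit, run_ite_neg (by simpa using hf)]
    exact ⟨rfl, fun _ _ => rfl, fun _ _ _ => rfl, rfl, rfl, .inl ⟨.inl hf, rfl, rfl, rfl⟩⟩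
  by_cases hp : h.v .ph = 0
  · by_cases hd : h.v .dflt = 0
    · rw [extendWit, run_ite_pos (by simpa using hf), run_ite_neg (by simpa using hp),
        run_ite_neg (by simpa using hd)]
      refine ⟨rfl, fun k hk => ?_, fun r hr hr' => ?_, rfl, rfl,
        .inr (.inr ⟨hf, hp, hd, ?_, ?_, ?_⟩)⟩
      · funext i; simp [Cmd.run, incr, hk]
      all_goals simp [Cmd.run, incr, *]
    · rw [extendWit, run_ite_pos (by simpa using hf), run_ite_neg (by simpa using hp),
        run_ite_pos (by simpa using hd)]
      refine ⟨rfl, fun k hk => ?_, fun r hr hr' => ?_, rfl, rfl,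
        .inr (.inl ⟨hf, hp, hd, ?_, ?_, ?_⟩)⟩
      · funext i; simp [Cmd.run, hk]
      all_goals simp [Cmd.run, *]
  · rw [extendWit, run_ite_pos (by simpa using hf), run_ite_pos (by simpa using hp)]
    exact ⟨rfl, fun _ _ => rfl, fun _ _ _ => rfl, rfl, rfl, .inl ⟨.inr hp, rfl, rfl, rfl⟩⟩

end FCQ

namespace FCQ

open RAM

/-- The effect of `select`. -/
structure Selected (D : Data) (h g : Store) : Prop where
  A : ∀ k, k ≠ .bucket → k ≠ .owner → k ≠ .done → g.A k = h.A k
  done : ∀ y, g.A .done y = if y = h.v .e then h.v .ph + 1 else h.A .done y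
  owner : ∀ x, g.A .owner x = if (x ∈ D.vs (h.v .e) ∧ h.A .isFree x + h.v .ph ≠ 0) ∧
    h.A .owner x = 0 then h.v .id + 2 else h.A .owner x
  L : ∀ k, k ≠ .heap → k ≠ .edges → k ≠ .wit → g.L k = h.L k
  v : ∀ r, r ≠ .top → r ≠ .x → r ≠ .y → r ≠ .par → r ≠ .fresh → r ≠ .id → r ≠ .wit → r ≠ .dflt →
    g.v r = h.v r
  id : g.v .id = h.v .id + 2
  prioInv : PrioInv D g
  heapInv : HeapInv D.d (Unselected g) g
  pot : g.time + cells g + g.v .top + 3 * prio D.d h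
    ≤ h.time + cells h + h.v .top + 3 * prio D.d g + 3 * (D.vs (h.v .e)).length
  edges : g.L .edges 0
    = (h.v .id + 2) :: (h.v .id + 1) :: (h.v .id + 1) :: g.v .par :: h.L .edges 0
  par_le : h.v .dflt ≤ g.v .par
  le_par : ∀ x ∈ D.vs (h.v .e), h.A .owner x ≤ g.v .par
  par : g.v .par = h.v .dflt ∨
    ∃ x ∈ D.vs (h.v .e), h.A .owner x ≠ 0 ∧ h.A .owner x = g.v .par
  fresh : g.v .fresh = ((D.vs (h.v .e)).filter fun x =>
    h.A .owner x = 0 ∧ h.A .isFree x + h.v .ph ≠ 0).length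
  out : g.out = h.out
    ++ ((h.A .bucket (h.v .e) - 1) :: (D.vs (h.v .e)).filter (h.A .owner · ≠ 0))
    ++ [h.v .e - 1] ++ ((h.A .bucket (h.v .e) - 1 + g.v .fresh)
    :: (D.vs (h.v .e)).filter (h.A .isFree · + h.v .ph ≠ 0)) ++ [h.v .e - 1]
  wit : (g.v .fresh = 0 ∨ h.v .ph ≠ 0) ∧ g.v .dflt = h.v .dflt ∧ g.v .wit = h.v .wit ∧
      g.L .wit 0 = h.L .wit 0 ∨
    g.v .fresh ≠ 0 ∧ h.v .ph = 0 ∧ h.v .dflt ≠ 0 ∧ g.v .dflt = h.v .dflt ∧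
      g.v .wit = h.v .wit + 2 ∧ g.L .wit 0 = (h.v .id + 2) :: (h.v .id + 1) :: h.L .wit 0 ∨
    g.v .fresh ≠ 0 ∧ h.v .ph = 0 ∧ h.v .dflt = 0 ∧ g.v .dflt = h.v .id + 2 ∧
      g.v .wit = h.v .wit + 1 ∧ g.L .wit 0 = (h.v .id + 2) :: h.L .wit 0

/-- The selected atom has just been popped and may be missing from the heap. It is declared done
before any bump, after which the heap no longer has to contain it. -/
theorem run_select {D : Data} (hD : D.Valid) {h : Store} (hs : Stored D h) (hp : PrioInv D h)
    (hh : HeapInv D.d (fun y => Unselected h y ∧ y ≠ h.v .e) h) :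
    Selected D h (select.run h) := by
  have hrun : select.run h = eachRun .x mark
      ((extendWit.run (emitNodes.run h)).L .vars ((extendWit.run (emitNodes.run h)).v .e))
      (extendWit.run (emitNodes.run h)) := rfl
  rw [hrun]
  obtain ⟨A1, done1, L1, edges1, v1, id1, fresh1, parle1, lepar1, par1, out1, time1⟩ :=
    run_emitNodes h
  generalize emitNodes.run h = h1 at *
  obtain ⟨A2, L2, v2, out2, time2, wit2⟩ := run_extendWit h1
  generalize extendWit.run h1 = h2 at *
  rw [hs.vars] at fresh1 lepar1 par1 out1 time1
  have hv2 : ∀ r, r ≠ .x → r ≠ .par → r ≠ .fresh → r ≠ .id → r ≠ .wit → r ≠ .dflt →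
      h2.v r = h.v r := fun r h1 h2 h3 h4 h5 h6 => (v2 r h5 h6).trans (v1 r h1 h2 h3 h4)
  have he2 : h2.v .e = h.v .e := by simp [hv2]
  have hph2 : h2.v .ph = h.v .ph := by simp [hv2]
  have htop2 : h2.v .top = h.v .top := by simp [hv2]
  have hid2 : h2.v .id = h.v .id + 2 := by rw [v2 _ (by simp) (by simp), id1]
  have hL2 : ∀ k, k ≠ .edges → k ≠ .wit → h2.L k = h.L k :=
    fun k hk hk' => (L2 k hk').trans (L1 k hk)
  have hA2 : ∀ k, k ≠ .done → h2.A k = h.A k := fun k hk => by rw [A2, A1 k hk]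
  rw [he2, hL2 _ (by simp) (by simp), hs.vars]
  have hU2 : ∀ y, Unselected h2 y ↔ Unselected h y ∧ y ≠ h.v .e := fun y => by
    rw [Unselected, Unselected, A2, done1, hph2]
    split_ifs with hy
    · simp [hy]
    · simp [hy]
  have hh2 : HeapInv D.d (Unselected h2) h2 := by
    refine ⟨fun j y hy => ?_, fun y hy hU => ?_, fun j hj => ?_⟩
    · rw [hL2 _ (by simp) (by simp)] at hy
      rw [hA2 _ (by simp)]
      exact hh.mem j y hy
    · rw [hL2 _ (by simp) (by simp), hA2 _ (by simp)]
      exact hh.has y hy ((hU2 y).1 hU)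
    · rw [hL2 _ (by simp) (by simp)]
      exact hh.above j (htop2 ▸ hj)
  have hp2 : PrioInv D h2 := by
    intro y hy
    rw [hA2 _ (by simp), hA2 _ (by simp)]
    exact hp y hy
  obtain ⟨A3, owner3, L3, v3, -, out3, prio3, heap3, pot3⟩ := eachRun_mark hD (D.vs (h.v .e)) h2
    (by rw [hL2 _ (by simp) (by simp), hs.occ]) (by omega) hp2 hh2
  generalize eachRun .x mark (D.vs (h.v .e)) h2 = g at *
  have hpar : g.v .par = h1.v .par := by
    rw [v3 _ (by simp) (by simp) (by simp), v2 _ (by simp) (by simp)]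
  have hfresh : g.v .fresh = h1.v .fresh := by
    rw [v3 _ (by simp) (by simp) (by simp), v2 _ (by simp) (by simp)]
  refine ⟨fun k hk hk' hk'' => (A3 k hk hk').trans (hA2 k hk''), fun y => ?_, fun x => ?_,
    fun k hk hk' hk'' => (L3 k hk).trans (hL2 k hk' hk''),
    fun r h1 h2 h3 h4 h5 h6 h7 h8 => (v3 r h1 h2 h3).trans (hv2 r h2 h4 h5 h6 h7 h8), ?_, prio3,
    ?_, ?_, ?_, by rwa [hpar], by rwa [hpar], by rwa [hpar], by rwa [hfresh], ?_, ?_⟩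
  · rw [A3 _ (by simp) (by simp), A2, done1]
  · rw [owner3, hA2 _ (by simp), hA2 _ (by simp), hph2, hid2]
  · rw [v3 _ (by simp) (by simp) (by simp), hid2]
  · have : Unselected g = Unselected h2 := by
      funext y
      rw [Unselected, Unselected, A3 _ (by simp) (by simp), v3 _ (by simp) (by simp) (by simp)]
    rw [this]
    exact heap3
  · have e1 : cells h2 = cells h := by
      rw [cells, cells, htop2, hL2 _ (by simp) (by simp)]
    have e2 : prio D.d h2 = prio D.d h := by rw [prio, prio, hA2 _ (by simp)]
    omega
  · rw [L3 _ (by simp), L2 _ (by simp), edges1, hpar]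
  · rw [out3, out2, out1, hfresh]
  · rw [hfresh, v3 .dflt (by simp) (by simp) (by simp), v3 .wit (by simp) (by simp) (by simp),
      L3 _ (by simp), ← v1 .ph (by simp) (by simp) (by simp) (by simp),
      ← v1 .dflt (by simp) (by simp) (by simp) (by simp),
      ← v1 .wit (by simp) (by simp) (by simp) (by simp), ← L1 .wit (by simp)]
    have : h.v .id + 2 - 1 = h.v .id + 1 := rfl
    rw [id1, this] at wit2
    exact wit2

/-- The variables of the atom `e` that may be marked in the phase `ph`. -/
def trace (D : Data) (ph e : ℕ) : Set ℕ := {x | x ∈ D.vs e ∧ D.fr x + ph ≠ 0}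

/-- The invariant of the search. -/
structure Inv (D : Data) (h : Store) (bag : ℕ → List ℕ) (par cov : ℕ → ℕ) (X : Set (Set ℕ))
    (R : List (Set ℕ)) : Prop where
  stored : Stored D h
  ph_le : h.v .ph ≤ 1
  out : h.out = (4 * D.d + 1) :: nodesOut bag cov (h.v .id)
  edges : h.L .edges 0 = edgesOut par (h.v .id)
  nodes : NodeInv D.d D.vs (h.v .id) bag par cov (h.A .owner)
  wit : WitInv D.fr D.zs (h.v .id) bag par (h.A .owner) (h.v .dflt) (h.L .wit 0)
  wit_len : h.v .wit = (h.L .wit 0).length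
  prio : PrioInv D h
  allowed : ∀ x, h.A .owner x ≠ 0 → D.fr x + h.v .ph ≠ 0
  free : h.v .ph ≠ 0 → ∀ x, D.fr x ≠ 0 → h.A .owner x ≠ 0
  done : ∀ e ∈ Finset.Icc 1 D.d, h.A .done e = h.v .ph ∨ h.A .done e = h.v .ph + 1
  perm : R.Perm (((List.range' 1 D.d).filter (h.A .done · = h.v .ph)).map (trace D (h.v .ph)))
  elim : Elim X R
  union : ⋃₀ X = {x | h.A .owner x ≠ 0}
  -- A base set need not be a bag itself, only its intersection with each atom must lie in a bag. In
  -- the second phase this admits free(Q) as a base set.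
  cover : ∀ f ∈ X, ∀ e ∈ Finset.Icc 1 D.d, ∃ t ≤ h.v .id, ∀ x ∈ D.vs e, x ∈ f → x ∈ bag t
  seen : ∀ e ∈ Finset.Icc 1 D.d, h.A .done e = h.v .ph + 1 → ∃ t ≤ h.v .id, cov t = e - 1 ∧
    ∀ x, x ∈ bag t ↔ x ∈ trace D (h.v .ph) e
  -- Every remaining set will contribute two more nodes in the current phase.
  count : h.v .id + 2 * R.length = 2 * (h.v .ph + 1) * D.d

/-- A list is split by a condition. -/
theorem filter_length_add {l : List ℕ} {p q r : ℕ → Prop} [DecidablePred p] [DecidablePred q]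
    [DecidablePred r] (h : ∀ x, r x ↔ p x ∨ q x) (h' : ∀ x, ¬ (p x ∧ q x)) :
    (l.filter (p ·)).length + (l.filter (q ·)).length = (l.filter (r ·)).length := by
  induction l with
  | nil => rfl
  | cons a l ih =>
    have h1 := h a
    have h2 := h' a
    by_cases hp : p a <;> by_cases hq : q a <;> simp [hp, hq] at h1 h2 <;> simp [hp, hq, h1] <;>
      omega

/-- One element of a list is removed from a selection. -/
theorem filter_perm_cons {l : List ℕ} (hl : l.Nodup) {p q : ℕ → Prop} [DecidablePred p]
    [DecidablePred q] {e : ℕ} (he : e ∈ l) (hp : p e) (hq : ∀ x ∈ l, q x ↔ p x ∧ x ≠ e) :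
    (l.filter (p ·)).Perm (e :: l.filter (q ·)) := by
  refine (List.perm_ext_iff_of_nodup (hl.filter _) (List.nodup_cons.2 ⟨?_, hl.filter _⟩)).2
    fun x => ?_
  · simp only [List.mem_filter, decide_eq_true_eq, not_and]
    exact fun _ h => ((hq e he).1 h).2 rfl
  · by_cases hx : x = e
    · subst hx; simp [he, hp]
    · simp only [List.mem_filter, decide_eq_true_eq, List.mem_cons, hx, false_or]
      exact and_congr_right fun h => by rw [hq x h]; simp [hx]

namespace Inv

variable {D : Data} {h : Store} {bag : ℕ → List ℕ} {par cov : ℕ → ℕ} {X : Set (Set ℕ)}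
  {R : List (Set ℕ)}

theorem unselected_iff (hI : Inv D h bag par cov X R) {e : ℕ} (he : e ∈ Finset.Icc 1 D.d) :
    Unselected h e ↔ h.A .done e = h.v .ph := by
  have := hI.done e he
  rw [Unselected]
  omega

theorem trace_mem (hI : Inv D h bag par cov X R) {s : Set ℕ} :
    s ∈ R ↔ ∃ e ∈ Finset.Icc 1 D.d, Unselected h e ∧ trace D (h.v .ph) e = s := by
  rw [hI.perm.mem_iff]
  simp only [List.mem_map, List.mem_filter, List.mem_range'_1, decide_eq_true_eq]
  refine exists_congr fun e => ?_
  have : (1 ≤ e ∧ e < 1 + D.d) ↔ e ∈ Finset.Icc 1 D.d := by rw [Finset.mem_Icc]; omega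
  rw [this, and_assoc]
  exact and_congr_right fun he => by rw [hI.unselected_iff he]

/-- The union of the base is the set of marked variables, all of which are allowed in the current
phase; so traces on the base are what the priorities count. -/
theorem trace_inter (hI : Inv D h bag par cov X R) (e : ℕ) :
    trace D (h.v .ph) e ∩ ⋃₀ X = {x | x ∈ D.vs e ∧ h.A .owner x ≠ 0} := by
  ext x
  rw [hI.union]
  simp only [trace, Set.mem_inter_iff, Set.mem_ofPred_eq]
  have := hI.allowed x
  tauto

/-- An atom with the largest number of marked variables is eliminated. -/
theorem exchange (hI : Inv D h bag par cov X R) (hD : D.Valid) {e : ℕ}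
    (he : e ∈ Finset.Icc 1 D.d) (hU : Unselected h e)
    (hmax : ∀ y ∈ Finset.Icc 1 D.d, Unselected h y → h.A .bucket y ≤ h.A .bucket e) :
    (∃ t ≤ h.v .id, (D.vs e).filter (h.A .owner · ≠ 0) ⊆ bag t) ∧
    ∃ R', (trace D (h.v .ph) e :: R').Perm R ∧ Elim (insert (trace D (h.v .ph) e) X) R' := by
  obtain ⟨⟨f, hf, hef⟩, hR⟩ := hI.elim.exchange (hI.trace_mem.2 ⟨e, he, hU, rfl⟩) <| by
    intro s hs hes
    obtain ⟨y, hy, hUy, rfl⟩ := hI.trace_mem.1 hs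
    rw [hI.trace_inter] at hes ⊢
    have hle := hmax y hy hUy
    rw [hI.prio y hy, hI.prio e he, markedCount, markedCount] at hle
    have hsub : (D.vs e).filter (h.A .owner · ≠ 0) ⊆ (D.vs y).filter (h.A .owner · ≠ 0) := by
      intro x hx
      simp only [List.mem_filter, decide_eq_true_eq] at hx ⊢
      exact ⟨(hes hx).1, hx.2⟩
    -- The marked variables of `e` are among those of `y`, and there are at least as many of them,
    -- so the two sets agree: largest cardinality implies maximality under inclusion.
    have hperm := (((hD.vs_nodup e).filter _).subperm hsub).perm_of_length_le (by omega)
    intro x hx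
    have : x ∈ (D.vs e).filter (h.A .owner · ≠ 0) :=
      hperm.mem_iff.2 (List.mem_filter.2 ⟨hx.1, by simpa using hx.2⟩)
    exact ⟨(List.mem_filter.1 this).1, hI.allowed x hx.2⟩
  refine ⟨?_, hR⟩
  obtain ⟨t, ht, hsub⟩ := hI.cover f hf e he
  refine ⟨t, ht, fun x hx => ?_⟩
  simp only [List.mem_filter, decide_eq_true_eq] at hx
  exact hsub x hx.1 (hef (by rw [hI.trace_inter]; exact hx))

/-- The new nodes are n + 1 with bag `S`, the marked variables of the atom, attached to `p`, and n +
2 with bag `b`, its allowed variables, attached to n + 1. The inclusions of `S` in the bag of `p`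
and in `b` give running intersection and comparability. -/
theorem select (hI : Inv D h bag par cov X R) (hD : D.Valid) (he : h.v .e ∈ Finset.Icc 1 D.d)
    (hU : Unselected h (h.v .e))
    (hmax : ∀ y ∈ Finset.Icc 1 D.d, Unselected h y → h.A .bucket y ≤ h.A .bucket (h.v .e))
    {g : Store} (hg : Selected D h g) :
    ∃ bag' par' cov' X' R', Inv D g bag' par' cov' X' R' := by
  set n := h.v .id with hn
  set e := h.v .e with he'
  set M := h.A .owner with hM
  set ph := h.v .ph with hph
  have hfr := hI.stored.isFree
  obtain ⟨⟨i, hi, hSi⟩, R', hR', hX'⟩ := hI.exchange hD he hU hmax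
  rw [← hM] at hSi
  rw [← hph] at hR' hX'
  have owner := hg.owner
  rw [hfr, ← hM, ← he', ← hph, ← hn] at owner
  have fresh := hg.fresh
  rw [hfr, ← hM, ← he', ← hph] at fresh
  have out := hg.out
  rw [hfr, ← hM, ← he', ← hph] at out
  have lepar := hg.le_par
  have parle := hg.par_le
  have par_or := hg.par
  rw [← hM, ← he'] at lepar par_or
  set p := g.v .par with hp
  set S := (D.vs e).filter (M · ≠ 0) with hS
  set b := (D.vs e).filter (D.fr · + ph ≠ 0) with hb
  have memS : ∀ x, x ∈ S ↔ x ∈ D.vs e ∧ M x ≠ 0 := fun x => by simp [hS]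
  have memb : ∀ x, x ∈ b ↔ x ∈ D.vs e ∧ D.fr x + ph ≠ 0 := fun x => by
    rw [hb, List.mem_filter, decide_eq_true_eq]
  have hSb : S ⊆ b := fun x hx => by
    rw [memS] at hx
    exact (memb x).2 ⟨hx.1, hI.allowed x hx.2⟩
  have hpn : p ≤ n := by
    rcases par_or with h1 | ⟨x, -, hx, hxp⟩
    · rw [h1]; exact hI.wit.dflt_le
    · rw [← hxp]; exact (hI.nodes.owner x hx).1
  have hSp : S ⊆ bag p := by
    by_cases h0 : S = []
    · simp [h0]
    -- For nonempty `S`, the value `p` is the largest owner in `S` even if the scan never exceeded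
    -- its initial value `dflt`, because every owner is at least `dflt`.
    obtain ⟨x, hx⟩ := List.exists_mem_of_ne_nil S h0
    refine hI.nodes.subset_owner ?_ (fun y hy => lepar y ((memS y).1 hy).1) hi hSi
    rcases par_or with h1 | ⟨y, hy, hy0, hyp⟩
    · refine ⟨x, hx, le_antisymm (lepar x ((memS x).1 hx).1) ?_⟩
      rw [h1]
      exact hI.wit.low x ((memS x).1 hx).2
    · exact ⟨y, (memS y).2 ⟨hy, hy0⟩, hyp⟩
  have hed : e - 1 < D.d := by have := Finset.mem_Icc.1 he; omega
  have hee : e - 1 + 1 = e := by have := Finset.mem_Icc.1 he; omega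
  set bag1 := Function.update bag (n + 1) S with hbag1
  set par1 := Function.update par (n + 1) p with hpar1
  set cov1 := Function.update cov (n + 1) (e - 1) with hcov1
  have N1 : NodeInv D.d D.vs (n + 1) bag1 par1 cov1 M := by
    refine hI.nodes.snoc hpn ((hD.vs_nodup e).filter _) hed ?_ (.inl hSp) (fun x hx _ => hSp hx)
      fun x => ?_
    · rw [hee]; exact fun x hx => ((memS x).1 hx).1
    · rw [if_neg fun hx => ((memS x).1 hx.1).2 hx.2]
  set bag2 := Function.update bag1 (n + 2) b with hbag2
  set par2 := Function.update par1 (n + 2) (n + 1) with hpar2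
  set cov2 := Function.update cov1 (n + 2) (e - 1) with hcov2
  have bagS : bag1 (n + 1) = S := Function.update_self ..
  have N2 : NodeInv D.d D.vs (n + 2) bag2 par2 cov2 (g.A .owner) := by
    refine N1.snoc le_rfl ((hD.vs_nodup e).filter _) hed ?_ (.inr (bagS ▸ hSb))
      (fun x hx h0 => ?_) fun x => ?_
    · rw [hee]; exact fun x hx => ((memb x).1 hx).1
    · rw [bagS]; exact (memS x).2 ⟨((memb x).1 hx).1, h0⟩
    · rw [owner]
      refine if_congr ?_ rfl rfl
      rw [memb]
  have bag_old : ∀ t ≤ n, bag2 t = bag t := fun t ht => by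
    rw [hbag2, Function.update_of_ne (by omega), hbag1, Function.update_of_ne (by omega)]
  have par_old : ∀ t ≤ n, par2 t = par t := fun t ht => by
    rw [hpar2, Function.update_of_ne (by omega), hpar1, Function.update_of_ne (by omega)]
  have cov_old : ∀ t ≤ n, cov2 t = cov t := fun t ht => by
    rw [hcov2, Function.update_of_ne (by omega), hcov1, Function.update_of_ne (by omega)]
  have bagb : bag2 (n + 2) = b := Function.update_self ..
  have bagS2 : bag2 (n + 1) = S := by
    rw [hbag2, Function.update_of_ne (by omega), bagS]
  have covb : cov2 (n + 2) = e - 1 := Function.update_self ..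
  have gid := hg.id
  rw [← hn] at gid
  have gph : g.v .ph = ph := by rw [hg.v] <;> simp
  have owner_old : ∀ x, M x ≠ 0 → g.A .owner x = M x := fun x hx => by
    rw [owner, if_neg fun h => hx h.2]
  have owner_new : ∀ x, M x = 0 → g.A .owner x ≠ 0 → g.A .owner x = n + 2 ∧ x ∈ b := by
    intro x hx hx'
    rw [owner] at hx' ⊢
    split_ifs at hx' ⊢ with hc
    · exact ⟨rfl, (memb x).2 hc.1⟩
    · exact absurd hx hx'
  have lenS : h.A .bucket e - 1 = S.length := by rw [hI.prio e he]; rfl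
  -- The allowed variables are the marked and the fresh ones; this justifies the size that was
  -- output ahead of the second bag.
  have lenb : S.length + g.v .fresh = b.length := by
    rw [fresh]
    refine filter_length_add (fun x => ?_) fun x => ?_
    · have := hI.allowed x
      tauto
    · tauto
  have hfresh : g.v .fresh ≠ 0 → ∃ x ∈ b, M x = 0 ∧ g.A .owner x ≠ 0 := fun h0 => by
    rw [fresh] at h0
    obtain ⟨x, hx⟩ := List.exists_mem_of_ne_nil _ (List.ne_nil_of_length_pos (Nat.pos_of_ne_zero h0))
    simp only [List.mem_filter, decide_eq_true_eq] at hx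
    refine ⟨x, (memb x).2 ⟨hx.1, hx.2.2⟩, hx.2.1, ?_⟩
    rw [owner, if_pos ⟨⟨hx.1, hx.2.2⟩, hx.2.1⟩]
    omega
  have hfresh0 : g.v .fresh = 0 → ∀ x ∈ b, M x ≠ 0 := fun h0 x hx h1 => by
    rw [fresh, List.length_eq_zero_iff, List.filter_eq_nil_iff] at h0
    have := h0 x ((memb x).1 hx).1
    simp only [decide_eq_true_eq] at this
    exact this ⟨h1, ((memb x).1 hx).2⟩
  refine ⟨bag2, par2, cov2, insert (trace D ph e) X, R', ?_⟩
  have W2 : WitInv D.fr D.zs (n + 2) bag2 par2 (g.A .owner) (g.v .dflt) (g.L .wit 0) ∧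
      g.v .wit = (g.L .wit 0).length := by
    rcases hg.wit with ⟨h0, h1, h2, h3⟩ | ⟨h0, hph0, hd, h1, h2, h3⟩ | ⟨h0, hph0, hd, h1, h2, h3⟩
    · rw [h1, h2, h3]
      refine ⟨hI.wit.keep bag_old par_old owner_old fun x hx hx' => ?_, hI.wit_len⟩
      obtain ⟨h4, h5⟩ := owner_new x hx hx'
      refine ⟨h4, ?_⟩
      -- A newly marked variable cannot be free: either nothing is newly marked, or this is the
      -- second phase, where all free variables were marked before.
      rcases h0 with h0 | h0
      · exact absurd hx (hfresh0 h0 x h5)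
      · by_contra h6
        exact hI.free h0 x h6 hx
    · rw [← hph] at hph0
      have bfr : ∀ x ∈ b, D.fr x ≠ 0 := fun x hx => by
        have := ((memb x).1 hx).2
        omega
      rw [h1, h2, h3]
      refine ⟨hI.wit.more hd bag_old par_old hD.mem_zs (fun x hx hx' => (owner_new x hx hx').1)
        owner_old (bagb ▸ bfr) (bagS2 ▸ fun x hx => bfr x (hSb hx)) (Function.update_self ..) ?_
        (bagb ▸ hfresh h0), ?_⟩
      · rw [hpar2, Function.update_of_ne (by omega), hpar1, Function.update_self]
        -- The parent of the new pair belongs to the witness: it is `dflt` or the owner of a marked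
        -- free variable.
        rcases par_or with h4 | ⟨x, hx, hx0, hxp⟩
        · rw [h4]; exact hI.wit.mem hd
        · rw [← hxp]
          exact hI.wit.own x (bfr x (hSb ((memS x).2 ⟨hx, hx0⟩))) hx0
      · simpa using hI.wit_len
    · rw [← hph] at hph0
      have bfr : ∀ x ∈ b, D.fr x ≠ 0 := fun x hx => by
        have := ((memb x).1 hx).2
        omega
      rw [h1, h2, h3]
      have hW := hI.wit
      rw [hd] at hW
      refine ⟨hW.first (fun x hx => ?_) hD.mem_zs (fun x hx hx' => (owner_new x hx hx').1)
        owner_old (bagb ▸ bfr) (bagb ▸ hfresh h0), ?_⟩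
      · have := hI.allowed x hx
        omega
      · simpa using hI.wit_len
  have hdone := hg.done
  rw [← he', ← hph] at hdone
  refine ⟨?_, by rw [gph]; exact hI.ph_le, ?_, ?_, by rw [gid]; exact N2, by rw [gid]; exact W2.1,
    W2.2, hg.prioInv, fun x hx => ?_, fun h0 x hx => ?_, fun y hy => ?_, ?_, hX', ?_, ?_, ?_, ?_⟩
  · refine hI.stored.congr ?_ ?_ ?_ ?_ ?_ ?_
    · rw [hg.L] <;> simp
    · rw [hg.L] <;> simp
    · rw [hg.L] <;> simp
    · rw [hg.A] <;> simp
    · rw [hg.v] <;> simp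
    · rw [hg.v] <;> simp
  · rw [out, gid, hbag2, hcov2, nodesOut_snoc, hbag1, hcov1, nodesOut_snoc, hI.out, lenS, lenb,
      ← hn]
    simp [encodeList]
  · rw [hg.edges, gid, hpar2, edgesOut_snoc, hpar1, edgesOut_snoc, hI.edges]
  · rw [gph]
    by_cases h0 : M x = 0
    · exact ((memb x).1 (owner_new x h0 hx).2).2
    · exact hI.allowed x h0
  · rw [gph] at h0
    have := hI.free h0 x hx
    rw [owner_old x this]
    exact this
  · rw [hdone, gph]
    split_ifs
    · exact .inr rfl
    · exact hI.done y hy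
  · have heL : e ∈ List.range' 1 D.d := by
      rw [List.mem_range'_1]
      have := Finset.mem_Icc.1 he
      omega
    have hpq := filter_perm_cons (p := (h.A .done · = ph)) (q := (g.A .done · = ph))
      List.nodup_range' heL ((hI.unselected_iff he).1 hU) fun x _ => by
        rw [hdone]
        split_ifs with hx
        · simp [hx]
        · simp [hx]
    have := (hR'.trans hI.perm).trans (hpq.map _)
    rw [gph]
    exact (List.perm_cons _).1 this
  · ext x
    rw [Set.sUnion_insert, hI.union]
    simp only [Set.mem_union, Set.mem_ofPred_eq, trace]
    rw [← hM, owner]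
    split_ifs with hc
    · exact iff_of_true (.inl hc.1) (by omega)
    · tauto
  · rintro f (rfl | hf) y hy
    · exact ⟨n + 2, by rw [gid], fun x _ hx => by rw [bagb]; exact (memb x).2 hx⟩
    · obtain ⟨t, ht, hsub⟩ := hI.cover f hf y hy
      exact ⟨t, by rw [gid]; omega, by rwa [bag_old t ht]⟩
  · intro y hy hdy
    rw [hdone, gph] at hdy
    rw [gph, gid]
    split_ifs at hdy with hye
    · subst hye
      exact ⟨n + 2, le_rfl, covb, fun x => by rw [bagb]; exact memb x⟩
    · obtain ⟨t, ht, h1, h2⟩ := hI.seen y hy hdy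
      exact ⟨t, by omega, by rw [cov_old t ht]; exact h1, by rw [bag_old t ht]; exact h2⟩
  · have := hI.count
    have hl := hR'.length_eq
    rw [← hph, ← hn] at this
    rw [List.length_cons] at hl
    rw [gid, gph]
    omega

end Inv

end FCQ

/-! ## The phases of the search -/

namespace RAM

theorem Cmd.time_le_run (c : Cmd) : ∀ h : Store, h.time ≤ (c.run h).time := by
  induction c with
  | skip => exact fun _ => le_rfl
  | set r e => exact fun _ => le_rfl
  | put k i e => exact fun _ => le_rfl
  | push k i e => exact fun _ => le_rfl
  | pop r k i => exact fun _ => le_rfl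
  | read r => exact fun _ => le_rfl
  | write e => exact fun _ => le_rfl
  | seq a b iha ihb => exact fun h => (iha h).trans (ihb _)
  | ite e a b iha ihb =>
    intro h
    rw [Cmd.run]
    split_ifs
    · exact iha h
    · exact ihb h
  | each r k i body ih =>
    intro h
    rw [Cmd.run]
    generalize h.L k (i.eval h) = l
    induction l generalizing h with
    | nil => exact le_rfl
    | cons a l ihl =>
      refine le_trans ?_ (ihl _)
      exact (Nat.le_succ _).trans (ih (h.setV r a).tick)
  | rep e body ih =>
    intro h
    rw [Cmd.run]
    generalize e.eval h = n
    induction n generalizing h with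
    | zero => exact le_rfl
    | succ n ihn =>
      rw [Function.iterate_succ_apply]
      exact ((Nat.le_succ _).trans (ih h.tick)).trans (ihn _)

end RAM

namespace FCQ

open RAM

/-- The invariant of the search does not depend on the heap. -/
theorem Inv.congr {D : Data} {h g : Store} {bag : ℕ → List ℕ} {par cov : ℕ → ℕ}
    {X : Set (Set ℕ)} {R : List (Set ℕ)} (hI : Inv D h bag par cov X R) (hA : g.A = h.A)
    (hL : ∀ k, k ≠ .heap → g.L k = h.L k) (hv : ∀ r, r ≠ .top → r ≠ .e → g.v r = h.v r)
    (ho : g.out = h.out) : Inv D g bag par cov X R := by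
  have hs : Stored D g := by
    refine hI.stored.congr ?_ ?_ ?_ (by rw [hA]) ?_ ?_
    · rw [hL]; simp
    · rw [hL]; simp
    · rw [hL]; simp
    · rw [hv] <;> simp
    · rw [hv] <;> simp
  have hid : g.v .id = h.v .id := by rw [hv] <;> simp
  have hph : g.v .ph = h.v .ph := by rw [hv] <;> simp
  have hdflt : g.v .dflt = h.v .dflt := by rw [hv] <;> simp
  have hwit : g.v .wit = h.v .wit := by rw [hv] <;> simp
  have hedges : g.L .edges = h.L .edges := by rw [hL]; simp
  have hwits : g.L .wit = h.L .wit := by rw [hL]; simp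
  have hprio : PrioInv D g := by
    have := hI.prio
    rwa [PrioInv, ← hA] at this
  obtain ⟨-, h2, h3, h4, h5, h6, h7, -, h9, h10, h11, h12, h13, h14, h15, h16, h17⟩ := hI
  refine ⟨hs, ?_, ?_, ?_, ?_, ?_, ?_, hprio, ?_, ?_, ?_, ?_, h13, ?_, ?_, ?_, ?_⟩ <;>
    simpa only [hA, hid, hph, hdflt, hwit, hedges, hwits, ho]

/-- The invariant of the search, including that of the heap. -/
def Good (D : Data) (h : Store) : Prop :=
  (∃ bag par cov X R, Inv D h bag par cov X R) ∧ HeapInv D.d (Unselected h) h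

/-- The cost of the atoms that are still to be selected. -/
def unselectedCost (D : Data) (h : Store) : ℕ :=
  ∑ y ∈ Finset.Icc 1 D.d, if h.A .done y < h.v .ph + 1 then 3 * (D.vs y).length else 0

/-- The effect of `step`. -/
structure Stepped (D : Data) (h g : Store) : Prop where
  good : Good D g
  ph : g.v .ph = h.v .ph
  top : h.v .top = 0 → g.v .top = 0
  pot : g.time + cells g + g.v .top + 3 * prio D.d h + unselectedCost D g
      + (if h.v .top = 0 then 0 else 1)
    ≤ h.time + cells h + h.v .top + 3 * prio D.d g + unselectedCost D h

/-- As long as `top` is nonzero, a step either removes a heap entry or lowers `top`, which releases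
one unit of potential. The three loops over the variables of a selected atom are paid by its share
of `unselectedCost`. -/
theorem run_step {D : Data} (hD : D.Valid) {h : Store} (hh : Good D h) :
    Stepped D h (step.run h) := by
  by_cases htop : h.v .top = 0
  · rw [step, run_ite_neg (by simpa using htop)]
    exact ⟨hh, rfl, id, by simp [Cmd.run, htop]⟩
  rw [step, run_ite_pos (by simpa using htop), run_seq]
  obtain ⟨⟨bag, par, cov, X, R, hI⟩, hH⟩ := hh
  have hrun : ∃ h1, (Cmd.pop .e .heap (.var .top)).run h = h1 ∧ h1.A = h.A ∧
      (∀ k, k ≠ .heap → h1.L k = h.L k) ∧ (∀ r, r ≠ .e → h1.v r = h.v r) ∧ h1.out = h.out ∧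
      h1.time = h.time ∧ h1.v .e = (h.L .heap (h.v .top)).headD 0 ∧
      ∀ j, h1.L .heap j = if j = h.v .top then (h.L .heap (h.v .top)).tail else h.L .heap j := by
    refine ⟨_, rfl, rfl, fun k hk => ?_, fun r hr => ?_, rfl, rfl, ?_, fun j => ?_⟩
    · funext j; simp [Cmd.run, hk]
    all_goals simp [Cmd.run, *]
  obtain ⟨h1, e1, A1, L1, v1, out1, time1, ev1, heap1⟩ := hrun
  rw [e1]
  have hI1 : Inv D h1 bag par cov X R := hI.congr A1 L1 (fun r _ hr => v1 r hr) out1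
  have htop1 : h1.v .top = h.v .top := by rw [v1]; simp
  have hph1 : h1.v .ph = h.v .ph := by rw [v1]; simp
  have hU1 : Unselected h1 = Unselected h := by
    funext y; rw [Unselected, A1, hph1]; rfl
  have hprio1 : prio D.d h1 = prio D.d h := by rw [prio, A1]; rfl
  have hcost1 : unselectedCost D h1 = unselectedCost D h := by
    rw [unselectedCost, A1, hph1]; rfl
  have habove1 : ∀ j, h1.v .top < j → h1.L .heap j = [] := fun j hj => by
    rw [htop1] at hj
    rw [heap1, if_neg hj.ne', hH.above j hj]
  rcases hl : h.L .heap (h.v .top) with - | ⟨y, l⟩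
  · rw [hl] at ev1 heap1
    rw [run_ite_neg (by simpa using ev1)]
    set g := (Cmd.set .top (.sub (.var .top) (.lit 1))).run h1 with hg
    have hgv : ∀ r, r ≠ .top → g.v r = h1.v r := fun r hr => by simp [hg, Cmd.run, hr]
    have hgt : g.v .top = h.v .top - 1 := by simp [hg, Cmd.run, htop1]
    have hheap : ∀ j, g.L .heap j = h.L .heap j := fun j => by
      change h1.L .heap j = _
      rw [heap1]
      split_ifs with hj
      · rw [hj, hl]; rfl
      · rfl
    have hgph : g.v .ph = h.v .ph := by rw [hgv _ (by simp), hph1]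
    have hUg : Unselected g = Unselected h := by
      rw [← hU1]; funext y; rw [Unselected, hgv _ (by simp)]; rfl
    have habove : ∀ j, g.v .top < j → g.L .heap j = [] := fun j hj => by
      rw [hheap]
      by_cases hj' : j = h.v .top
      · rw [hj', hl]
      · exact hH.above j (by omega)
    refine ⟨⟨⟨bag, par, cov, X, R, hI1.congr rfl (fun _ _ => rfl) (fun r hr _ => hgv r hr) rfl⟩,
      ⟨fun j z hz => ?_, fun z hz hU => ?_, habove⟩⟩, hgph, fun h0 => by omega, ?_⟩
    · rw [hheap] at hz
      rw [show g.A = h.A from A1]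
      exact hH.mem j z hz
    · rw [hheap, show g.A = h.A from A1]
      exact hH.has z hz (hUg ▸ hU)
    · have c1 : cells g = cells h := by
        rw [cells_eq habove (m := h.v .top) (by omega), cells]
        exact Finset.sum_congr rfl fun j _ => by rw [hheap]
      have c2 : prio D.d g = prio D.d h := hprio1
      have c3 : unselectedCost D g = unselectedCost D h := by
        rw [unselectedCost, hgph, show g.A = h.A from A1]; rfl
      have c4 : g.time = h.time := time1
      rw [if_neg htop]
      omega
  · rw [hl] at ev1 heap1
    have hymem := hH.mem (h.v .top) y (by rw [hl]; exact List.mem_cons_self)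
    have hyI := hymem.1
    have hy0 : y ≠ 0 := by have := Finset.mem_Icc.1 hyI; omega
    have hye : h1.v .e = y := ev1
    have hmem1 : ∀ j, ∀ z ∈ h1.L .heap j, z ∈ Finset.Icc 1 D.d ∧ 0 < j ∧ j ≤ h1.A .bucket z := by
      intro j z hz
      rw [A1]
      rw [heap1] at hz
      refine hH.mem j z ?_
      split_ifs at hz with hj
      · rw [hj, hl]; exact List.mem_cons_of_mem _ hz
      · exact hz
    have hH1 : HeapInv D.d (fun z => Unselected h1 z ∧ z ≠ h1.v .e) h1 := by
      refine ⟨hmem1, fun z hz hU => ?_, habove1⟩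
      rw [hU1, hye] at hU
      have := hH.has z hz hU.1
      rw [heap1, A1]
      split_ifs with hj
      · rw [hj, hl] at this
        exact (List.mem_cons.1 this).resolve_left hU.2
      · exact this
    have hcells : cells h1 + 1 = cells h := by
      have hb : h.v .top ∈ Finset.range (h.v .top + 1) := by simp
      rw [cells, cells, htop1, ← Finset.sum_erase_add _ _ hb,
        ← Finset.sum_erase_add (Finset.range (h.v .top + 1)) _ hb, heap1, if_pos rfl, hl,
        List.tail_cons, List.length_cons, Nat.add_assoc]
      congr 1
      refine Finset.sum_congr rfl fun j hj => ?_
      rw [heap1, if_neg (Finset.ne_of_mem_erase hj)]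
    rw [run_ite_pos (by simpa [hye] using hy0)]
    by_cases hU : Unselected h y
    · rw [run_ite_pos (by
        simp only [Expr.eval, hye, A1, hph1]
        rw [Unselected] at hU
        omega)]
      have hU' : Unselected h1 (h1.v .e) := by rw [hU1, hye]; exact hU
      have hS := run_select hD hI1.stored hI1.prio hH1
      -- The popped atom comes from bucket `top`, which bounds the priorities of all unselected
      -- atoms.
      obtain ⟨bag', par', cov', X', R', hI'⟩ := hI1.select hD (hye ▸ hyI) hU' (fun z hz hUz => by
        rw [hU1] at hUz
        have := hH.le_top hz hUz
        rw [hye, A1]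
        exact this.trans hymem.2.2) hS
      generalize select.run h1 = g at *
      have hgph : g.v .ph = h.v .ph := by rw [← hph1, hS.v] <;> simp
      refine ⟨⟨⟨_, _, _, _, _, hI'⟩, hS.heapInv⟩, hgph, fun h0 => absurd h0 htop, ?_⟩
      have hc : unselectedCost D g + 3 * (D.vs y).length = unselectedCost D h := by
        rw [unselectedCost, unselectedCost, ← Finset.sum_erase_add _ _ hyI,
          ← Finset.sum_erase_add (Finset.Icc 1 D.d) _ hyI, hS.done, hye, if_pos rfl, hgph, hph1,
          if_neg (lt_irrefl _), if_pos (show h.A .done y < h.v .ph + 1 from hU), Nat.add_zero]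
        congr 1
        refine Finset.sum_congr rfl fun z hz => ?_
        rw [hS.done, hye, if_neg (Finset.ne_of_mem_erase hz), A1]
      have := hS.pot
      rw [hye] at this
      rw [if_neg htop]
      omega
    · rw [run_ite_neg (by
        simp only [Expr.eval, hye, A1, hph1]
        rw [Unselected] at hU
        omega)]
      refine ⟨⟨⟨_, _, _, _, _, hI1⟩, ⟨hmem1, fun z hz hUz => hH1.has z hz ⟨hUz, fun hzy => hU ?_⟩,
        habove1⟩⟩, hph1, fun h0 => absurd h0 htop, ?_⟩
      · change Unselected h1 z at hUz
        rw [hU1] at hUz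
        rw [hye] at hzy
        exact hzy ▸ hUz
      · change h1.time + cells h1 + h1.v .top + _ + unselectedCost D h1 + _ ≤ _
        rw [if_neg htop, show (Cmd.skip.run h1) = h1 from rfl]
        omega

/-- The effect of several steps. -/
theorem iterate_step {D : Data} (hD : D.Valid) (n : ℕ) : ∀ {h : Store}, Good D h →
    ∃ g, (fun g => step.run g.tick)^[n] h = g ∧ Good D g ∧ g.v .ph = h.v .ph ∧
      h.time + n ≤ g.time ∧
      g.time + cells g + g.v .top + 3 * prio D.d h + unselectedCost D g
        ≤ h.time + n + cells h + h.v .top + 3 * prio D.d g + unselectedCost D h ∧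
      (g.v .top = 0 ∨ g.time + cells g + g.v .top + 3 * prio D.d h + unselectedCost D g
        ≤ h.time + cells h + h.v .top + 3 * prio D.d g + unselectedCost D h) := by
  induction n with
  | zero => exact fun {h} hh => ⟨h, rfl, hh, rfl, le_rfl, le_rfl, .inr le_rfl⟩
  | succ n ih =>
    intro h hh
    obtain ⟨g, hg, hG, hph, ht, hp, hd⟩ := ih hh
    obtain ⟨⟨_, _, _, _, _, hI⟩, hH⟩ := hG
    have hG' : Good D g.tick :=
      ⟨⟨_, _, _, _, _, hI.congr rfl (fun _ _ => rfl) (fun _ _ _ => rfl) rfl⟩,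
        ⟨hH.mem, hH.has, hH.above⟩⟩
    obtain ⟨s1, s2, s3, s4⟩ := run_step hD hG'
    have ht' := step.time_le_run g.tick
    refine ⟨step.run g.tick, by rw [Function.iterate_succ_apply', hg], s1, s2.trans hph, ?_⟩
    generalize step.run g.tick = g' at *
    have c1 : cells g.tick = cells g := rfl
    have c2 : prio D.d g.tick = prio D.d g := rfl
    have c3 : unselectedCost D g.tick = unselectedCost D g := rfl
    rw [c1, c2, c3] at s4
    rw [Store.tick_time] at s4 ht'
    rw [Store.tick_v] at s3 s4
    refine ⟨by omega, by split_ifs at s4 <;> omega, ?_⟩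
    -- While `top` is nonzero, each iteration's tick is absorbed by the potential; once `top` is
    -- zero it stays so, and the sharper bound is no longer needed.
    by_cases h0 : g.v .top = 0
    · exact .inl (s3 h0)
    · rw [if_neg h0] at s4
      have := hd.resolve_left h0
      exact .inr (by omega)

/-- The effect of `phase`. -/
theorem run_phase {D : Data} (hD : D.Valid) {h : Store} {bag : ℕ → List ℕ} {par cov : ℕ → ℕ}
    {X : Set (Set ℕ)} {R : List (Set ℕ)} (hI : Inv D h bag par cov X R)
    (hheap : ∀ j, h.L .heap j = []) (htop : h.v .top = 0) :
    ∃ g bag' par' cov' X', phase.run h = g ∧ Inv D g bag' par' cov' X' [] ∧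
      (∀ j, g.L .heap j = []) ∧ g.v .top = 0 ∧ g.v .ph = h.v .ph ∧
      (∀ e ∈ Finset.Icc 1 D.d, g.A .done e = h.v .ph + 1) ∧
      g.time ≤ h.time + 15 * D.tot + 3 * D.d + 2 := by
  have hF := eachRun_enter (d := D.d) (h.L .atoms 0) (U := fun _ => False)
    (V := fun y => Unselected h y ∧ y ∈ Finset.Icc 1 D.d) h
    ⟨by simp [hheap], by simp, fun j _ => hheap j⟩ (fun y hy => (hI.stored.atoms y).1 hy)
    (fun y hy => by rw [hI.prio y ((hI.stored.atoms y).1 hy)]; omega)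
    (fun y hU => .inr ((hI.stored.atoms y).2 hU.2))
  have hrun : phase.run h = (Cmd.rep bound step).run (eachRun .e (enter .e) (h.L .atoms 0) h) := rfl
  rw [hrun]
  obtain ⟨A0, L0, v0, -, out0, time0, cells0, top0, heap0⟩ := hF
  generalize eachRun .e (enter .e) (h.L .atoms 0) h = h0 at *
  have hI0 : Inv D h0 bag par cov X R := hI.congr A0 L0 v0 out0
  have hph0 : h0.v .ph = h.v .ph := by rw [v0] <;> simp
  have hU0 : Unselected h0 = Unselected h := by
    funext y; rw [Unselected, A0, hph0]; rfl
  have hbound : bound.eval h0 = 8 * D.tot + D.d + 1 := by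
    have h1 := hI0.stored.tot
    have h2 := hI0.stored.cnt
    simp only [bound, dbl, Expr.eval]
    omega
  have hlen : (h.L .atoms 0).length = D.d := by
    have : (h.L .atoms 0).toFinset = Finset.Icc 1 D.d := by
      ext y; rw [List.mem_toFinset, hI.stored.atoms]
    rw [← List.toFinset_card_of_nodup hI.stored.atoms_nodup, this, Nat.card_Icc]
    omega
  have hcells : cells h = 0 := by simp [cells, hheap]
  have htop0 : h0.v .top ≤ D.tot + 1 := by
    refine top0 _ (by omega) fun y hy => ?_
    have hy' := (hI.stored.atoms y).1 hy
    rw [hI.prio y hy', ← hD.tot_eq]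
    exact Nat.add_le_add_right ((List.length_filter_le ..).trans
      (Finset.single_le_sum (f := fun e => (D.vs e).length) (fun _ _ => Nat.zero_le _) hy')) 1
  have hprio0 : D.d ≤ prio D.d h0 := by
    calc D.d = ∑ _y ∈ Finset.Icc 1 D.d, 1 := by simp
      _ ≤ _ := Finset.sum_le_sum fun y hy => by rw [hI0.prio y hy]; omega
  have hcost0 : unselectedCost D h0 ≤ 3 * D.tot := by
    rw [← hD.tot_eq, Finset.mul_sum]
    exact Finset.sum_le_sum fun y _ => by split_ifs <;> omega
  obtain ⟨g, hg, ⟨⟨bag', par', cov', X', R', hI'⟩, hH'⟩, hph', ht, hp, hd⟩ :=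
    iterate_step hD (8 * D.tot + D.d + 1) (h := h0)
      ⟨⟨_, _, _, _, _, hI0⟩, ⟨heap0.mem, fun z hz hU => heap0.has z hz ⟨hU0 ▸ hU, hz⟩,
        heap0.above⟩⟩
  have hprio' : prio D.d g ≤ D.tot + D.d := by
    calc prio D.d g ≤ ∑ y ∈ Finset.Icc 1 D.d, ((D.vs y).length + 1) :=
          Finset.sum_le_sum fun y hy => by
            rw [hI'.prio y hy]
            exact Nat.add_le_add_right (List.length_filter_le ..) 1
      _ = _ := by rw [Finset.sum_add_distrib, hD.tot_eq]; simp
  -- If the sharper bound holds, elapsed time plus `top` is at most 7 tot + d + 1, whereas 8 tot + d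
  -- + 1 iterations have been made; this forces `top` to be 0. The factor 8 is used in `bound`
  -- because doubling produces it.
  have htop' : g.v .top = 0 := by
    rcases hd with hd | hd
    · exact hd
    · omega
  have hheap' : ∀ j, g.L .heap j = [] := fun j => by
    -- Bucket 0 is always empty, as priorities are positive.
    by_cases hj : j = 0
    · rw [List.eq_nil_iff_forall_not_mem]
      intro y hy
      have := hH'.mem j y hy
      omega
    · exact hH'.above j (by omega)
  -- An unselected atom would still be in the heap, which is empty.
  have hdone : ∀ e ∈ Finset.Icc 1 D.d, ¬ Unselected g e := fun e he hU => by
    have := hH'.has e he hU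
    rw [hheap'] at this
    simp at this
  have hR : R' = [] := by
    rw [List.eq_nil_iff_forall_not_mem]
    intro s hs
    obtain ⟨e, he, hU, -⟩ := hI'.trace_mem.1 hs
    exact hdone e he hU
  subst hR
  refine ⟨g, bag', par', cov', X', ?_, hI', hheap', htop', by omega, fun e he => ?_, by omega⟩
  · rw [← hg, ← hbound]; rfl
  · have h1 := hI'.done e he
    have h2 := hdone e he
    rw [Unselected] at h2
    omega

end FCQ

/-! ## The correctness of the search -/

namespace FCQ

open RAM

variable {σ : Schema}

/-- The data of the query `Q`. -/
structure Data.Of (D : Data) (Q : CQ σ) : Prop where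
  d_eq : D.d = Q.body.length
  vs : ∀ i α, Q.body[i]? = some α → ∀ x, x ∈ D.vs (i + 1) ↔ x ∈ α.vars
  zs : D.zs = Q.head

/-- The data are in the memory, and the other parts of the memory are in their initial state. -/
structure Loaded (D : Data) (h : Store) : Prop where
  stored : Stored D h
  zero : ∀ r, r = .ph ∨ r = .id ∨ r = .dflt ∨ r = .wit ∨ r = .top → h.v r = 0
  bucket : ∀ e ∈ Finset.Icc 1 D.d, h.A .bucket e = 1
  owner : ∀ x, h.A .owner x = 0
  done : ∀ x, h.A .done x = 0
  heap : ∀ j, h.L .heap j = []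
  edges : h.L .edges 0 = []
  wit : h.L .wit 0 = []
  out : h.out = []

/-- Translates between atoms numbered from 1 in memory and positions from 0 in the body. -/
theorem Data.Of.map_range' {D : Data} {Q : CQ σ} (h : D.Of Q) {f : ℕ → Set ℕ}
    {g : Set ℕ → Set ℕ} (hf : ∀ e, f e = g {x | x ∈ D.vs e}) :
    (List.range' 1 D.d).map f = Q.varSets.map g := by
  refine List.ext_getElem (by simp [CQ.varSets, h.d_eq]) fun i h1 h2 => ?_
  have hi : i < Q.body.length := by simpa [CQ.varSets] using h2
  simp only [List.getElem_map, List.getElem_range', CQ.varSets, one_mul]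
  rw [hf, Nat.add_comm 1 i]
  congr 1
  ext x
  exact h.vs i _ (List.getElem?_eq_getElem hi) x

theorem Data.Of.mem_free {D : Data} {Q : CQ σ} (h : D.Of Q) (hD : D.Valid) {x : ℕ} :
    x ∈ Q.free ↔ D.fr x ≠ 0 := by
  rw [← hD.mem_zs, h.zs, CQ.free, List.mem_toFinset]

/-- The invariant at the beginning of the first phase. -/
theorem Loaded.inv {Q : CQ σ} (hQ : Q.IsFreeConnexAcyclic) {D : Data} (hDQ : D.Of Q)
    (hD : D.Valid) {h : Store} (hh : Loaded D h) :
    ∃ R, Inv D (header.run h) (fun _ => []) (fun _ => 0) (fun _ => 0) {∅} R := by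
  obtain ⟨R, hR, hE⟩ := CQ.exists_elim_inter_free Q hQ
  have hph : h.v .ph = 0 := hh.zero _ (by simp)
  have hid : h.v .id = 0 := hh.zero _ (by simp)
  have hdflt : h.v .dflt = 0 := hh.zero _ (by simp)
  have hwit : h.v .wit = 0 := hh.zero _ (by simp)
  have hlen : R.length = D.d := by
    rw [hR.length_eq, List.length_map, CQ.varSets, List.length_map, hDQ.d_eq]
  have hpos : 0 < D.d := by
    rw [hDQ.d_eq]; exact List.length_pos_iff.2 Q.body_ne_nil
  set g := header.run h with hg
  have hgv : g.v = h.v := rfl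
  have hgA : g.A = h.A := rfl
  have hgL : g.L = h.L := rfl
  have hout : g.out = h.out ++ [(h.v .cnt + h.v .cnt) + (h.v .cnt + h.v .cnt) + 1, 0, 0] := by
    simp [hg, header, Cmd.run, dbl]
  have hprio : PrioInv D g := fun y hy => by
    rw [hgA, hh.bucket y hy]
    simp [markedCount, hh.owner]
  refine ⟨R, ⟨hh.stored.congr rfl rfl rfl rfl rfl rfl, ?_, ?_, ?_, ?_, ?_, ?_, hprio, ?_, ?_, ?_, ?_,
    hE, ?_, ?_, ?_, ?_⟩⟩ <;> simp only [hgv, hgA, hgL, hph, hid, hdflt, hwit, hh.wit, hh.edges]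
  · omega
  · rw [hout, hh.out, hh.stored.cnt]
    simp [nodesOut, encodeList]
    omega
  · simp [edgesOut, countdown]
  · refine ⟨⟨by omega, by simp, by simp, by simp⟩, by simp [hpos], by simp, rfl, by simp, ?_⟩
    simp [hh.owner]
  · refine ⟨by simp, by simp, by simp, by simp, by simp, ?_, ?_, by simp, by simp⟩ <;>
      simp [hh.owner]
  · rfl
  · simp [hh.owner]
  · simp
  · simp [hh.done]
  · rw [List.filter_eq_self.2 (by simp [hh.done]),
      hDQ.map_range' (g := (· ∩ (Q.free : Set Var))) fun e => ?_]
    · exact hR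
    · ext x
      simp [trace, hDQ.mem_free hD]
  · simp [hh.owner]
  · simp
  · simp [hh.done]
  · omega

/-- The transition to the second phase. -/
theorem Inv.transition {Q : CQ σ} (hQ : Q.IsFreeConnexAcyclic) {D : Data} (hDQ : D.Of Q)
    (hD : D.Valid) {h : Store} {bag : ℕ → List ℕ} {par cov : ℕ → ℕ} {X : Set (Set ℕ)}
    (hI : Inv D h bag par cov X []) (hph : h.v .ph = 0)
    (hdone : ∀ e ∈ Finset.Icc 1 D.d, h.A .done e = 1) :
    ∃ R, Inv D (h.setV .ph 1) bag par cov {(Q.free : Set Var), ∅} R := by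
  obtain ⟨R, hR, hE⟩ := CQ.exists_elim_free Q hQ
  have hlen : R.length = D.d := by
    rw [hR.length_eq, CQ.varSets, List.length_map, hDQ.d_eq]
  have hseen : ∀ e ∈ Finset.Icc 1 D.d, ∃ t ≤ h.v .id, ∀ x, x ∈ bag t ↔ x ∈ D.vs e ∧ D.fr x ≠ 0 := by
    intro e he
    obtain ⟨t, ht, -, hx⟩ := hI.seen e he (by rw [hdone e he, hph])
    refine ⟨t, ht, fun x => ?_⟩
    rw [hx, hph]
    rfl
  -- After the first phase exactly the free variables are marked: each one occurs in some atom,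
  -- whose trace has become a bag.
  have hfree : ∀ x, D.fr x ≠ 0 ↔ h.A .owner x ≠ 0 := fun x => by
    constructor
    · intro hx
      obtain ⟨e, he, hxe⟩ := hD.exists_mem x hx
      obtain ⟨t, ht, hbt⟩ := hseen e he
      exact (hI.nodes.marked t ht x ((hbt x).2 ⟨hxe, hx⟩)).1.ne'
    · intro hx
      have := hI.allowed x hx
      omega
  have hv : ∀ r, r ≠ .ph → (h.setV .ph 1).v r = h.v r := fun r hr => by simp [hr]
  have hid := hv .id (by simp)
  have hdflt := hv .dflt (by simp)
  have hwit := hv .wit (by simp)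
  have hph1 : (h.setV .ph 1).v .ph = 1 := by simp
  refine ⟨R, ⟨hI.stored.congr rfl rfl rfl rfl (hv _ (by simp)) (hv _ (by simp)), ?_, ?_, ?_, ?_, ?_,
    ?_, hI.prio, ?_, ?_, ?_, ?_, hE, ?_, ?_, ?_, ?_⟩⟩ <;>
    simp only [hid, hdflt, hwit, hph1, Store.setV_out, Store.setV_A, Store.setV_L]
  · omega
  · exact hI.out
  · exact hI.edges
  · exact hI.nodes
  · exact hI.wit
  · exact hI.wit_len
  · omega
  · exact fun _ x => (hfree x).1
  · exact fun e he => .inl (hdone e he)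
  · rw [List.filter_eq_self.2 fun e he => ?_, hDQ.map_range' (g := id) fun e => ?_, List.map_id]
    · exact hR
    · ext x
      simp [trace]
    · rw [List.mem_range'_1] at he
      simpa using hdone e (Finset.mem_Icc.2 (by omega))
  · rw [Set.sUnion_insert, Set.sUnion_singleton, Set.union_empty]
    ext x
    exact (hDQ.mem_free hD).trans (hfree x)
  -- The base set free(Q) meets the atom `e` in the bag that the first phase produced for `e`.
  · rintro f (rfl | rfl) e he
    · obtain ⟨t, ht, hx⟩ := hseen e he
      exact ⟨t, ht, fun x hxe hxf => (hx x).2 ⟨hxe, (hDQ.mem_free hD).1 hxf⟩⟩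
    · exact ⟨0, Nat.zero_le _, by simp⟩
  · intro e he h2
    rw [hdone e he] at h2
    omega
  · have := hI.count
    rw [hph, List.length_nil] at this
    omega

/-- The effect of `finish`. -/
theorem run_finish (h : Store) (hw : h.v .wit = (h.L .wit 0).length) :
    ∃ W, (W = if h.L .wit 0 = [] then [0] else h.L .wit 0) ∧
      (finish.run h).out = h.out ++ 4 * h.v .cnt :: h.L .edges 0 ++ encodeList W ∧
      (finish.run h).time = h.time + (h.L .edges 0).length + W.length := by
  set h1 := (Cmd.write (dbl (dbl (.var .cnt)))).run h with hh1
  have out1 : h1.out = h.out ++ [4 * h.v .cnt] := by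
    simp [hh1, Cmd.run, dbl]
    omega
  obtain ⟨a1, a2, a3, a4⟩ := eachRun_write (h.L .edges 0) h1
  set h2 := eachRun .x (.write (.var .x)) (h.L .edges 0) h1 with hh2
  have hw2 : h2.v .wit = (h.L .wit 0).length := by rw [a4 _ (by simp), ← hw]; rfl
  have hL2 : h2.L = h.L := a3
  have ht2 : h2.time = h.time + (h.L .edges 0).length := a2
  obtain ⟨h3, e3, t3, o3, w3, W3⟩ : ∃ h3,
      (Cmd.ite (.var .wit) .skip (.push .wit (.lit 0) (.lit 0) ;; incr .wit)).run h2 = h3 ∧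
      h3.time = h2.time ∧ h3.out = h2.out ∧ h3.v .wit = (h3.L .wit 0).length ∧
      h3.L .wit 0 = if h.L .wit 0 = [] then [0] else h.L .wit 0 := by
    by_cases h0 : h.L .wit 0 = []
    · rw [h0, List.length_nil] at hw2
      rw [run_ite_neg (by simpa using hw2)]
      refine ⟨_, rfl, rfl, rfl, ?_, ?_⟩ <;> simp [Cmd.run, incr, hL2, h0, hw2]
    · have : h2.v .wit ≠ 0 := by rw [hw2]; simpa using h0
      rw [run_ite_pos (by simpa using this)]
      exact ⟨_, rfl, rfl, rfl, by rw [Cmd.run, hw2, hL2], by rw [if_neg h0, Cmd.run, hL2]⟩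
  have hrun : finish.run h = eachRun .x (.write (.var .x))
      (((Cmd.write (.var .wit)).run h3).L .wit 0) ((Cmd.write (.var .wit)).run h3) := by
    rw [← e3]; rfl
  obtain ⟨b1, b2, -, -⟩ := eachRun_write (h3.L .wit 0) ((Cmd.write (.var .wit)).run h3)
  refine ⟨h3.L .wit 0, W3, ?_, ?_⟩
  · rw [hrun, show ((Cmd.write (.var .wit)).run h3).L = h3.L from rfl, b1,
      show ((Cmd.write (.var .wit)).run h3).out = h3.out ++ [h3.v .wit] from rfl, o3, a1, out1, w3]
    simp [encodeList]
  · rw [hrun, show ((Cmd.write (.var .wit)).run h3).L = h3.L from rfl, b2,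
      show ((Cmd.write (.var .wit)).run h3).time = h3.time from rfl, t3, ht2]

theorem edgesOut_length (par : ℕ → ℕ) (n : ℕ) : (edgesOut par n).length = 2 * n := by
  simp [edgesOut, countdown, Nat.mul_comm]

/-- The time consists of 30 tot + 6d + 4 for the two phases, 8d for writing the 4d edges, and at
most 2ℓ + 1 for the witness, where ℓ is the number of free variables. -/
theorem run_search {Q : CQ σ} (hQ : Q.IsFreeConnexAcyclic) {D : Data} (hDQ : D.Of Q)
    (hD : D.Valid) {h : Store} (hh : Loaded D h) :
    (search.run h).time ≤ h.time + 30 * D.tot + 14 * D.d + 2 * Q.head.length + 5 ∧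
    ∃ H : FC1GHD Q (Fin (4 * D.d + 1)), H.Represents (search.run h).out ∧ H.IsComplete ∧
      (Q.free.Nonempty → H.witness.card < 2 * Q.free.card) ∧
      (Q.free = ∅ → H.witness.card = 1) ∧
      ∀ u v, H.tree.Adj u v → H.bag u ⊆ H.bag v ∨ H.bag v ⊆ H.bag u := by
  have hcard : Q.free.card = Q.head.length := List.toFinset_card_of_nodup Q.head_nodup
  obtain ⟨R, hI0⟩ := hh.inv hQ hDQ hD
  have hph0 : (header.run h).v .ph = 0 := hh.zero _ (by simp)
  obtain ⟨h1, bag1, par1, cov1, X1, e1, hI1, heap1, top1, ph1, done1, time1⟩ :=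
    run_phase hD hI0 hh.heap (hh.zero _ (by simp))
  rw [hph0] at ph1 done1
  obtain ⟨R', hI2⟩ := hI1.transition hQ hDQ hD ph1 done1
  obtain ⟨g, bag, par, cov, X, e2, hI, heap2, top2, ph2, done2, time2⟩ :=
    run_phase hD hI2 heap1 (by simpa using top1)
  have hph : g.v .ph = 1 := by rw [ph2]; simp
  have hdone : ∀ e ∈ Finset.Icc 1 D.d, g.A .done e = 2 := fun e he => by rw [done2 e he]; simp
  have hrun : search.run h = finish.run g := by
    rw [← e2, ← e1]; rfl
  have htime0 : (header.run h).time = h.time := rfl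
  rw [Store.setV_time] at time2
  obtain ⟨W, hW, hout, htime⟩ := run_finish g hI.wit_len
  have hn : g.v .id = 4 * D.d := by
    have := hI.count
    rw [hph, List.length_nil] at this
    omega
  have hnodes := hI.nodes
  have hwit := hI.wit
  rw [hn] at hnodes hwit
  rw [hI.out, hI.edges, hn, hI.stored.cnt] at hout
  rw [hI.edges, edgesOut_length, hn] at htime
  have hfreeM := hI.free (by omega)
  have hzs : ∀ M : ℕ → ℕ, (D.zs.filter (M · ≠ 0)).length ≤ Q.head.length := fun M => by
    rw [← hDQ.zs]; exact List.length_filter_le ..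
  have hcov : ∀ t ≤ 4 * D.d, ∃ α, Q.body[cov t]? = some α ∧ ∀ x ∈ bag t, x ∈ α.vars := by
    intro t ht
    have hlt := hnodes.cov_lt t ht
    rw [hDQ.d_eq] at hlt
    have hα := List.getElem?_eq_getElem hlt
    exact ⟨_, hα, fun x hx => (hDQ.vs _ _ hα x).1 (hnodes.cov_sub t ht hx)⟩
  have hcomp : ∀ e α, Q.body[e]? = some α → ∃ t ≤ 4 * D.d, cov t = e ∧
      ∀ x, x ∈ bag t ↔ x ∈ α.vars := by
    intro e α he
    have hlt := (List.getElem?_eq_some_iff.1 he).1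
    rw [← hDQ.d_eq] at hlt
    have heI : e + 1 ∈ Finset.Icc 1 D.d := Finset.mem_Icc.2 (by omega)
    obtain ⟨t, ht, hc, hx⟩ := hI.seen (e + 1) heI (by rw [hdone _ heI, hph])
    refine ⟨t, hn ▸ ht, hc, fun x => ?_⟩
    rw [hx, ← hDQ.vs e α he x, hph]
    simp [trace]
  -- The root of the witness is node 0 if there are no free variables, and `dflt` otherwise.
  have key : ∃ m ∈ W, W.Nodup ∧ (∀ t ∈ W, t ≤ 4 * D.d) ∧
      (∀ t ∈ W, t ≠ m → 0 < t ∧ par t ∈ W) ∧ (∀ x, x ∈ Q.free ↔ ∃ t ∈ W, x ∈ bag t) ∧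
      (Q.free.Nonempty → W.length < 2 * Q.free.card) ∧ (Q.free = ∅ → W.length = 1) ∧
      W.length ≤ 2 * Q.head.length + 1 := by
    by_cases h0 : g.L .wit 0 = []
    · have hfree : ∀ x, x ∉ Q.free := fun x hx => by
        have hx' := (hDQ.mem_free hD).1 hx
        have := hwit.own x hx' (hfreeM x hx')
        rw [h0] at this
        simp at this
      rw [if_pos h0] at hW
      subst hW
      exact ⟨0, by simp, by simp, by simp, by simp, fun x => by simp [hfree, hnodes.zero],
        fun ⟨x, hx⟩ => absurd hx (hfree x), by simp, by simp⟩
    · rw [if_neg h0] at hW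
      subst hW
      have hc := hwit.card h0
      have hz := hzs (g.A .owner)
      have hd : g.v .dflt ≠ 0 := fun hd => h0 (hwit.nil hd)
      refine ⟨g.v .dflt, hwit.mem hd, hwit.nodup, fun t ht => (hwit.le t ht).2,
        fun t ht htm => ⟨(hwit.le t ht).1, hwit.par_mem t ht htm⟩, fun x => ⟨fun hx => ?_, ?_⟩,
        fun _ => by omega, fun he => ?_, by omega⟩
      · have hx' := (hDQ.mem_free hD).1 hx
        exact ⟨_, hwit.own x hx' (hfreeM x hx'), (hnodes.owner x (hfreeM x hx')).2⟩
      · rintro ⟨t, ht, hx⟩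
        exact (hDQ.mem_free hD).2 (hwit.free t ht x hx)
      · rw [he, Finset.card_empty] at hcard
        omega
  obtain ⟨m, hm, hWn, hWle, hWp, hWf, hWc, hWc', hWl⟩ := key
  obtain ⟨H, hR, hC, hw, hE⟩ := hnodes.seq.exists_decomposition Q cov W hcov hcomp hWn hWle hm hWp
    hWf (fun t => mem_countdown) (countdown_nodup _)
  refine ⟨by rw [hrun]; omega, H, ?_, hC, by rwa [hw], by rwa [hw], hE⟩
  rw [hrun, hout]
  simpa [nodesOut, edgesOut] using hR

end FCQ

/-! ## Reading the query -/

namespace FCQ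

open RAM

variable {σ : Schema}

/-- The effect of the loop that reads the head. -/
structure HeadRead (l rest : List ℕ) (h g : Store) : Prop where
  A : ∀ k, k ≠ .isFree → g.A k = h.A k
  isFree : ∀ x, g.A .isFree x = if x ∈ l then 1 else h.A .isFree x
  L : g.L = h.L
  v : ∀ r, r ≠ .x → g.v r = h.v r
  inp : g.inp = rest
  out : g.out = h.out
  time : g.time = h.time + l.length

theorem iterate_readHead (l : List ℕ) {rest : List ℕ} : ∀ {h : Store}, h.inp = l ++ rest →
    HeadRead l rest h ((fun g => (Cmd.read .x ;; .put .isFree (.var .x) (.lit 1)).run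
      g.tick)^[l.length] h) := by
  induction l with
  | nil =>
    exact fun {h} hi => ⟨fun _ _ => rfl, by simp, rfl, fun _ _ => rfl, hi, rfl, rfl⟩
  | cons a l ih =>
    intro h hi
    rw [List.length_cons, Function.iterate_succ_apply]
    obtain ⟨h1, e1, A1, f1, L1, v1, i1, o1, t1⟩ : ∃ h1,
        (Cmd.read .x ;; .put .isFree (.var .x) (.lit 1)).run h.tick = h1 ∧
        (∀ k, k ≠ .isFree → h1.A k = h.A k) ∧
        (∀ x, h1.A .isFree x = if x = a then 1 else h.A .isFree x) ∧ h1.L = h.L ∧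
        (∀ r, r ≠ .x → h1.v r = h.v r) ∧ h1.inp = l ++ rest ∧ h1.out = h.out ∧
        h1.time = h.time + 1 := by
      refine ⟨_, rfl, fun k hk => ?_, fun x => ?_, rfl, fun r hr => ?_, ?_, rfl, rfl⟩
      · funext x; simp [Cmd.run, hk]
      all_goals simp [Cmd.run, *]
    rw [e1]
    obtain ⟨A2, f2, L2, v2, i2, o2, t2⟩ := ih i1
    refine ⟨fun k hk => (A2 k hk).trans (A1 k hk), fun x => ?_, L2.trans L1,
      fun r hr => (v2 r hr).trans (v1 r hr), i2, o2.trans o1, ?_⟩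
    · rw [f2, f1]
      by_cases hx : x = a <;> simp [hx]
    · rw [t2, t1, List.length_cons]; omega

/-- The variables that have been read for the atom `e` are determined by the array `last`. -/
structure LastInv (e : ℕ) (h : Store) : Prop where
  le : ∀ x, h.A .last x ≤ e
  eq_iff : ∀ x, h.A .last x = e ↔ x ∈ h.L .vars e
  nodup : (h.L .vars e).Nodup

/-- The effect of the loop that reads the variables of the atom `e`. -/
structure VarsRead (e : ℕ) (l rest : List ℕ) (h g : Store) : Prop where
  last : LastInv e g
  A : ∀ k, k ≠ .last → g.A k = h.A k
  mem : ∀ x, x ∈ g.L .vars e ↔ x ∈ h.L .vars e ∨ x ∈ l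
  vars : ∀ y, y ≠ e → g.L .vars y = h.L .vars y
  occ : ∀ x, g.L .occ x = if x ∈ l ∧ x ∉ h.L .vars e then e :: h.L .occ x else h.L .occ x
  L : ∀ k, k ≠ .vars → k ≠ .occ → g.L k = h.L k
  v : ∀ r, r ≠ .x → r ≠ .tot → g.v r = h.v r
  tot : g.v .tot + (h.L .vars e).length = h.v .tot + (g.L .vars e).length
  tot_le : g.v .tot ≤ h.v .tot + l.length
  inp : g.inp = rest
  out : g.out = h.out
  time : g.time = h.time + l.length

/-- A variable may be repeated among the arguments of an atom. The array `last` detects repetitions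
in constant time without being cleared between atoms, because atom numbers increase. -/
theorem iterate_readVar (e : ℕ) (l : List ℕ) {rest : List ℕ} : ∀ {h : Store}, LastInv e h →
    h.v .e = e → h.inp = l ++ rest →
    VarsRead e l rest h ((fun g => readVar.run g.tick)^[l.length] h) := by
  induction l with
  | nil =>
    exact fun {h} hl _ hi => ⟨hl, fun _ _ => rfl, by simp, fun _ _ => rfl, by simp,
      fun _ _ _ => rfl, fun _ _ _ => rfl, rfl, le_rfl, hi, rfl, rfl⟩
  | cons a l ih =>
    intro h hl he hi
    rw [List.length_cons, Function.iterate_succ_apply]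
    have step1 : VarsRead e [a] (l ++ rest) h (readVar.run h.tick) := by
      by_cases ha : a ∈ h.L .vars e
      · have hr : readVar.run h.tick = (Cmd.read .x).run h.tick := by
          rw [readVar, run_seq, run_ite_neg]
          · rfl
          · simp [Cmd.run, hi, he, (hl.eq_iff a).2 ha]
        rw [hr]
        refine ⟨⟨hl.le, hl.eq_iff, hl.nodup⟩, fun _ _ => rfl, fun x => ?_, fun _ _ => rfl,
          fun x => ?_, fun _ _ _ => rfl, fun r hr _ => by simp [Cmd.run, hr], ?_, ?_, ?_, rfl, rfl⟩
        · change x ∈ h.L .vars e ↔ _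
          rw [List.mem_singleton]
          exact ⟨.inl, fun hx => hx.elim id fun hx => hx ▸ ha⟩
        · rw [if_neg]
          · rfl
          · rw [List.mem_singleton]
            rintro ⟨rfl, hx⟩
            exact hx ha
        all_goals simp [Cmd.run, hi]
      · have hlt : h.A .last a < e :=
          lt_of_le_of_ne (hl.le a) fun hx => ha ((hl.eq_iff a).1 hx)
        have hr : readVar.run h.tick = (Cmd.put .last (.var .x) (.var .e) ;;
            .push .occ (.var .x) (.var .e) ;; .push .vars (.var .e) (.var .x) ;; incr .tot).run
            ((Cmd.read .x).run h.tick) := by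
          rw [readVar, run_seq, run_ite_pos]
          simp [Cmd.run, hi, he]
          omega
        obtain ⟨g, hg, A, last, L, occ, vars, v, tot, inp, out, time⟩ : ∃ g,
            readVar.run h.tick = g ∧ (∀ k, k ≠ .last → g.A k = h.A k) ∧
            (∀ x, g.A .last x = if x = a then e else h.A .last x) ∧
            (∀ k, k ≠ .vars → k ≠ .occ → g.L k = h.L k) ∧
            (∀ x, g.L .occ x = if x = a then e :: h.L .occ x else h.L .occ x) ∧
            (∀ y, g.L .vars y = if y = e then a :: h.L .vars y else h.L .vars y) ∧
            (∀ r, r ≠ .x → r ≠ .tot → g.v r = h.v r) ∧ g.v .tot = h.v .tot + 1 ∧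
            g.inp = l ++ rest ∧ g.out = h.out ∧ g.time = h.time + 1 := by
          refine ⟨_, hr, fun k hk => ?_, fun x => ?_, fun k hk hk' => ?_, fun x => ?_, fun y => ?_,
            fun r hr hr' => ?_, ?_, ?_, rfl, rfl⟩
          · funext x; simp [Cmd.run, incr, hk]
          · simp [Cmd.run, incr, hi, he]
          · funext x; simp [Cmd.run, incr, hk, hk']
          · simp [Cmd.run, incr, hi, he]
            split_ifs with hx <;> simp [hx]
          · simp [Cmd.run, incr, hi, he]
            split_ifs with hx <;> simp [hx]
          all_goals simp [Cmd.run, incr, *]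
        rw [hg]
        refine ⟨⟨fun x => ?_, fun x => ?_, ?_⟩, A, fun x => ?_, fun y hy => ?_, fun x => ?_, L, v,
          ?_, ?_, inp, out, time⟩
        · rw [last]
          split_ifs
          · exact le_rfl
          · exact hl.le x
        · rw [last, vars, if_pos rfl]
          by_cases hx : x = a
          · simp [hx]
          · simp [hx, hl.eq_iff]
        · rw [vars, if_pos rfl]
          exact List.nodup_cons.2 ⟨ha, hl.nodup⟩
        · rw [vars, if_pos rfl, List.mem_cons, List.mem_singleton, or_comm]
        · rw [vars, if_neg hy]
        · rw [occ]
          refine if_congr ?_ rfl rfl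
          rw [List.mem_singleton]
          exact ⟨fun hx => ⟨hx, hx ▸ ha⟩, And.left⟩
        · rw [vars, if_pos rfl, tot, List.length_cons]; omega
        · rw [tot]; rfl
    generalize readVar.run h.tick = h1 at *
    obtain ⟨l1, A1, m1, w1, o1, L1, v1, t1, tl1, i1, u1, c1⟩ := step1
    obtain ⟨l2, A2, m2, w2, o2, L2, v2, t2, tl2, i2, u2, c2⟩ :=
      ih l1 ((v1 _ (by simp) (by simp)).trans he) i1
    refine ⟨l2, fun k hk => (A2 k hk).trans (A1 k hk), fun x => ?_,
      fun y hy => (w2 y hy).trans (w1 y hy), fun x => ?_,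
      fun k hk hk' => (L2 k hk hk').trans (L1 k hk hk'),
      fun r hr hr' => (v2 r hr hr').trans (v1 r hr hr'), by omega, ?_, i2, u2.trans u1, ?_⟩
    · rw [m2, m1, List.mem_singleton, List.mem_cons, or_assoc]
    · rw [o2, o1]
      have := m1 x
      rw [List.mem_singleton] at this
      by_cases hxa : x = a
      · subst hxa
        by_cases hx : x ∈ h.L .vars e <;> simp [this, hx]
      · simp [this, hxa]
    · rw [List.length_cons]
      have : [a].length = 1 := rfl
      omega
    · simp only [c2, c1, List.length_cons, List.length_nil]
      omega

/-- The state after the atoms with the arguments `as` have been read. -/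
structure Reading (zs : List ℕ) (c T : ℕ) (as : List (List ℕ)) (rest : List ℕ) (h : Store) :
    Prop where
  e : h.v .e = as.length
  cnt : h.v .cnt = c
  last : ∀ x, h.A .last x ≤ as.length
  vars_nodup : ∀ y, (h.L .vars y).Nodup
  vars : ∀ i l, as[i]? = some l → ∀ x, x ∈ h.L .vars (i + 1) ↔ x ∈ l
  mem_Icc : ∀ y, ∀ x ∈ h.L .vars y, y ∈ Finset.Icc 1 as.length
  occ_nodup : ∀ x, (h.L .occ x).Nodup
  occ : ∀ x y, y ∈ h.L .occ x ↔ x ∈ h.L .vars y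
  tot : ∑ y ∈ Finset.Icc 1 as.length, (h.L .vars y).length = h.v .tot
  tot_le : h.v .tot ≤ (as.map List.length).sum
  bucket : ∀ y ∈ Finset.Icc 1 as.length, h.A .bucket y = 1
  atoms_nodup : (h.L .atoms 0).Nodup
  atoms : ∀ y, y ∈ h.L .atoms 0 ↔ y ∈ Finset.Icc 1 as.length
  isFree : ∀ x, h.A .isFree x ≠ 0 ↔ x ∈ zs
  zero : ∀ r, r = .ph ∨ r = .id ∨ r = .dflt ∨ r = .wit ∨ r = .top → h.v r = 0
  owner : ∀ x, h.A .owner x = 0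
  done : ∀ x, h.A .done x = 0
  nil : ∀ k, k = .heap ∨ k = .edges ∨ k = .wit → ∀ j, h.L k j = []
  out : h.out = []
  inp : h.inp = rest
  time : h.time ≤ T + as.length + (as.map List.length).sum

/-- The number of the new atom is larger than all earlier ones, so its variable list is empty and it
occurs in no occurrence list yet. -/
theorem Reading.snoc {zs : List ℕ} {c T R : ℕ} {as : List (List ℕ)} {l rest : List ℕ} {h : Store}
    (hh : Reading zs c T as (R :: encodeList l ++ rest) h) :
    Reading zs c T (as ++ [l]) rest (readAtom.run h.tick) := by
  set e := as.length + 1 with he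
  have hlen : (as ++ [l]).length = e := by simp [he]
  have hsum : ((as ++ [l]).map List.length).sum = (as.map List.length).sum + l.length := by simp
  obtain ⟨h1, r1, ev1, v1, len1, b1, A1, L1, at1, i1, o1, t1⟩ : ∃ h1,
      readAtom.run h.tick = (fun g => readVar.run g.tick)^[h1.v .len] h1 ∧ h1.v .e = e ∧
      (∀ r, r ≠ .e → r ≠ .x → r ≠ .len → h1.v r = h.v r) ∧ h1.v .len = l.length ∧
      (∀ y, h1.A .bucket y = if y = e then 1 else h.A .bucket y) ∧
      (∀ k, k ≠ .bucket → h1.A k = h.A k) ∧ (∀ k, k ≠ .atoms → h1.L k = h.L k) ∧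
      h1.L .atoms 0 = e :: h.L .atoms 0 ∧ h1.inp = l ++ rest ∧ h1.out = h.out ∧
      h1.time = h.time + 1 := by
    have hee := hh.e
    have hi := hh.inp
    refine ⟨(incr .e ;; .read .x ;; .read .len ;; .put .bucket (.var .e) (.lit 1) ;;
      .push .atoms (.lit 0) (.var .e)).run h.tick, rfl, ?_, fun r hr hr' hr'' => ?_, ?_,
      fun y => ?_, fun k hk => ?_, fun k hk => ?_, ?_, ?_, rfl, rfl⟩
    · simp [Cmd.run, incr, hee, he]
    · simp [Cmd.run, incr, hr, hr', hr'']
    · simp [Cmd.run, incr, hi, encodeList]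
    · simp [Cmd.run, incr, hee, he]
    · funext y; simp [Cmd.run, incr, hk]
    · funext y; simp [Cmd.run, incr, hk]
    · simp [Cmd.run, incr, hee, he]
    · simp [Cmd.run, incr, hi, encodeList]
  have hvars1 : h1.L .vars e = [] := by
    rw [L1 _ (by simp), List.eq_nil_iff_forall_not_mem]
    intro x hx
    have := Finset.mem_Icc.1 (hh.mem_Icc e x hx)
    omega
  have hlast1 : LastInv e h1 := by
    refine ⟨fun x => ?_, fun x => ?_, by simp [hvars1]⟩ <;> rw [A1 _ (by simp)] <;>
      have := hh.last x
    · omega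
    · simp [hvars1]; omega
  rw [r1, len1]
  obtain ⟨l2, A2, m2, w2, o2, L2, v2, t2, tl2, i2, u2, c2⟩ := iterate_readVar e l hlast1 ev1 i1
  generalize (fun g => readVar.run g.tick)^[l.length] h1 = g at *
  have gv : ∀ r, r ≠ .e → r ≠ .x → r ≠ .len → r ≠ .tot → g.v r = h.v r :=
    fun r h1 h2 h3 h4 => (v2 r h2 h4).trans (v1 r h1 h2 h3)
  have gA : ∀ k, k ≠ .last → k ≠ .bucket → g.A k = h.A k := fun k h1 h2 => (A2 k h1).trans (A1 k h2)
  have gL : ∀ k, k ≠ .vars → k ≠ .occ → k ≠ .atoms → g.L k = h.L k :=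
    fun k h1 h2 h3 => (L2 k h1 h2).trans (L1 k h3)
  have mem_e : ∀ x, x ∈ g.L .vars e ↔ x ∈ l := fun x => by simp [m2, hvars1]
  have vars_ne : ∀ y, y ≠ e → g.L .vars y = h.L .vars y := fun y hy => by
    rw [w2 y hy, L1 _ (by simp)]
  have occ : ∀ x, g.L .occ x = if x ∈ l then e :: h.L .occ x else h.L .occ x := fun x => by
    rw [o2, hvars1, L1 _ (by simp)]; simp
  have hIcc : ∀ y, y ∈ Finset.Icc 1 e ↔ y = e ∨ y ∈ Finset.Icc 1 as.length := fun y => by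
    simp only [Finset.mem_Icc]; omega
  have he_occ : ∀ x, e ∉ h.L .occ x := fun x hx => by
    have := Finset.mem_Icc.1 (hh.mem_Icc e x ((hh.occ x e).1 hx))
    omega
  have hatoms : g.L .atoms 0 = e :: h.L .atoms 0 := by rw [L2 _ (by simp) (by simp), at1]
  refine ⟨?_, ?_, ?_, fun y => ?_, fun i l' hi x => ?_, fun y x hx => ?_, fun x => ?_,
    fun x y => ?_, ?_, ?_, fun y hy => ?_, ?_, fun y => ?_, ?_, fun r hr => ?_, ?_, ?_,
    fun k hk j => ?_, ?_, i2, ?_⟩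
  · rw [hlen, v2 _ (by simp) (by simp), ev1]
  · rw [gv _ (by simp) (by simp) (by simp) (by simp), hh.cnt]
  · rw [hlen]; exact l2.le
  · by_cases hy : y = e
    · rw [hy]; exact l2.nodup
    · rw [vars_ne y hy]; exact hh.vars_nodup y
  · rcases lt_trichotomy i as.length with hlt | rfl | hlt
    · rw [List.getElem?_append_left hlt] at hi
      rw [vars_ne _ (by omega)]
      exact hh.vars i l' hi x
    · rw [List.getElem?_concat_length, Option.some.injEq] at hi
      rw [← hi]
      exact mem_e x
    · rw [List.getElem?_eq_none (by rw [hlen]; omega)] at hi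
      cases hi
  · rw [hlen, hIcc]
    by_cases hy : y = e
    · exact .inl hy
    · rw [vars_ne y hy] at hx
      exact .inr (hh.mem_Icc y x hx)
  · rw [occ]
    split_ifs
    · exact List.nodup_cons.2 ⟨he_occ x, hh.occ_nodup x⟩
    · exact hh.occ_nodup x
  · rw [occ]
    by_cases hy : y = e
    · subst hy
      rw [mem_e]
      split_ifs with hx
      · simp [hx]
      · simp [hx, he_occ]
    · rw [vars_ne y hy, ← hh.occ]
      split_ifs
      · simp [hy]
      · rfl
  · rw [hlen, he, Finset.sum_Icc_succ_top (by omega), ← he]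
    have : ∑ y ∈ Finset.Icc 1 as.length, (g.L .vars y).length = h.v .tot := by
      rw [← hh.tot]
      refine Finset.sum_congr rfl fun y hy => ?_
      have := Finset.mem_Icc.1 hy
      rw [vars_ne y (by omega)]
    rw [this]
    rw [hvars1, v1 .tot (by simp) (by simp) (by simp), List.length_nil] at t2
    omega
  · have := hh.tot_le
    rw [v1 .tot (by simp) (by simp) (by simp)] at tl2
    omega
  · rw [hlen, hIcc] at hy
    rw [A2 _ (by simp), b1]
    split_ifs with hye
    · rfl
    · exact hh.bucket y (hy.resolve_left hye)
  · rw [hatoms]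
    refine List.nodup_cons.2 ⟨fun hx => ?_, hh.atoms_nodup⟩
    have := Finset.mem_Icc.1 ((hh.atoms e).1 hx)
    omega
  · rw [hatoms, hlen, hIcc, List.mem_cons, hh.atoms]
  · rw [gA _ (by simp) (by simp)]; exact hh.isFree
  · rw [← hh.zero r hr]
    apply gv <;> rintro rfl <;> simp at hr
  · rw [gA _ (by simp) (by simp)]; exact hh.owner
  · rw [gA _ (by simp) (by simp)]; exact hh.done
  · rw [← hh.nil k hk j, gL] <;> rintro rfl <;> simp at hk
  · rw [u2, o1, hh.out]
  · have := hh.time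
    rw [hlen, hsum]
    omega

theorem Reading.iterate {zs : List ℕ} {c T : ℕ} {rest : List ℕ} (todo : List (ℕ × List ℕ)) :
    ∀ {as : List (List ℕ)} {h : Store},
    Reading zs c T as ((todo.flatMap fun a => a.1 :: encodeList a.2) ++ rest) h →
    Reading zs c T (as ++ todo.map Prod.snd) rest
      ((fun g => readAtom.run g.tick)^[todo.length] h) := by
  induction todo with
  | nil => intro as h hh; simpa using hh
  | cons a todo ih =>
    intro as h hh
    rw [List.flatMap_cons, List.append_assoc] at hh
    have := ih hh.snoc
    rwa [List.append_assoc] at this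

theorem run_readHead {l rest : List ℕ} {c : ℕ} :
    Reading l c l.length [] rest
      ((Cmd.read .cnt).run (readHead.run (.init (encodeList l ++ c :: rest)))) := by
  set h0 := (Cmd.read .len).run (Store.init (encodeList l ++ c :: rest)) with hh0
  have hlen : h0.v .len = l.length := by simp [hh0, Cmd.run, encodeList, Store.init]
  have hinp : h0.inp = l ++ c :: rest := by simp [hh0, Cmd.run, encodeList, Store.init]
  have hv0 : ∀ r, r ≠ .len → h0.v r = 0 := fun r hr => by
    simp [hh0, Cmd.run, Store.init, hr]
  have hA0 : ∀ k x, h0.A k x = 0 := fun _ _ => rfl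
  have hL0 : ∀ k x, h0.L k x = [] := fun _ _ => rfl
  obtain ⟨A1, f1, L1, v1, i1, o1, t1⟩ := iterate_readHead l hinp
  have hrun : readHead.run (.init (encodeList l ++ c :: rest)) =
      (fun g => (Cmd.read .x ;; .put .isFree (.var .x) (.lit 1)).run g.tick)^[l.length] h0 := by
    rw [← hlen]; rfl
  rw [hrun]
  generalize (fun g => (Cmd.read .x ;; .put .isFree (.var .x) (.lit 1)).run g.tick)^[l.length] h0
    = h1 at *
  set g := (Cmd.read .cnt).run h1 with hg
  have gA : g.A = h1.A := rfl
  have gL : g.L = h0.L := L1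
  have gv : ∀ r, r ≠ .cnt → r ≠ .x → r ≠ .len → g.v r = 0 := fun r hr hr' hr'' => by
    rw [← hv0 r hr'', ← v1 r hr']; simp [hg, Cmd.run, hr]
  have gcnt : g.v .cnt = c := by simp [hg, Cmd.run, i1]
  refine ⟨by simp [gv], gcnt, ?_, ?_, by simp, ?_, ?_, ?_, ?_, ?_, by simp, ?_, ?_, ?_, ?_, ?_, ?_,
    ?_, o1, ?_, ?_⟩
  · simp [gA, A1, hA0]
  · simp [gL, hL0]
  · simp [gL, hL0]
  · simp [gL, hL0]
  · simp [gL, hL0]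
  · simp [gv]
  · simp [gv]
  · simp [gL, hL0]
  · simp [gL, hL0]
  · simp [gA, f1, hA0]
  · rintro r (rfl | rfl | rfl | rfl | rfl) <;> simp [gv]
  · simp [gA, A1, hA0]
  · simp [gA, A1, hA0]
  · simp [gL, hL0]
  · simp [hg, Cmd.run, i1]
  · have : g.time = h1.time := rfl
    rw [this, t1]
    simp [hh0, Cmd.run, Store.init]

/-- The effect of the part of the program that reads the query. -/
theorem run_read (Q : CQ σ) : ∃ D h, readBody.run (readHead.run (.init Q.encode)) = h ∧
    D.Of Q ∧ D.Valid ∧ Loaded D h ∧ D.tot ≤ Q.size ∧ D.d ≤ Q.size ∧ h.time ≤ 2 * Q.size := by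
  set todo := Q.body.map fun α => (α.rel, α.args) with htodo
  have henc : Q.encode = encodeList Q.head ++ Q.body.length ::
      ((todo.flatMap fun a => a.1 :: encodeList a.2) ++ []) := by
    rw [CQ.encode, htodo, List.flatMap_map, List.append_nil]
  have hlen : todo.length = Q.body.length := by simp [htodo]
  have h0 := run_readHead (l := Q.head) (c := Q.body.length)
    (rest := (todo.flatMap fun a => a.1 :: encodeList a.2) ++ [])
  rw [← henc] at h0
  have h1 := h0.iterate
  rw [List.nil_append] at h1
  set as := todo.map Prod.snd with has
  have hrun : readBody.run (readHead.run (.init Q.encode)) =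
      (fun g => readAtom.run g.tick)^[todo.length]
        ((Cmd.read .cnt).run (readHead.run (.init Q.encode))) := by
    rw [hlen, ← h0.cnt]; rfl
  rw [← hrun] at h1
  generalize readBody.run (readHead.run (.init Q.encode)) = h at *
  have haslen : as.length = Q.body.length := by simp [has, hlen]
  have has' : as = Q.body.map Atom.args := by simp [has, htodo]
  have hsum : (as.map List.length).sum = (Q.body.map fun α => σ.ar α.rel).sum := by
    rw [has', List.map_map]
    exact congrArg List.sum (List.map_congr_left fun α _ => α.args_length)
  -- Positive arities bound the number of atoms by ‖Q‖.
  have hle : Q.body.length ≤ (Q.body.map fun α => σ.ar α.rel).sum := by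
    have := List.length_le_sum_of_one_le (Q.body.map fun α => σ.ar α.rel) (by
      simp only [List.mem_map]
      rintro _ ⟨α, -, rfl⟩
      exact σ.ar_pos _ α.rel_mem)
    simpa using this
  have hsize : Q.size = Q.head.length + (Q.body.map fun α => σ.ar α.rel).sum := rfl
  have hget : ∀ i α, Q.body[i]? = some α → ∀ x, x ∈ h.L .vars (i + 1) ↔ x ∈ α.vars := by
    intro i α hi x
    rw [h1.vars i α.args (by simp [has', hi]), Atom.vars, List.mem_toFinset]
  refine ⟨⟨Q.body.length, h.v .tot, h.L .vars, h.L .occ, h.A .isFree, Q.head⟩, h, rfl,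
    ⟨rfl, hget, rfl⟩, ⟨h1.vars_nodup, h1.occ_nodup, fun x y => ?_, fun x => (h1.isFree x).symm,
      fun x hx => ?_, haslen ▸ h1.tot⟩, ⟨⟨rfl, rfl, rfl, h1.atoms_nodup, haslen ▸ h1.atoms, h1.cnt,
      rfl⟩, h1.zero, haslen ▸ h1.bucket, h1.owner, h1.done, h1.nil _ (by simp), h1.nil _ (by simp) 0,
      h1.nil _ (by simp) 0, h1.out⟩, ?_, ?_, ?_⟩
  · rw [h1.occ]
    exact ⟨fun hx => ⟨haslen ▸ h1.mem_Icc y x hx, hx⟩, And.right⟩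
  · obtain ⟨α, hα, hxα⟩ := Q.head_subset x ((h1.isFree x).1 hx)
    obtain ⟨i, hi⟩ := List.mem_iff_getElem?.1 hα
    have hlt := (List.getElem?_eq_some_iff.1 hi).1
    exact ⟨i + 1, Finset.mem_Icc.2 ⟨by omega, by change _ ≤ Q.body.length; omega⟩,
      (hget i α hi x).2 hxα⟩
  · have := h1.tot_le
    change h.v .tot ≤ _
    omega
  · change Q.body.length ≤ _
    omega
  · have := h1.time
    omega

end FCQ

theorem mainTheorem9 :
    ∃ (p : RAM.Prog) (c : ℕ), ∀ (σ : FCQ.Schema) (Q : FCQ.CQ σ), Q.IsFreeConnexAcyclic →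
      ∃ (t : ℕ) (w : List ℕ) (n : ℕ) (H : FCQ.FC1GHD Q (Fin n)),
        RAM.Computes p Q.encode t w ∧ t ≤ c * Q.size ∧ H.Represents w ∧
        H.IsComplete ∧
        (Q.free.Nonempty → H.witness.card < 2 * Q.free.card) ∧
        (Q.free = ∅ → H.witness.card = 1) ∧
        (∀ u v : Fin n, H.tree.Adj u v → H.bag u ⊆ H.bag v ∨ H.bag v ⊆ H.bag u) := by
  obtain ⟨K, hK⟩ := FCQ.program.computes
  -- With tot, d and the length of the head at most ‖Q‖, and ‖Q‖ ≥ 1, the clock plus one is at most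
  -- (2 + 30 + 14 + 2 + 6) ‖Q‖: reading, then the terms of the bound for the search, the last one
  -- being the constant 5 + 1.
  refine ⟨FCQ.program.comp 0, K * 54, fun σ Q hQ => ?_⟩
  obtain ⟨D, h, hh, hDQ, hD, hL, htot, hd, ht⟩ := FCQ.run_read Q
  obtain ⟨htime, H, h1, h2, h3, h4, h5⟩ := FCQ.run_search hQ hDQ hD hL
  have hrun : FCQ.program.run (.init Q.encode) = FCQ.search.run h := by rw [← hh]; rfl
  obtain ⟨t, hc, hle⟩ := hK Q.encode
  rw [hrun] at hc hle
  refine ⟨t, _, _, H, hc, hle.trans ?_, h1, h2, h3, h4, h5⟩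
  have hpos : 0 < D.d := by
    rw [hDQ.d_eq]; exact List.length_pos_iff.2 Q.body_ne_nil
  have hhead : Q.head.length ≤ Q.size := Nat.le_add_right _ _
  rw [Nat.mul_assoc]
  exact Nat.mul_le_mul_left _ (by omega)
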